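/- Let $\mathrm{M}$ be a loopless matroid of rank $d$ on a finite set $E$, and let $i\in E$. The Chow ring of $\mathrm{M}$ is the graded $\mathbb{Q}$-algebra $$\mathrm{CH}(\mathrm{M})=\mathbb{Q}[x_F \mid F \text{ a nonempty proper flat of } \mathrm{M}]/(I+J),$$ where $I$ is generated by the forms $\sum_{F\ni i_1}x_F-\sum_{F\ni i_2}x_F$ for distinct $i_1,i_2\in E$, and $J$ by the products $x_{F_1}x_{F_2}$ for incomparable $F_1,F_2$. There is a unique linear map $\deg:\mathrm{CH}^{d-1}(\mathrm{M})\to\mathbb{Q}$ that sends $\prod_{F\in\mathscr{F}}x_F$ to $1$ for every complete flag $\mathscr{F}$ of nonempty proper flats; the Poincaré pairing of elements $\eta_1,\eta_2$ of complementary degrees ($k$ and $d-1-k$) is $\deg(\eta_1\eta_2)$. Let $\theta_i:\mathrm{CH}(\mathrm{M}\setminus i)\to\mathrm{CH}(\mathrm{M})$ be the graded algebra homomorphism $x_F\mapsto x_F+x_{F\cup i}$, where $x_S=0$ if $S$ is not a nonempty proper flat of $\mathrm{M}$; it makes $\mathrm{CH}(\mathrm{M})$ a $\mathrm{CH}(\mathrm{M}\setminus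 i)$-module. Let $\mathrm{CH}_{(i)}$ be its image, and let $\mathscr{S}_i$ be the set of nonempty proper subsets $F$ of $E\setminus i$ such that $F$ and $F\cup i$ are both flats of $\mathrm{M}$. (1) If $i$ is not a coloop of $\mathrm{M}$, then $$\mathrm{CH}(\mathrm{M})=\mathrm{CH}_{(i)}\oplus\bigoplus_{F\in\mathscr{S}_i}x_{F\cup i}\,\mathrm{CH}_{(i)},$$ every summand is an indecomposable graded $\mathrm{CH}(\mathrm{M}\setminus i)$-module, and any two distinct summands are orthogonal for the Poincaré pairing. (2) If $i$ is a coloop of $\mathrm{M}$, then $$\mathrm{CH}(\mathrm{M})=\mathrm{CH}_{(i)}\oplus x_{E\setminus i}\,\mathrm{CH}_{(i)}\oplus\bigoplus_{F\in\mathscr{S}_i}x_{F\cup i}\,\mathrm{CH}_{(i)},$$ and every summand is an indecomposable graded $\mathrm{CH}(\mathrm{M}\setminus i)$-module, except that the second summand is zero when $E=\{i\}$. Any two distinct summands other than the pair of the first two are orthogonal for the Poincaré pairing; the first two are not orthogonal when $E\neq\{i\}$. (3) There are isomorphisms of graded $\mathrm{CH}(\mathrm{M}\setminus i)$-modules $\mathrm{CH}_{(i)}\cong\mathrm{CH}(\mathrm{M}\setminus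 i)$ and, for $F\in\mathscr{S}_i$, $x_{F\cup i}\,\mathrm{CH}_{(i)}\cong\mathrm{CH}(\mathrm{M}_{F\cup i})\otimes_{\mathbb{Q}}\mathrm{CH}(\mathrm{M}^F)[-1]$; if $i$ is a coloop and $E\ne\{i\}$, also $x_{E\setminus i}\,\mathrm{CH}_{(i)}\cong\mathrm{CH}(\mathrm{M}\setminus i)[-1]$. Here $[-1]$ raises all degrees by one, $\mathrm{M}_{F\cup i}$ is the contraction of $\mathrm{M}$ by $F\cup i$, $\mathrm{M}^F$ is the restriction of $\mathrm{M}$ to $F$, and $\mathrm{CH}(\mathrm{M}\setminus i)$ acts on the tensor product through the algebra homomorphism that sends $x_G$ to $1\otimes x_G$ if $G\subsetneq F$, to $x_{G\setminus F}\otimes 1$ if $G\supsetneq F$ (which is $0$ if $G\setminus F$ is not a flat of $\mathrm{M}_{F\cup i}$), to $0$ if $G$ and $F$ are incomparable, and $x_F$ to $-1\otimes\sum_{j\in G}x_G-\sum_{l\notin G}x_G\otimes1$ for any $j\in F$ and $l\in E\setminus(F\cup i)$, the sums being over nonempty proper flats of $\mathrm{M}^F$ and of $\mathrm{M}_{F\cup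 i}$ respectively. -/

import Mathlib

open scoped TensorProduct Matroid

namespace MatroidChow

universe u

variable {α : Type u}

/-- The nonempty proper flats of a matroid, ordered by inclusion. -/
abbrev PFlat (M : Matroid α) : Type u :=
  {F : Set α // M.IsFlat F ∧ F.Nonempty ∧ F ≠ M.E}

/-- The linear form `∑_{j ∈ F} x_F` in the polynomial ring on the nonempty proper flats
(a finite sum when the ground set is finite). -/
noncomputable def linForm (M : Matroid α) (j : α) : MvPolynomial (PFlat M) ℚ :=
  ∑ᶠ (F : PFlat M) (_ : j ∈ F.1), MvPolynomial.X F

/-- The ideal generated by the differences of the linear forms `∑_{j ∈ F} x_F`, for `j ∈ E`. -/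
noncomputable def linIdeal (M : Matroid α) : Ideal (MvPolynomial (PFlat M) ℚ) :=
  Ideal.span {p | ∃ j₁ ∈ M.E, ∃ j₂ ∈ M.E, j₁ ≠ j₂ ∧ p = linForm M j₁ - linForm M j₂}

/-- The ideal generated by the products `x_F x_G` for incomparable `F` and `G`. -/
noncomputable def monIdeal (M : Matroid α) : Ideal (MvPolynomial (PFlat M) ℚ) :=
  Ideal.span {p | ∃ F G : PFlat M, ¬ F ≤ G ∧ ¬ G ≤ F ∧
    p = MvPolynomial.X F * MvPolynomial.X G}

/-- The Chow ring of a matroid, with rational coefficients. -/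
def CH (M : Matroid α) : Type u :=
  MvPolynomial (PFlat M) ℚ ⧸ (linIdeal M + monIdeal M)

noncomputable instance instCommRingCH (M : Matroid α) : CommRing (CH M) :=
  inferInstanceAs (CommRing (MvPolynomial (PFlat M) ℚ ⧸ (linIdeal M + monIdeal M)))

noncomputable instance instAlgebraCH (M : Matroid α) : Algebra ℚ (CH M) :=
  inferInstanceAs (Algebra ℚ (MvPolynomial (PFlat M) ℚ ⧸ (linIdeal M + monIdeal M)))

/-- The quotient map from the polynomial ring to the Chow ring. -/
noncomputable def toCH (M : Matroid α) : MvPolynomial (PFlat M) ℚ →ₐ[ℚ] CH M :=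
  Ideal.Quotient.mkₐ ℚ (linIdeal M + monIdeal M)

open Classical in
/-- The class `x_S`, which is zero if `S` is not a nonempty proper flat of `M`. -/
noncomputable def x (M : Matroid α) (S : Set α) : CH M :=
  if h : M.IsFlat S ∧ S.Nonempty ∧ S ≠ M.E then toCH M (MvPolynomial.X ⟨S, h⟩) else 0

/-- The graded piece `CH^k`: classes of homogeneous polynomials of degree `k`. -/
noncomputable def gr (M : Matroid α) (k : ℕ) : Submodule ℚ (CH M) :=
  (MvPolynomial.homogeneousSubmodule (PFlat M) ℚ k).map (toCH M).toLinearMap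

/-! ### The pullback along a deletion -/

theorem x_of_pflat (M : Matroid α) (F : PFlat M) : x M F.1 = toCH M (MvPolynomial.X F) := by
  simp [x, F.2]

theorem x_of_not (M : Matroid α) {S : Set α} (h : ¬ (M.IsFlat S ∧ S.Nonempty ∧ S ≠ M.E)) :
    x M S = 0 := by
  simp only [x, dif_neg h]

theorem x_mul_x (M : Matroid α) {S T : Set α} (h₁ : ¬ S ⊆ T) (h₂ : ¬ T ⊆ S) :
    x M S * x M T = 0 := by
  by_cases hS : M.IsFlat S ∧ S.Nonempty ∧ S ≠ M.E
  swap
  · rw [x_of_not M hS, zero_mul]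
  by_cases hT : M.IsFlat T ∧ T.Nonempty ∧ T ≠ M.E
  swap
  · rw [x_of_not M hT, mul_zero]
  rw [x_of_pflat M ⟨S, hS⟩, x_of_pflat M ⟨T, hT⟩, ← map_mul]
  refine Ideal.Quotient.eq_zero_iff_mem.2 (Ideal.mem_sup_right (Ideal.subset_span ?_))
  exact ⟨⟨S, hS⟩, ⟨T, hT⟩, h₁, h₂, rfl⟩

theorem toCH_linForm (M : Matroid α) {j₁ j₂ : α} (h₁ : j₁ ∈ M.E) (h₂ : j₂ ∈ M.E) :
    toCH M (linForm M j₁) = toCH M (linForm M j₂) := by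
  by_cases h : j₁ = j₂
  · rw [h]
  rw [← sub_eq_zero, ← map_sub]
  refine Ideal.Quotient.eq_zero_iff_mem.2 (Ideal.mem_sup_left (Ideal.subset_span ?_))
  exact ⟨j₁, h₁, j₂, h₂, h, rfl⟩

theorem finite_pflat (M : Matroid α) [M.Finite] : Finite (PFlat M) :=
  Set.Finite.to_subtype
    (M.ground_finite.finite_subsets.subset fun _ hF => hF.1.subset_ground)

open Classical in
theorem map_linForm (M : Matroid α) [M.Finite] {A : Type*} [CommRing A] [Algebra ℚ A]
    (φ : MvPolynomial (PFlat M) ℚ →ₐ[ℚ] A) (f : Set α → A)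
    (hf : ∀ F : PFlat M, φ (MvPolynomial.X F) = f F.1) (j : α) (E : Finset α) (hE : ↑E = M.E)
    (h0 : ∀ S ⊆ M.E, ¬ (M.IsFlat S ∧ S.Nonempty ∧ S ≠ M.E) → j ∈ S → f S = 0) :
    φ (linForm M j) = ∑ T ∈ E.powerset, if j ∈ T then f ↑T else 0 := by
  have := finite_pflat M
  have : Fintype (PFlat M) := Fintype.ofFinite _
  have e1 : φ (linForm M j) = ∑ F : PFlat M, if j ∈ F.1 then f F.1 else 0 := by
    rw [linForm, finsum_eq_sum_of_fintype, map_sum]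
    refine Finset.sum_congr rfl fun F _ => ?_
    by_cases h : j ∈ F.1 <;> simp [h, hf]
  rw [e1]
  have hfin : ∀ F : PFlat M, F.1.Finite := fun F =>
    M.ground_finite.subset F.2.1.subset_ground
  refine Finset.sum_of_injOn (fun F => (hfin F).toFinset) ?_ ?_ ?_ ?_
  · intro F _ G _ h
    apply Subtype.ext
    simpa using h
  · intro F _
    simp only [Finset.coe_powerset, Set.mem_preimage, Set.mem_powerset_iff, Set.Finite.coe_toFinset]
    rw [hE]
    exact F.2.1.subset_ground
  · intro T hT hn
    split_ifs with hj
    swap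
    · rfl
    refine h0 T ?_ ?_ hj
    · rw [← hE]
      exact_mod_cast Finset.mem_powerset.1 hT
    · intro hF
      exact hn ⟨⟨↑T, hF⟩, by simp, by simp⟩
  · intro F _
    simp

theorem isFlat_delete (M : Matroid α) (i : α) {T G : Set α} (hG : M.IsFlat G)
    (hT : T = G \ {i}) : (M ＼ {i}).IsFlat T := by
  rw [Matroid.isFlat_iff_closure_eq, Matroid.delete_closure_eq]
  subst hT
  refine subset_antisymm (Set.sdiff_subset_sdiff_left ?_) ?_
  · conv_rhs => rw [← hG.closure]
    exact M.closure_subset_closure (Set.sdiff_subset.trans Set.sdiff_subset)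
  · intro a ha
    refine ⟨M.subset_closure _ (Set.sdiff_subset.trans (Set.sdiff_subset.trans
      hG.subset_ground)) ⟨ha, ha.2⟩, ha.2⟩

/-- The polynomial form of the pullback along the deletion: `x_F ↦ x_F + x_{F ∪ i}`. -/
noncomputable def thetaPoly (M : Matroid α) (i : α) :
    MvPolynomial (PFlat (M ＼ {i})) ℚ →ₐ[ℚ] CH M :=
  MvPolynomial.aeval fun F => x M F.1 + x M (insert i F.1)

open Classical in
theorem thetaPoly_linForm (M : Matroid α) [M.Finite] (i j : α) (hj : j ∈ (M ＼ {i}).E) :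
    thetaPoly M i (linForm (M ＼ {i}) j) = toCH M (linForm M j) - x M (M.E \ {i}) := by
  obtain ⟨E, hE⟩ := M.ground_finite.exists_finset_coe
  have hE' : ((E.erase i : Finset α) : Set α) = (M ＼ {i}).E := by
    simp [hE]
  have hji : j ≠ i := hj.2
  have hjE : j ∈ M.E := hj.1
  let f : Set α → CH M := fun S =>
    if S = M.E \ {i} then 0 else x M S + x M (insert i S)
  rw [map_linForm (M ＼ {i}) (thetaPoly M i) f ?_ j _ hE' ?_,
    map_linForm M (toCH M) (x M) (fun F => (x_of_pflat M F).symm) j E hE ?_]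
  · have hs : ∀ T ∈ (E.erase i).powerset, (if j ∈ T then f ↑T else 0) =
        (if j ∈ T then x M ↑T else 0) +
          (if j ∈ T then x M (insert i (T : Set α)) else 0) -
          (if T = E.erase i then x M (M.E \ {i}) else 0) := by
      intro T hT
      by_cases hTE : T = E.erase i
      · subst hTE
        have hjm : j ∈ E.erase i := by
          rw [← Finset.mem_coe, hE']
          exact hj
        have h0 : x M (insert i (M.E \ {i})) = 0 := by
          apply x_of_not
          rintro ⟨h1, -, h3⟩
          have hi : i ∈ M.E := h1.subset_ground (Set.mem_insert _ _)
          exact h3 (by rw [Set.insert_sdiff_singleton, Set.insert_eq_of_mem hi])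
        have hc : ((E.erase i : Finset α) : Set α) = M.E \ {i} := hE'
        simp only [if_pos hjm, if_true, hc, f, h0]
        simp
      · have hc : (T : Set α) ≠ M.E \ {i} := by
          intro h
          apply hTE
          rw [← Finset.coe_inj, h, hE']
          rfl
        simp only [f, if_neg hc, if_neg hTE, sub_zero]
        split_ifs <;> simp
    rw [Finset.sum_congr rfl hs, Finset.sum_sub_distrib, Finset.sum_add_distrib,
      Finset.sum_ite_eq' , if_pos (Finset.mem_powerset_self _)]
    congr 1
    by_cases hi : i ∈ E
    · conv_rhs => rw [← Finset.insert_erase hi,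
        Finset.sum_powerset_insert (Finset.notMem_erase i E)]
      congr 1
      refine Finset.sum_congr rfl fun T _ => ?_
      simp [hji]
    · rw [Finset.erase_eq_of_notMem hi]
      convert add_zero _
      refine Finset.sum_eq_zero fun T _ => ?_
      rw [x_of_not M (S := insert i (T : Set α)), ite_self]
      rintro ⟨h1, -, -⟩
      apply hi
      rw [← Finset.mem_coe, hE]
      exact h1.subset_ground (Set.mem_insert _ _)
  · intro S _ hS _
    exact x_of_not M hS
  · intro F
    have : F.1 ≠ M.E \ {i} := F.2.2.2
    simp [thetaPoly, f, this]
  · intro S hSE hS hjS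
    by_cases hc : S = M.E \ {i}
    · simp [f, hc]
    have hiS : i ∉ S := fun h => (hSE h).2 rfl
    have hnf : ¬ (M ＼ {i}).IsFlat S := fun h => hS ⟨h, ⟨j, hjS⟩, hc⟩
    simp only [f, if_neg hc]
    rw [x_of_not M, x_of_not M, add_zero]
    · rintro ⟨h1, -, -⟩
      exact hnf (isFlat_delete M i h1 (by simp [hiS]))
    · rintro ⟨h1, -, -⟩
      exact hnf (isFlat_delete M i h1 (by simp [hiS]))

theorem thetaPoly_eq_zero (M : Matroid α) [M.Finite] (i : α)
    (p : MvPolynomial (PFlat (M ＼ {i})) ℚ)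
    (hp : p ∈ linIdeal (M ＼ {i}) + monIdeal (M ＼ {i})) : thetaPoly M i p = 0 := by
  have h : linIdeal (M ＼ {i}) + monIdeal (M ＼ {i}) ≤ RingHom.ker (thetaPoly M i) := by
    refine sup_le (Ideal.span_le.2 ?_) (Ideal.span_le.2 ?_)
    · rintro _ ⟨j₁, h₁, j₂, h₂, -, rfl⟩
      rw [SetLike.mem_coe, RingHom.mem_ker, map_sub, thetaPoly_linForm M i j₁ h₁,
        thetaPoly_linForm M i j₂ h₂, toCH_linForm M h₁.1 h₂.1, sub_self]
    · rintro _ ⟨F, G, h₁, h₂, rfl⟩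
      have hF : i ∉ F.1 := fun h => (F.2.1.subset_ground h).2 rfl
      have hG : i ∉ G.1 := fun h => (G.2.1.subset_ground h).2 rfl
      have h₁' : ¬ F.1 ⊆ G.1 := h₁
      have h₂' : ¬ G.1 ⊆ F.1 := h₂
      have k₁ : ¬ F.1 ⊆ insert i G.1 := fun h => h₁' ((Set.subset_insert_iff_of_notMem hF).1 h)
      have k₂ : ¬ G.1 ⊆ insert i F.1 := fun h => h₂' ((Set.subset_insert_iff_of_notMem hG).1 h)
      have l₁ : ¬ insert i F.1 ⊆ G.1 := fun h => hG (h (Set.mem_insert _ _))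
      have l₂ : ¬ insert i G.1 ⊆ F.1 := fun h => hF (h (Set.mem_insert _ _))
      have m₁ : ¬ insert i F.1 ⊆ insert i G.1 := fun h => k₁ ((Set.subset_insert _ _).trans h)
      have m₂ : ¬ insert i G.1 ⊆ insert i F.1 := fun h => k₂ ((Set.subset_insert _ _).trans h)
      rw [SetLike.mem_coe, RingHom.mem_ker]
      simp only [thetaPoly, map_mul, MvPolynomial.aeval_X]
      rw [add_mul, mul_add, mul_add, x_mul_x M h₁' h₂', x_mul_x M k₁ l₂, x_mul_x M l₁ k₂,
        x_mul_x M m₁ m₂]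
      simp
  exact h hp

/-- The homomorphism `θ_i : CH(M ∖ i) → CH(M)`, `x_F ↦ x_F + x_{F ∪ i}`. -/
noncomputable def theta (M : Matroid α) [M.Finite] (i : α) : CH (M ＼ {i}) →ₐ[ℚ] CH M :=
  Ideal.Quotient.liftₐ (linIdeal (M ＼ {i}) + monIdeal (M ＼ {i})) (thetaPoly M i)
    (thetaPoly_eq_zero M i)

theorem theta_x (M : Matroid α) [M.Finite] (i : α) (F : PFlat (M ＼ {i})) :
    theta M i (x (M ＼ {i}) F.1) = x M F.1 + x M (insert i F.1) := by
  rw [x_of_pflat (M ＼ {i}) F]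
  exact MvPolynomial.aeval_X _ _

/-- `CH(M)` as an algebra, hence a module, over `CH(M ∖ i)` through `θ_i`. -/
noncomputable instance instAlgebraDelete (M : Matroid α) [M.Finite] (i : α) :
    Algebra (CH (M ＼ {i})) (CH M) :=
  (theta M i).toRingHom.toAlgebra

/-! ### The summands -/

/-- `CH_(i)`, the image of `θ_i`, as a `CH(M ∖ i)`-submodule of `CH(M)`. -/
noncomputable def imTheta (M : Matroid α) [M.Finite] (i : α) :
    Submodule (CH (M ＼ {i})) (CH M) :=
  LinearMap.range (Algebra.linearMap (CH (M ＼ {i})) (CH M))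

/-- `x_S · CH_(i)` as a `CH(M ∖ i)`-submodule of `CH(M)`. -/
noncomputable def xImTheta (M : Matroid α) [M.Finite] (i : α) (S : Set α) :
    Submodule (CH (M ＼ {i})) (CH M) :=
  (imTheta M i).map (LinearMap.mulLeft (CH (M ＼ {i})) (x M S))

/-- The nonempty proper subsets `F` of `E ∖ i` such that `F` and `F ∪ i` are both flats. -/
def Si (M : Matroid α) (i : α) : Set (Set α) :=
  {F | F.Nonempty ∧ F ⊂ M.E \ {i} ∧ M.IsFlat F ∧ M.IsFlat (insert i F)}

/-- The summands when `i` is not a coloop. -/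
noncomputable def summand (M : Matroid α) [M.Finite] (i : α) :
    Option (Si M i) → Submodule (CH (M ＼ {i})) (CH M)
  | none => imTheta M i
  | some F => xImTheta M i (insert i F.1)

/-- The summands when `i` is a coloop: `none` is the first one, `some none` the second one. -/
noncomputable def summandColoop (M : Matroid α) [M.Finite] (i : α) :
    Option (Option (Si M i)) → Submodule (CH (M ＼ {i})) (CH M)
  | none => imTheta M i
  | some none => xImTheta M i (M.E \ {i})
  | some (some F) => xImTheta M i (insert i F.1)

/-- A submodule of `CH(M)` is graded if each of its elements is a finite sum of homogeneous
elements that lie in it. -/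
def IsGradedSubmodule (M : Matroid α) [M.Finite] (i : α)
    (N : Submodule (CH (M ＼ {i})) (CH M)) : Prop :=
  ∀ a ∈ N, ∃ c : ℕ →₀ CH M, (∀ k, c k ∈ N ∧ c k ∈ gr M k) ∧ a = c.sum fun _ b => b

/-- A nonzero submodule that is not the direct sum of two nonzero submodules, graded or not. -/
def IsIndecomposable {R V : Type*} [CommRing R] [AddCommGroup V] [Module R V]
    (N : Submodule R V) : Prop :=
  N ≠ ⊥ ∧ ∀ A B : Submodule R V, Disjoint A B → A ⊔ B = N → A = ⊥ ∨ B = ⊥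

open Classical in
/-- `V` is the internal direct sum of the submodules `N s`. -/
def IsDirectSum {R V ι : Type*} [CommRing R] [AddCommGroup V] [Module R V]
    (N : ι → Submodule R V) : Prop :=
  DirectSum.IsInternal N

/-! ### The Poincaré pairing -/

/-- `deg` is the degree map `CH^{d-1}(M) → ℚ`, extended by zero to the other degrees:
it sends the monomial of every complete flag of nonempty proper flats to `1`. -/
structure IsDegreeMap (M : Matroid α) (deg : CH M →ₗ[ℚ] ℚ) : Prop where
  eq_zero : ∀ k : ℕ, (k : ℕ∞) + 1 ≠ M.eRank → ∀ a ∈ gr M k, deg a = 0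
  flag : ∀ C : Finset (PFlat M), IsMaxChain (· ≤ ·) (C : Set (PFlat M)) →
    deg (∏ F ∈ C, x M F.1) = 1

/-- Orthogonality of two submodules for the pairing `(a, b) ↦ deg (a b)`. -/
def IsOrtho (M : Matroid α) [M.Finite] (i : α) (deg : CH M →ₗ[ℚ] ℚ)
    (N₁ N₂ : Submodule (CH (M ＼ {i})) (CH M)) : Prop :=
  ∀ a ∈ N₁, ∀ b ∈ N₂, deg (a * b) = 0

/-! ### The identification of the summands -/

/-- The graded piece of degree `k` of `CH(M) ⊗ CH(N)`. -/
noncomputable def grTensor (M N : Matroid α) (k : ℕ) : Submodule ℚ (CH M ⊗[ℚ] CH N) :=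
  ⨆ p ∈ Finset.HasAntidiagonal.antidiagonal k,
    Submodule.map₂ (TensorProduct.mk ℚ (CH M) (CH N)) (gr M p.1) (gr N p.2)

/-- `∑_{j ∈ G} x_G`, which is the class `α` of `M` for every `j ∈ E`. -/
noncomputable def alphaAt (M : Matroid α) (j : α) : CH M :=
  ∑ᶠ (G : PFlat M) (_ : j ∈ G.1), x M G.1

/-- `∑_{j ∉ G} x_G`, which is the class `β` of `M` for every `j ∈ E`. -/
noncomputable def betaAt (M : Matroid α) (j : α) : CH M :=
  ∑ᶠ (G : PFlat M) (_ : j ∉ G.1), x M G.1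

/-- `ρ` is the restriction homomorphism `CH(M ∖ i) → CH(M_{F ∪ i}) ⊗ CH(M^F)` through which
the tensor product is a `CH(M ∖ i)`-module, given by its values on all generators `x_G`. Here
`M_{F ∪ i}` is the contraction of `F ∪ i` and `M^F` is the localization at `F`. -/
structure IsRestriction (M : Matroid α) (i : α) (F : Set α)
    (ρ : CH (M ＼ {i}) →ₐ[ℚ] CH (M ／ (insert i F)) ⊗[ℚ] CH (M ↾ F)) : Prop where
  incomparable : ∀ G : PFlat (M ＼ {i}), ¬ G.1 ⊆ F → ¬ F ⊆ G.1 → ρ (x (M ＼ {i}) G.1) = 0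
  below : ∀ G : PFlat (M ＼ {i}), G.1 ⊂ F →
    ρ (x (M ＼ {i}) G.1) = 1 ⊗ₜ[ℚ] x (M ↾ F) G.1
  above : ∀ G : PFlat (M ＼ {i}), F ⊂ G.1 →
    ρ (x (M ＼ {i}) G.1) = x (M ／ (insert i F)) (G.1 \ F) ⊗ₜ[ℚ] 1
  self : ∀ j ∈ F, ∀ l ∈ M.E \ insert i F,
    ρ (x (M ＼ {i}) F) =
      - (1 ⊗ₜ[ℚ] alphaAt (M ↾ F) j) - betaAt (M ／ (insert i F)) l ⊗ₜ[ℚ] 1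

/-- An isomorphism of graded `CH(M ∖ i)`-modules `CH(M ∖ i)[-s] ≅ N`. -/
def IsoDelete (M : Matroid α) [M.Finite] (i : α) (s : ℕ)
    (N : Submodule (CH (M ＼ {i})) (CH M)) : Prop :=
  ∃ e : CH (M ＼ {i}) ≃ₗ[CH (M ＼ {i})] N,
    ∀ (k : ℕ) (a : CH (M ＼ {i})), a ∈ gr (M ＼ {i}) k ↔ (e a : CH M) ∈ gr M (k + s)

/-- An isomorphism of graded `CH(M ∖ i)`-modules
`CH(M_{F ∪ i}) ⊗ CH(M^F)[-1] ≅ x_{F ∪ i} · CH_(i)`. -/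
def IsoTensor (M : Matroid α) [M.Finite] (i : α) (F : Set α) : Prop :=
  ∃ ρ : CH (M ＼ {i}) →ₐ[ℚ] CH (M ／ (insert i F)) ⊗[ℚ] CH (M ↾ F),
    IsRestriction M i F ρ ∧
    ∃ e : (CH (M ／ (insert i F)) ⊗[ℚ] CH (M ↾ F)) ≃+ xImTheta M i (insert i F),
      (∀ a t, e (ρ a * t) = a • e t) ∧
      ∀ k t, t ∈ grTensor (M ／ (insert i F)) (M ↾ F) k ↔ (e t : CH M) ∈ gr M (k + 1)

end MatroidChow

/-! Over `CH(M ∖ i)` the Chow ring is generated by `1`, `x_{E ∖ i}` and the `x_{F ∪ i}` with `F ∈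
𝒮_i` (`span_generators`), so it is the sum of the asserted cyclic modules. That the sum is direct is
read off from the Poincaré pairing: an element that pairs to zero with everything has zero
components (`components_eq_zero`). The same fact proves Poincaré duality (`nondeg`) by induction on
`|E|`, because the argument for `M` uses duality only for `M ∖ i`, `M_{F ∪ i}` and `M^F`.

The summand of `F`: multiplying the linear relations of `M` by `x_{F ∪ i}` yields homomorphisms from
`CH(M_{F ∪ i})` and `CH(M^F)` to `CH(M) / Ann(x_{F ∪ i})`. The induced map `λ` on the tensor product
has the same image as `θ_i` (`lambda_range`), and `deg (x_F x_{F ∪ i} λ(t))` is the product degree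
of `t` (`deg_lambda`), so duality for the two minors makes `λ` injective. Hence the summand is the
tensor product shifted by one. It ends one degree below the top of `CH(M)`, and the degree map kills
it (`deg_x_insert_mul_theta`). This gives orthogonality to `CH_(i)`, and also to the other summands,
since `x_{F ∪ i} x_{G ∪ i} = θ(x_G) x_{F ∪ i}` for `F ⊂ G`. As `x_{F ∪ i}² = θ(x_F) x_{F ∪ i} - x_F
x_{F ∪ i}`, the pairing on the summand is minus the nondegenerate pairing of the tensor product.

The part `CH_(i)`: if `i` is not a coloop, `deg ∘ θ_i` is the degree map of `M ∖ i`. If `i` is a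
coloop and `E ≠ {i}`, then `deg ∘ θ_i = 0`, while `a ↦ deg (x_{E ∖ i} θ_i(a))` is the degree map of
`M ∖ i`, so the first two summands pair with each other. Duality for `M ∖ i` finishes both cases.

The degree map is built from the presentation. The functionals `p ↦ deg (x_s p)` are defined for all
flags `s` by recursion on the number of ranks that `s` misses. Compatibility with the linear
relations comes down to flags that miss one rank (`flagFam_balanced`), where the flats strictly
inside a gap `A ⊂ B` partition `B ∖ A`.

The summands are indecomposable because they are cyclic over a ring in which every element is a
scalar plus a nilpotent. -/

set_option linter.unusedSectionVars false

open scoped TensorProduct Matroid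

namespace MatroidChow

universe u

variable {α : Type u}

/-! ### Flats, ranks and flags -/

/-- `S` is a nonempty proper flat of `M`. -/
abbrev PF (M : Matroid α) (S : Set α) : Prop := M.IsFlat S ∧ S.Nonempty ∧ S ≠ M.E

/-- The rank of a set, as a natural number. -/
noncomputable def rk (M : Matroid α) (S : Set α) : ℕ := (M.eRk S).toNat

/-- The socle degree `rank - 1` of the Chow ring. -/
noncomputable def topDeg (M : Matroid α) : ℕ := rk M M.E - 1

/-- A flag of nonempty proper flats. -/
structure IsFlag (M : Matroid α) (s : Finset (Set α)) : Prop where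
  pf : ∀ S ∈ s, PF M S
  chain : ∀ S ∈ s, ∀ T ∈ s, S ⊆ T ∨ T ⊆ S

section Rank

variable (M : Matroid α)

theorem rk_empty : rk M ∅ = 0 := by simp [rk]

theorem rk_closure (S : Set α) : rk M (M.closure S) = rk M S := by
  simp [rk, Matroid.eRk_closure_eq]

theorem isFlat_empty [M.Loopless] : M.IsFlat ∅ := by
  rw [Matroid.isFlat_iff_closure_eq, Matroid.closure_empty, Matroid.loops_eq_empty]

theorem closure_insert_of_isFlat {A B : Set α} (hB : M.IsFlat B) (hAB : A ⊆ B) {e : α}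
    (he : e ∈ B) : M.closure (insert e A) ⊆ B := by
  rw [← hB.closure]
  exact M.closure_subset_closure (Set.insert_subset he hAB)

theorem subset_closure_insert {A : Set α} (hA : A ⊆ M.E) {e : α} (he : e ∈ M.E) :
    insert e A ⊆ M.closure (insert e A) :=
  M.subset_closure _ (Set.insert_subset he hA)

variable [M.Finite]

theorem coe_rk (S : Set α) : (rk M S : ℕ∞) = M.eRk S :=
  ENat.natCast_toNat (Matroid.eRk_ne_top_iff.2 (Matroid.RankFinite.isRkFinite S))

theorem rk_mono {S T : Set α} (h : S ⊆ T) : rk M S ≤ rk M T := by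
  have := M.eRk_mono h
  rw [← coe_rk, ← coe_rk] at this
  exact_mod_cast this

theorem rk_insert {S : Set α} {e : α} (he : e ∈ M.E) (h : e ∉ M.closure S) :
    rk M (insert e S) = rk M S + 1 := by
  have := Matroid.eRk_insert_eq_add_one (M := M) ⟨he, h⟩
  rw [← coe_rk, ← coe_rk] at this
  exact_mod_cast this

theorem rk_lt {S T : Set α} (hS : M.IsFlat S) (hT : T ⊆ M.E) (h : S ⊂ T) : rk M S < rk M T := by
  obtain ⟨e, heT, heS⟩ := Set.exists_of_ssubset h
  have h1 := rk_insert M (hT heT) (by rwa [hS.closure] : e ∉ M.closure S)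
  have h2 := rk_mono M (Set.insert_subset heT h.subset)
  omega

theorem eq_of_rk_le {S T : Set α} (hS : M.IsFlat S) (hT : T ⊆ M.E) (h : S ⊆ T)
    (hr : rk M T ≤ rk M S) : S = T := by
  by_contra hne
  exact absurd (rk_lt M hS hT (h.ssubset_of_ne hne)) (by omega)

theorem rk_pos [M.Loopless] {S : Set α} (hS : S ⊆ M.E) (h : S.Nonempty) : 0 < rk M S := by
  obtain ⟨e, he⟩ := h
  have h1 := rk_insert M (S := ∅) (hS he) (by
    rw [Matroid.closure_empty, Matroid.loops_eq_empty]; exact Set.notMem_empty e)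
  have h2 := rk_mono M (Set.insert_subset he (Set.empty_subset S))
  omega

end Rank

theorem exists_top_of_chain (s : Finset (Set α)) (hs : s.Nonempty)
    (hc : ∀ S ∈ s, ∀ T ∈ s, S ⊆ T ∨ T ⊆ S) : ∃ A ∈ s, ∀ S ∈ s, S ⊆ A := by
  obtain ⟨A, hA⟩ := s.exists_maximal hs
  refine ⟨A, hA.1, fun S hS => ?_⟩
  rcases hc S hS A hA.1 with h | h
  · exact h
  · exact hA.2 hS h

theorem exists_bot_of_chain (s : Finset (Set α)) (hs : s.Nonempty)
    (hc : ∀ S ∈ s, ∀ T ∈ s, S ⊆ T ∨ T ⊆ S) : ∃ A ∈ s, ∀ S ∈ s, A ⊆ S := by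
  obtain ⟨A, hA⟩ := s.exists_minimal hs
  refine ⟨A, hA.1, fun S hS => ?_⟩
  rcases hc S hS A hA.1 with h | h
  · exact hA.2 hS h
  · exact h

theorem IsFlag.mono {M : Matroid α} {s t : Finset (Set α)} (h : IsFlag M t) (hst : s ⊆ t) :
    IsFlag M s :=
  ⟨fun S hS => h.pf S (hst hS), fun S hS T hT => h.chain S (hst hS) T (hst hT)⟩

theorem isFlag_empty (M : Matroid α) : IsFlag M ∅ := ⟨by simp, by simp⟩

open Classical in
theorem isFlag_insert {M : Matroid α} {s : Finset (Set α)} {H : Set α} :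
    IsFlag M (insert H s) ↔ PF M H ∧ IsFlag M s ∧ ∀ S ∈ s, S ⊆ H ∨ H ⊆ S := by
  constructor
  · intro h
    exact ⟨h.pf H (Finset.mem_insert_self _ _), h.mono (Finset.subset_insert _ _),
      fun S hS => h.chain S (Finset.mem_insert_of_mem hS) H (Finset.mem_insert_self _ _)⟩
  · rintro ⟨h1, h2, h3⟩
    refine ⟨fun S hS => ?_, fun S hS T hT => ?_⟩
    · rcases Finset.mem_insert.1 hS with rfl | hS
      · exact h1
      · exact h2.pf S hS
    · rcases Finset.mem_insert.1 hS with hS' | hS' <;>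
        rcases Finset.mem_insert.1 hT with hT' | hT'
      · exact Or.inl (hS'.trans hT'.symm).subset
      · exact hS' ▸ (h3 T hT').symm
      · exact hT' ▸ h3 S hS'
      · exact h2.chain S hS' T hT'

/-! ### Completing flags, and the gap of a flag that misses one rank. -/

section Flags

open Classical in
theorem IsFlag.exists_missing_rank {M : Matroid α} {s : Finset (Set α)} (hc : s.card < topDeg M) :
    ∃ k ∈ Finset.Ico 1 (rk M M.E), ∀ S ∈ s, rk M S ≠ k := by
  obtain ⟨k, hk, hks⟩ := Finset.exists_mem_notMem_of_card_lt_card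
    (s := s.image (rk M)) (t := Finset.Ico 1 (rk M M.E))
    (by simpa [topDeg] using Finset.card_image_le.trans_lt hc)
  exact ⟨k, hk, fun S hS h => hks (Finset.mem_image.2 ⟨S, hS, h⟩)⟩

variable {M : Matroid α} [M.Finite]

theorem IsFlag.rk_injOn {s : Finset (Set α)} (h : IsFlag M s) : Set.InjOn (rk M) s := by
  intro S hS T hT hr
  rcases h.chain S hS T hT with h1 | h1
  · exact eq_of_rk_le M (h.pf S hS).1 (h.pf T hT).1.subset_ground h1 hr.ge
  · exact (eq_of_rk_le M (h.pf T hT).1 (h.pf S hS).1.subset_ground h1 hr.le).symm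

variable [M.Loopless]

theorem PF.rk_mem {S : Set α} (h : PF M S) : rk M S ∈ Finset.Ico 1 (rk M M.E) :=
  Finset.mem_Ico.2 ⟨rk_pos M h.1.subset_ground h.2.1,
    rk_lt M h.1 subset_rfl (h.1.subset_ground.ssubset_of_ne h.2.2)⟩

theorem IsFlag.card_le {s : Finset (Set α)} (h : IsFlag M s) : s.card ≤ topDeg M := by
  have := Finset.card_le_card_of_injOn (s := s) (t := Finset.Ico 1 (rk M M.E)) (rk M)
    (fun S hS => (h.pf S hS).rk_mem) h.rk_injOn
  simpa [topDeg] using this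

open Classical in
/-- If a flag misses the rank `k`, it splits into the parts below and above rank `k`. -/
theorem IsFlag.exists_split {s : Finset (Set α)} (h : IsFlag M s) {k : ℕ}
    (hk : k ∈ Finset.Ico 1 (rk M M.E)) :
    ∃ A B, M.IsFlat A ∧ M.IsFlat B ∧ (A = ∅ ∨ A ∈ s) ∧ (B = M.E ∨ B ∈ s) ∧ A ⊂ B ∧
      rk M A < k ∧ k < rk M B ∧ (∀ S ∈ s, rk M S < k → S ⊆ A) ∧ (∀ S ∈ s, k < rk M S → B ⊆ S) := by
  rw [Finset.mem_Ico] at hk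
  have hA : ∃ A, M.IsFlat A ∧ (A = ∅ ∨ A ∈ s) ∧ rk M A < k ∧ ∀ S ∈ s, rk M S < k → S ⊆ A := by
    by_cases hne : (s.filter fun S => rk M S < k).Nonempty
    · obtain ⟨A, hA, hmax⟩ := exists_top_of_chain _ hne fun S hS T hT =>
        h.chain S (Finset.mem_filter.1 hS).1 T (Finset.mem_filter.1 hT).1
      rw [Finset.mem_filter] at hA
      exact ⟨A, (h.pf A hA.1).1, Or.inr hA.1, hA.2, fun S hS hr =>
        hmax S (Finset.mem_filter.2 ⟨hS, hr⟩)⟩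
    · refine ⟨∅, isFlat_empty M, Or.inl rfl, by rw [rk_empty]; omega, fun S hS hr => ?_⟩
      exact absurd ⟨S, Finset.mem_filter.2 ⟨hS, hr⟩⟩ hne
  have hB : ∃ B, M.IsFlat B ∧ (B = M.E ∨ B ∈ s) ∧ k < rk M B ∧ ∀ S ∈ s, k < rk M S → B ⊆ S := by
    by_cases hne : (s.filter fun S => k < rk M S).Nonempty
    · obtain ⟨A, hA, hmax⟩ := exists_bot_of_chain _ hne fun S hS T hT =>
        h.chain S (Finset.mem_filter.1 hS).1 T (Finset.mem_filter.1 hT).1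
      rw [Finset.mem_filter] at hA
      exact ⟨A, (h.pf A hA.1).1, Or.inr hA.1, hA.2, fun S hS hr =>
        hmax S (Finset.mem_filter.2 ⟨hS, hr⟩)⟩
    · refine ⟨M.E, M.ground_isFlat, Or.inl rfl, by omega, fun S hS hr => ?_⟩
      exact absurd ⟨S, Finset.mem_filter.2 ⟨hS, hr⟩⟩ hne
  obtain ⟨A, hA1, hA2, hA3, hA4⟩ := hA
  obtain ⟨B, hB1, hB2, hB3, hB4⟩ := hB
  refine ⟨A, B, hA1, hB1, hA2, hB2, ?_, hA3, hB3, hA4, hB4⟩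
  have hne : A ≠ B := by rintro rfl; omega
  refine LE.le.ssubset_of_ne ?_ hne
  rcases hA2 with rfl | hA2
  · exact Set.empty_subset _
  rcases hB2 with rfl | hB2
  · exact hA1.subset_ground
  rcases h.chain A hA2 B hB2 with hAB | hAB
  · exact hAB
  · have := rk_mono M hAB
    omega

-- At a missing rank `k` the flag has a gap `A ⊂ B` with `rk A < k < rk B`. The flat spanned by `A`
-- and one element of `B ∖ A` has rank `rk A + 1 ≤ k`, so it fits strictly between them.
open Classical in
theorem IsFlag.exists_insert {s : Finset (Set α)} (h : IsFlag M s) (hc : s.card < topDeg M) :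
    ∃ H, H ∉ s ∧ IsFlag M (insert H s) := by
  obtain ⟨k, hk, hks⟩ := IsFlag.exists_missing_rank hc
  obtain ⟨A, B, hA1, hB1, -, -, hAB, hrA, hrB, hsA, hsB⟩ := h.exists_split hk
  obtain ⟨e, heB, heA⟩ := Set.exists_of_ssubset hAB
  have heE := hB1.subset_ground heB
  have h1 := rk_insert M heE (by rwa [hA1.closure] : e ∉ M.closure A)
  rw [← rk_closure] at h1
  have hin := subset_closure_insert M hA1.subset_ground heE
  have hAH : A ⊆ M.closure (insert e A) := (Set.subset_insert _ _).trans hin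
  have hHB := closure_insert_of_isFlat M hB1 hAB.subset heB
  have hEB := rk_mono M hB1.subset_ground
  refine ⟨M.closure (insert e A), fun hs => ?_, isFlag_insert.2 ⟨⟨Matroid.isFlat_closure _,
    ⟨e, hin (Set.mem_insert _ _)⟩, fun hE => ?_⟩, h, fun S hS => ?_⟩⟩
  · have h2 := hks _ hs
    exact heA (hsA _ hs (by omega) (hin (Set.mem_insert _ _)))
  · rw [hE] at h1
    omega
  · rcases lt_or_gt_of_ne (hks S hS) with h2 | h2
    · exact Or.inl ((hsA S hS h2).trans hAH)
    · exact Or.inr (hHB.trans (hsB S hS h2))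

theorem IsFlag.exists_complete {s : Finset (Set α)} (h : IsFlag M s) :
    ∃ t, s ⊆ t ∧ IsFlag M t ∧ t.card = topDeg M := by
  classical
  obtain ⟨n, hn⟩ : ∃ n, s.card + n = topDeg M := ⟨_, Nat.add_sub_cancel' h.card_le⟩
  induction n generalizing s with
  | zero => exact ⟨s, subset_rfl, h, by simpa using hn⟩
  | succ n ih =>
    obtain ⟨H, hH, hf⟩ := h.exists_insert (by omega)
    obtain ⟨t, hst, ht⟩ := ih hf (by rw [Finset.card_insert_of_notMem hH]; omega)
    exact ⟨t, (Finset.subset_insert _ _).trans hst, ht⟩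

open Classical in
/-- The unique gap of a flag that misses exactly one rank. -/
theorem IsFlag.exists_gap {s : Finset (Set α)} (h : IsFlag M s) (hc : s.card + 1 = topDeg M) :
    ∃ A B, M.IsFlat A ∧ M.IsFlat B ∧ (A = ∅ ∨ A ∈ s) ∧ (B = M.E ∨ B ∈ s) ∧ A ⊂ B ∧
      (∀ S ∈ s, S ⊆ A ∨ B ⊆ S) ∧
      (∀ H, PF M H → (H ∉ s ∧ IsFlag M (insert H s) ↔ A ⊂ H ∧ H ⊂ B)) ∧
      ∀ e ∈ B, e ∉ A → ∃! H, M.IsFlat H ∧ A ⊂ H ∧ H ⊂ B ∧ e ∈ H := by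
  obtain ⟨k, hk, hks⟩ := IsFlag.exists_missing_rank (M := M) (s := s) (by omega)
  obtain ⟨A, B, hA1, hB1, hA2, hB2, hAB, hrA, hrB, hsA, hsB⟩ := h.exists_split hk
  -- By counting, the members take every rank from `1` to `rk E - 1` except `k`. Hence `A` and `B`
  -- have ranks exactly `k - 1` and `k + 1`.
  have himg : s.image (rk M) = (Finset.Ico 1 (rk M M.E)).erase k := by
    apply Finset.eq_of_subset_of_card_le
    · intro l hl
      obtain ⟨S, hS, rfl⟩ := Finset.mem_image.1 hl
      exact Finset.mem_erase.2 ⟨hks S hS, (h.pf S hS).rk_mem⟩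
    · rw [Finset.card_erase_of_mem hk, Finset.card_image_of_injOn h.rk_injOn]
      simp only [Nat.card_Ico, topDeg] at hc ⊢
      omega
  have hatt : ∀ l, 1 ≤ l → l < rk M M.E → l ≠ k → ∃ S ∈ s, rk M S = l := fun l h1 h2 h3 =>
    Finset.mem_image.1 (himg ▸ Finset.mem_erase.2 ⟨h3, Finset.mem_Ico.2 ⟨h1, h2⟩⟩)
  rw [Finset.mem_Ico] at hk
  have hrA' : rk M A + 1 = k := by
    by_cases hk1 : k = 1
    · omega
    obtain ⟨S, hS, hr⟩ := hatt (k - 1) (by omega) (by omega) (by omega)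
    have := rk_mono M (hsA S hS (by omega))
    omega
  have hrB' : rk M B = k + 1 := by
    have := rk_mono M hB1.subset_ground
    by_cases hk1 : k + 1 = rk M M.E
    · omega
    obtain ⟨S, hS, hr⟩ := hatt (k + 1) (by omega) (by omega) (by omega)
    have := rk_mono M (hsB S hS (by omega))
    omega
  have hsAB : ∀ S ∈ s, S ⊆ A ∨ B ⊆ S := fun S hS =>
    (lt_or_gt_of_ne (hks S hS)).imp (hsA S hS) (hsB S hS)
  refine ⟨A, B, hA1, hB1, hA2, hB2, hAB, hsAB, fun H hH => ⟨?_, ?_⟩, fun e heB heA => ?_⟩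
  · rintro ⟨hHs, hf⟩
    have hrH : rk M H = k := by
      by_contra hne
      obtain ⟨S, hS, hr⟩ := hatt (rk M H) (Finset.mem_Ico.1 hH.rk_mem).1
        (Finset.mem_Ico.1 hH.rk_mem).2 hne
      exact hHs (hf.rk_injOn (by simp [hS]) (by simp) hr ▸ hS)
    have h3 := (isFlag_insert.1 hf).2.2
    constructor
    · refine LE.le.ssubset_of_ne ?_ (by rintro rfl; omega)
      rcases hA2 with rfl | hA2
      · exact Set.empty_subset _
      · refine (h3 A hA2).resolve_right fun h4 => ?_
        have := rk_mono M h4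
        omega
    · refine LE.le.ssubset_of_ne ?_ (by rintro rfl; omega)
      rcases hB2 with rfl | hB2
      · exact hH.1.subset_ground
      · refine (h3 B hB2).resolve_left fun h4 => ?_
        have := rk_mono M h4
        omega
  · rintro ⟨h1, h2⟩
    refine ⟨fun hs => ?_, isFlag_insert.2 ⟨hH, h, fun S hS => ?_⟩⟩
    · rcases hsAB H hs with h3 | h3
      · exact h1.2 h3
      · exact h2.2 h3
    · exact (hsAB S hS).imp (fun h3 => h3.trans h1.subset) (fun h3 => h2.subset.trans h3)
  -- The interval from `A` to `B` has length two, so a flat strictly inside it that contains `e`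
  -- must be the closure of `A ∪ e`.
  · have heE := hB1.subset_ground heB
    have h1 := rk_insert M heE (by rwa [hA1.closure] : e ∉ M.closure A)
    rw [← rk_closure] at h1
    have hin := subset_closure_insert M hA1.subset_ground heE
    refine ⟨M.closure (insert e A), ⟨Matroid.isFlat_closure _, ?_, ?_, hin (Set.mem_insert _ _)⟩,
      ?_⟩
    · refine ((Set.subset_insert _ _).trans hin).ssubset_of_ne fun h2 => heA ?_
      rw [h2]
      exact hin (Set.mem_insert _ _)
    · refine (closure_insert_of_isFlat M hB1 hAB.subset heB).ssubset_of_ne fun h2 => ?_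
      rw [h2] at h1
      omega
    · rintro H ⟨hH1, hH2, hH3, hH4⟩
      refine (eq_of_rk_le M (Matroid.isFlat_closure _) hH1.subset_ground
        (closure_insert_of_isFlat M hH1 hH2.subset hH4) ?_).symm
      have := rk_lt M hH1 hB1.subset_ground hH3
      omega

end Flags

open Classical in
/-- A member `G` of a flag is isolated by two elements `j ∈ G` and `l ∉ G`. -/
theorem IsFlag.exists_sep {M : Matroid α} {s : Finset (Set α)} (h : IsFlag M s) {G : Set α}
    (hG : G ∈ s) :
    ∃ j l, j ∈ G ∧ l ∈ M.E ∧ l ∉ G ∧ ∀ H ∈ s, j ∈ H → l ∉ H → H = G := by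
  -- Take `j` in `G` outside the largest member below `G`, and `l` outside `G` in the smallest
  -- member above it. Where no such member exists, any element of `G`, respectively of `E ∖ G`, will
  -- do.
  have hj : ∃ j ∈ G, ∀ H ∈ s, H ⊂ G → j ∉ H := by
    by_cases hne : (s.filter fun S => S ⊂ G).Nonempty
    · obtain ⟨A, hA, hmax⟩ := exists_top_of_chain _ hne fun S hS T hT =>
        h.chain S (Finset.mem_filter.1 hS).1 T (Finset.mem_filter.1 hT).1
      obtain ⟨j, hj, hjA⟩ := Set.exists_of_ssubset (Finset.mem_filter.1 hA).2
      exact ⟨j, hj, fun H hH hHG hjH => hjA (hmax H (Finset.mem_filter.2 ⟨hH, hHG⟩) hjH)⟩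
    · obtain ⟨j, hj⟩ := (h.pf G hG).2.1
      exact ⟨j, hj, fun H hH hHG _ => hne ⟨H, Finset.mem_filter.2 ⟨hH, hHG⟩⟩⟩
  have hl : ∃ l ∈ M.E, l ∉ G ∧ ∀ H ∈ s, G ⊂ H → l ∈ H := by
    by_cases hne : (s.filter fun S => G ⊂ S).Nonempty
    · obtain ⟨A, hA, hmax⟩ := exists_bot_of_chain _ hne fun S hS T hT =>
        h.chain S (Finset.mem_filter.1 hS).1 T (Finset.mem_filter.1 hT).1
      rw [Finset.mem_filter] at hA
      obtain ⟨l, hl, hlA⟩ := Set.exists_of_ssubset hA.2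
      exact ⟨l, (h.pf A hA.1).1.subset_ground hl, hlA, fun H hH hHG =>
        hmax H (Finset.mem_filter.2 ⟨hH, hHG⟩) hl⟩
    · obtain ⟨l, hl, hlA⟩ := Set.exists_of_ssubset
        ((h.pf G hG).1.subset_ground.ssubset_of_ne (h.pf G hG).2.2)
      exact ⟨l, hl, hlA, fun H hH hHG => absurd ⟨H, Finset.mem_filter.2 ⟨hH, hHG⟩⟩ hne⟩
  obtain ⟨j, hj, hj'⟩ := hj
  obtain ⟨l, hl, hlG, hl'⟩ := hl
  refine ⟨j, l, hj, hl, hlG, fun H hH hjH hlH => ?_⟩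
  by_contra hne
  rcases h.chain H hH G hG with h1 | h1
  · exact hj' H hH (h1.ssubset_of_ne hne) hjH
  · exact hlH (hl' H hH (h1.ssubset_of_ne (Ne.symm hne)))

-- Translates the maximal chains in the definition of the degree map into flags that meet every
-- rank.
open Classical in
theorem isMaxChain_iff {M : Matroid α} [M.Finite] [M.Loopless] (C : Finset (PFlat M)) :
    IsMaxChain (· ≤ ·) (C : Set (PFlat M)) ↔
      IsFlag M (C.image Subtype.val) ∧ (C.image Subtype.val).card = topDeg M := by
  have hflag : ∀ C : Finset (PFlat M), IsChain (· ≤ ·) (C : Set (PFlat M)) →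
      IsFlag M (C.image Subtype.val) := by
    intro C hC
    refine ⟨fun S hS => ?_, fun S hS T hT => ?_⟩
    · obtain ⟨F, -, rfl⟩ := Finset.mem_image.1 hS
      exact F.2
    · obtain ⟨F, hF, rfl⟩ := Finset.mem_image.1 hS
      obtain ⟨G, hG, rfl⟩ := Finset.mem_image.1 hT
      exact hC.total hF hG
  have := finite_pflat M
  constructor
  · intro h
    refine ⟨hflag C h.1, (hflag C h.1).card_le.eq_of_not_lt fun hlt => ?_⟩
    obtain ⟨H, hH, hf⟩ := (hflag C h.1).exists_insert hlt
    have hPF := (isFlag_insert.1 hf).1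
    have hch : IsChain (· ≤ ·) (insert (⟨H, hPF⟩ : PFlat M) (C : Set (PFlat M))) := by
      refine h.1.insert fun G hG _ => ?_
      exact ((isFlag_insert.1 hf).2.2 G.1 (Finset.mem_image_of_mem _ hG)).symm
    have h2 := h.2 hch (Set.subset_insert _ _)
    have h3 : (⟨H, hPF⟩ : PFlat M) ∈ (C : Set (PFlat M)) := by
      rw [h2]; exact Set.mem_insert _ _
    exact hH (Finset.mem_image_of_mem Subtype.val h3)
  · rintro ⟨h, hc⟩
    refine ⟨fun F hF G hG _ => h.chain F.1 (Finset.mem_image_of_mem _ hF) G.1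
      (Finset.mem_image_of_mem _ hG), fun t ht hCt => ?_⟩
    obtain ⟨t, rfl⟩ := t.toFinite.exists_finset_coe
    have h1 := (hflag t ht).card_le
    rw [Finset.card_image_of_injective _ Subtype.val_injective] at h1 hc
    exact congrArg _ (Finset.eq_of_subset_of_card_le (Finset.coe_subset.1 hCt) (by omega))

/-! ### Presentation and grading of the Chow ring -/

section Basics

variable (M : Matroid α)

theorem toCH_surjective : Function.Surjective (toCH M) :=
  Ideal.Quotient.mkₐ_surjective ℚ _

theorem adjoin_x : Algebra.adjoin ℚ {a | ∃ S, PF M S ∧ a = x M S} = ⊤ := by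
  rw [eq_top_iff]
  rintro a -
  obtain ⟨p, rfl⟩ := toCH_surjective M a
  induction p using MvPolynomial.induction_on with
  | C c =>
    rw [← MvPolynomial.algebraMap_eq, AlgHom.commutes]
    exact Subalgebra.algebraMap_mem _ c
  | add p q hp hq => rw [map_add]; exact add_mem hp hq
  | mul_X p F hp =>
    rw [map_mul, ← x_of_pflat]
    exact mul_mem hp (Algebra.subset_adjoin ⟨F.1, F.2, rfl⟩)

/-- The ring is generated in degree one, so facts about degrees reduce to powers of the first graded
piece. -/
theorem gr_pow (k : ℕ) : gr M k = gr M 1 ^ k := by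
  rw [gr, gr, ← MvPolynomial.homogeneousSubmodule_one_pow]
  exact Submodule.map_pow _ (toCH M) k

theorem one_mem_gr : (1 : CH M) ∈ gr M 0 := by
  rw [gr_pow, pow_zero]
  exact Submodule.one_le.1 le_rfl

theorem mul_mem_gr {k l : ℕ} {a b : CH M} (ha : a ∈ gr M k) (hb : b ∈ gr M l) :
    a * b ∈ gr M (k + l) := by
  rw [gr_pow] at *
  rw [pow_add]
  exact Submodule.mul_mem_mul ha hb

theorem gr_one_eq : gr M 1 = Submodule.span ℚ {a | ∃ S, PF M S ∧ a = x M S} := by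
  rw [gr, MvPolynomial.homogeneousSubmodule_one_eq_span_X, Submodule.map_span]
  congr 1
  ext a
  constructor
  · rintro ⟨_, ⟨F, rfl⟩, rfl⟩
    exact ⟨F.1, F.2, (x_of_pflat M F).symm⟩
  · rintro ⟨S, hS, rfl⟩
    exact ⟨_, ⟨⟨S, hS⟩, rfl⟩, (x_of_pflat M ⟨S, hS⟩).symm⟩

theorem x_mem_gr (S : Set α) : x M S ∈ gr M 1 := by
  by_cases h : PF M S
  · rw [gr_one_eq]
    exact Submodule.subset_span ⟨S, h, rfl⟩
  · rw [x_of_not M h]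
    exact zero_mem _

/-- A homomorphism that sends the generators to degree one respects degrees. -/
theorem map_mem_of_mem_gr {A : Type*} [CommRing A] [Algebra ℚ A] (φ : CH M →ₐ[ℚ] A)
    (𝒢 : ℕ → Submodule ℚ A) (h1 : 1 ∈ 𝒢 0)
    (hmul : ∀ k a b, a ∈ 𝒢 1 → b ∈ 𝒢 k → a * b ∈ 𝒢 (k + 1))
    (hx : ∀ S, PF M S → φ (x M S) ∈ 𝒢 1) {k : ℕ} {a : CH M} (ha : a ∈ gr M k) : φ a ∈ 𝒢 k := by
  induction k generalizing a with
  | zero =>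
    rw [gr_pow, pow_zero, Submodule.mem_one] at ha
    obtain ⟨c, rfl⟩ := ha
    rw [AlgHom.commutes, Algebra.algebraMap_eq_smul_one]
    exact Submodule.smul_mem _ _ h1
  | succ k ih =>
    rw [gr_pow, pow_succ', ← gr_pow] at ha
    induction ha using Submodule.mul_induction_on' with
    | mem_mul_mem a ha b hb =>
      rw [map_mul]
      refine hmul k _ _ ?_ (ih hb)
      have : gr M 1 ≤ (𝒢 1).comap φ.toLinearMap := by
        rw [gr_one_eq, Submodule.span_le]
        rintro _ ⟨S, hS, rfl⟩
        exact hx S hS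
      exact this ha
    | add a _ b _ ha hb => rw [map_add]; exact add_mem ha hb

/-- Only the existence of homogeneous components; their uniqueness comes from `gradeHom`. -/
theorem exists_components (a : CH M) :
    ∃ c : ℕ →₀ CH M, (∀ k, c k ∈ gr M k) ∧ a = c.sum fun _ b => b := by
  have h : a ∈ ⨆ k, gr M k := by
    obtain ⟨p, rfl⟩ := toCH_surjective M a
    rw [← MvPolynomial.sum_homogeneousComponent p, map_sum]
    refine sum_mem fun k _ => Submodule.mem_iSup_of_mem k ?_
    exact ⟨_, MvPolynomial.homogeneousComponent_mem k p, rfl⟩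
  obtain ⟨c, hc, h⟩ := (Submodule.mem_iSup_iff_exists_finsupp _ _).1 h
  exact ⟨c, hc, h.symm⟩

/-- The monomial of a set of flats. -/
noncomputable def xs (s : Finset (Set α)) : CH M := ∏ S ∈ s, x M S

theorem xs_mul_x_eq_zero {s : Finset (Set α)} {S T : Set α} (hT : T ∈ s) (h₁ : ¬ S ⊆ T)
    (h₂ : ¬ T ⊆ S) : xs M s * x M S = 0 := by
  classical
  rw [xs, ← Finset.mul_prod_erase s _ hT, mul_right_comm, x_mul_x M h₂ h₁, zero_mul]

open Classical in
theorem xs_mul_x_of_notMem {s : Finset (Set α)} (hs : IsFlag M s) {S : Set α} (hS : S ∉ s) :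
    xs M s * x M S = if IsFlag M (insert S s) then xs M (insert S s) else 0 := by
  split_ifs with h
  · rw [xs, xs, Finset.prod_insert hS, mul_comm]
  · by_cases hPF : PF M S
    · have h1 : ¬ ∀ T ∈ s, T ⊆ S ∨ S ⊆ T := fun h2 => h (isFlag_insert.2 ⟨hPF, hs, h2⟩)
      push Not at h1
      obtain ⟨T, hT, h2, h3⟩ := h1
      exact xs_mul_x_eq_zero M hT h3 h2
    · rw [x_of_not M hPF, mul_zero]

theorem xs_mem_gr (s : Finset (Set α)) : xs M s ∈ gr M s.card := by
  classical
  induction s using Finset.induction_on with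
  | empty => simpa [xs] using one_mem_gr M
  | insert S s hS ih =>
    rw [xs, Finset.prod_insert hS, Finset.card_insert_of_notMem hS, add_comm]
    exact mul_mem_gr M (x_mem_gr M S) ih

end Basics

/-! ### Linear relations, independence of degrees, and spanning by flag monomials. -/

section Finite

variable (M : Matroid α) [M.Finite]

/-- The finite set of all subsets of the ground set. -/
noncomputable def subs : Finset (Set α) := M.ground_finite.finite_subsets.toFinset

theorem mem_subs {S : Set α} : S ∈ subs M ↔ S ⊆ M.E := by
  simp [subs]

open Classical in
theorem map_linForm_eq {A : Type*} [CommRing A] [Algebra ℚ A]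
    (φ : MvPolynomial (PFlat M) ℚ →ₐ[ℚ] A) (f : Set α → A)
    (hf : ∀ F : PFlat M, φ (MvPolynomial.X F) = f F.1) (j : α) :
    φ (linForm M j) = ∑ S ∈ subs M with PF M S ∧ j ∈ S, f S := by
  have := finite_pflat M
  have : Fintype (PFlat M) := Fintype.ofFinite _
  have e1 : φ (linForm M j) = ∑ F : PFlat M with j ∈ F.1, f F.1 := by
    rw [linForm, finsum_eq_sum_of_fintype, map_sum, Finset.sum_filter]
    refine Finset.sum_congr rfl fun F _ => ?_
    by_cases h : j ∈ F.1 <;> simp [h, hf]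
  rw [e1]
  refine Finset.sum_bij (fun F _ => F.1) ?_ ?_ ?_ ?_
  · intro F hF
    simp only [Finset.mem_filter, Finset.mem_univ, true_and] at hF
    exact Finset.mem_filter.2 ⟨(mem_subs M).2 F.2.1.subset_ground, F.2, hF⟩
  · intro F _ G _ h
    exact Subtype.ext h
  · intro S hS
    rw [Finset.mem_filter] at hS
    exact ⟨⟨S, hS.2.1⟩, by simpa using hS.2.2, rfl⟩
  · intro F _
    rfl

open Classical in
/-- The homomorphism from the Chow ring given by the images of the generators. -/
noncomputable def liftCH {A : Type*} [CommRing A] [Algebra ℚ A] (f : Set α → A)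
    (hmul : ∀ S T, PF M S → PF M T → ¬ S ⊆ T → ¬ T ⊆ S → f S * f T = 0)
    (hlin : ∀ j ∈ M.E, ∀ l ∈ M.E, ∑ S ∈ subs M with PF M S ∧ j ∈ S, f S =
      ∑ S ∈ subs M with PF M S ∧ l ∈ S, f S) : CH M →ₐ[ℚ] A :=
  Ideal.Quotient.liftₐ (linIdeal M + monIdeal M) (MvPolynomial.aeval fun F : PFlat M => f F.1) (by
    have h : linIdeal M + monIdeal M ≤
        RingHom.ker (MvPolynomial.aeval fun F : PFlat M => f F.1 : _ →ₐ[ℚ] A) := by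
      refine sup_le (Ideal.span_le.2 ?_) (Ideal.span_le.2 ?_)
      · rintro _ ⟨j, hj, l, hl, -, rfl⟩
        rw [SetLike.mem_coe, RingHom.mem_ker, map_sub, map_linForm_eq M _ f (by simp),
          map_linForm_eq M _ f (by simp), hlin j hj l hl, sub_self]
      · rintro _ ⟨F, G, h₁, h₂, rfl⟩
        simpa using hmul F.1 G.1 F.2 G.2 h₁ h₂
    exact fun p hp => h hp)

theorem liftCH_x {A : Type*} [CommRing A] [Algebra ℚ A] (f : Set α → A) (hmul hlin) {S : Set α}
    (hS : PF M S) : liftCH M f hmul hlin (x M S) = f S := by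
  rw [x_of_pflat M ⟨S, hS⟩]
  exact MvPolynomial.aeval_X _ _

-- Since `x_S = 0` when `S` is not a nonempty proper flat, sums may run over all subsets of the
-- ground set. Reindexing along a deletion then needs no knowledge of which sets are flats.
open Classical in
theorem sum_pf_eq {A : Type*} [CommRing A] (f : Set α → A) (j : α)
    (hf : ∀ S ⊆ M.E, ¬ PF M S → j ∈ S → f S = 0) :
    ∑ S ∈ subs M with PF M S ∧ j ∈ S, f S = ∑ S ∈ subs M with j ∈ S, f S := by
  refine Finset.sum_subset (fun S hS => ?_) fun S hS hS' => ?_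
  · simp only [Finset.mem_filter] at hS ⊢
    exact ⟨hS.1, hS.2.2⟩
  · simp only [Finset.mem_filter, not_and] at hS hS'
    exact hf S ((mem_subs M).1 hS.1) (fun h => hS' hS.1 h hS.2) hS.2

open Classical in
theorem toCH_linForm_eq (j : α) :
    toCH M (linForm M j) = ∑ S ∈ subs M with j ∈ S, x M S := by
  rw [map_linForm_eq M (toCH M) (x M) (fun F => (x_of_pflat M F).symm),
    sum_pf_eq M _ _ fun S _ h _ => x_of_not M h]

open Classical in
theorem sum_x_eq {j l : α} (hj : j ∈ M.E) (hl : l ∈ M.E) :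
    ∑ S ∈ subs M with j ∈ S, x M S = ∑ S ∈ subs M with l ∈ S, x M S := by
  rw [← toCH_linForm_eq, ← toCH_linForm_eq, toCH_linForm M hj hl]

/-- The homomorphism `CH(M) → CH(M)[t]` that multiplies the part of degree `k` by `t ^ k`. -/
noncomputable def gradeHom : CH M →ₐ[ℚ] Polynomial (CH M) :=
  liftCH M (fun S => Polynomial.C (x M S) * Polynomial.X)
    (fun S T _ _ h₁ h₂ => by
      rw [mul_mul_mul_comm, ← map_mul, x_mul_x M h₁ h₂, map_zero, zero_mul])
    (fun j hj l hl => by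
      classical
      rw [sum_pf_eq M _ _ fun S _ h _ => by simp [x_of_not M h],
        sum_pf_eq M _ _ fun S _ h _ => by simp [x_of_not M h],
        ← Finset.sum_mul, ← Finset.sum_mul, ← map_sum, ← map_sum, sum_x_eq M hj hl])

theorem gradeHom_of_mem {k : ℕ} {a : CH M} (ha : a ∈ gr M k) :
    gradeHom M a = Polynomial.monomial k a := by
  -- The graphs of `b ↦ b t ^ k` multiply like graded pieces, so `map_mem_of_mem_gr` applies to `a ↦
  -- (a, gradeHom a)`.
  let 𝒢 : ℕ → Submodule ℚ (CH M × Polynomial (CH M)) := fun k =>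
    LinearMap.graph ((Polynomial.monomial k).restrictScalars ℚ : CH M →ₗ[ℚ] Polynomial (CH M))
  refine map_mem_of_mem_gr M ((AlgHom.id ℚ (CH M)).prod (gradeHom M)) 𝒢 ?_ ?_ ?_ ha
  · simp [𝒢, LinearMap.mem_graph_iff]
  · rintro k ⟨a, a'⟩ ⟨b, b'⟩ ha hb
    simp only [𝒢, LinearMap.mem_graph_iff, LinearMap.coe_restrictScalars, Prod.mk_mul_mk] at *
    rw [ha, hb, Polynomial.monomial_mul_monomial, add_comm]
  · intro S hS
    simp only [𝒢, LinearMap.mem_graph_iff, LinearMap.coe_restrictScalars, AlgHom.prod_apply,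
      AlgHom.id_apply]
    rw [gradeHom, liftCH_x M _ _ _ hS, Polynomial.C_mul_X_eq_monomial]

/-- If a sum of homogeneous elements is homogeneous, the other components vanish. -/
theorem eq_zero_of_sum_mem_gr {c : ℕ →₀ CH M} (hc : ∀ k, c k ∈ gr M k) {m : ℕ}
    (h : (c.sum fun _ b => b) ∈ gr M m) {k : ℕ} (hk : k ≠ m) : c k = 0 := by
  have h1 := gradeHom_of_mem M h
  rw [Finsupp.sum, map_sum, Finset.sum_congr rfl fun l _ => gradeHom_of_mem M (hc l)] at h1
  have h2 := congrArg (fun p => Polynomial.coeff p k) h1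
  simp only [Polynomial.finsetSum_coeff, Polynomial.coeff_monomial, if_neg hk.symm] at h2
  rw [Finset.sum_ite_eq'] at h2
  by_contra hne
  rw [if_pos (Finsupp.mem_support_iff.2 hne)] at h2
  exact hne h2

open Classical in
/-- The product of the monomial of a flag with one of its members, as a sum over other flats. -/
theorem xs_mul_x_of_sep {s : Finset (Set α)} {G : Set α} (hG : G ∈ s)
    (hGE : G ⊆ M.E) {j l : α} (hj : j ∈ G) (hl : l ∈ M.E) (hlG : l ∉ G) :
    xs M s * x M G = - ∑ S ∈ subs M with (j ∈ S ∧ l ∉ S) ∧ S ≠ G, xs M s * x M S := by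
  -- In the relation for `j` and `l`, flats that contain both cancel, and those that contain `l` but
  -- not `j` are incomparable with `G`, so `x_s` kills them.
  have h1 := congrArg (xs M s * ·) (sum_x_eq M (hGE hj) hl)
  simp only [Finset.mul_sum] at h1
  rw [← Finset.sum_filter_add_sum_filter_not _ (fun S => l ∈ S), Finset.filter_filter,
    Finset.filter_filter, ← Finset.sum_filter_add_sum_filter_not (Finset.filter (fun S => l ∈ S) _)
    (fun S => j ∈ S), Finset.filter_filter, Finset.filter_filter] at h1
  have h2 : ∑ S ∈ subs M with l ∈ S ∧ j ∉ S, xs M s * x M S = 0 := by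
    refine Finset.sum_eq_zero fun S hS => ?_
    rw [Finset.mem_filter] at hS
    exact xs_mul_x_eq_zero M hG (fun h => hlG (h hS.2.1)) fun h => hS.2.2 (h hj)
  have h3 : ∀ S : Set α, (j ∈ S ∧ l ∈ S) ↔ (l ∈ S ∧ j ∈ S) := fun S => and_comm
  simp only [h3, h2, add_zero, add_eq_left] at h1
  rw [eq_neg_iff_add_eq_zero, ← h1, ← Finset.filter_filter, Finset.filter_ne']
  exact Finset.add_sum_erase _ (fun S => xs M s * x M S)
    (Finset.mem_filter.2 ⟨(mem_subs M).2 hGE, hj, hlG⟩)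

/-- The graded pieces are spanned by the monomials of flags. -/
theorem gr_le_span (k : ℕ) :
    gr M k ≤ Submodule.span ℚ {a | ∃ s, IsFlag M s ∧ s.card = k ∧ a = xs M s} := by
  classical
  induction k with
  | zero =>
    rw [gr_pow, pow_zero, Submodule.one_eq_span, Submodule.span_le]
    rintro _ rfl
    exact Submodule.subset_span ⟨∅, isFlag_empty M, rfl, by simp [xs]⟩
  | succ k ih =>
    rw [gr_pow, pow_succ, ← gr_pow, gr_one_eq]
    refine (mul_le_mul_left ih _).trans ?_
    rw [Submodule.span_mul_span, Submodule.span_le]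
    rintro _ ⟨_, ⟨s, hs, hk, rfl⟩, _, ⟨G, hG, rfl⟩, rfl⟩
    simp only [SetLike.mem_coe]
    have key : ∀ S, S ∉ s → xs M s * x M S ∈
        Submodule.span ℚ {a | ∃ s, IsFlag M s ∧ s.card = k + 1 ∧ a = xs M s} := by
      intro S hS
      rw [xs_mul_x_of_notMem M hs hS]
      split_ifs with hf
      · exact Submodule.subset_span ⟨_, hf, by rw [Finset.card_insert_of_notMem hS, hk], rfl⟩
      · exact zero_mem _
    by_cases hGs : G ∈ s
    -- A repeated factor is removed by a pair that separates `G`: the flats that replace it lie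
    -- outside `s`.
    · obtain ⟨j, l, hj, hl, hlG, hsep⟩ := hs.exists_sep hGs
      rw [xs_mul_x_of_sep M hGs hG.1.subset_ground hj hl hlG]
      refine neg_mem (sum_mem fun S hS => key S fun hSs => ?_)
      rw [Finset.mem_filter] at hS
      exact hS.2.2 (hsep S hSs hS.2.1.1 hS.2.1.2)
    · exact key G hGs

theorem span_xs : Submodule.span ℚ {a | ∃ s, IsFlag M s ∧ a = xs M s} = ⊤ := by
  rw [eq_top_iff]
  rintro a -
  obtain ⟨c, hc, rfl⟩ := exists_components M a
  refine sum_mem fun k _ => ?_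
  refine Submodule.span_mono ?_ (gr_le_span M k (hc k))
  rintro _ ⟨s, hs, -, rfl⟩
  exact ⟨s, hs, rfl⟩

theorem finite_CH : Module.Finite ℚ (CH M) := by
  classical
  refine ⟨⟨((subs M).powerset.image (xs M) : Finset (CH M)), ?_⟩⟩
  rw [eq_top_iff, ← span_xs M]
  refine Submodule.span_mono ?_
  rintro _ ⟨s, hs, rfl⟩
  refine Finset.mem_coe.2 (Finset.mem_image_of_mem _ (Finset.mem_powerset.2 fun S hS => ?_))
  exact (mem_subs M).2 (hs.pf S hS).1.subset_ground

variable [M.Loopless]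

theorem eq_zero_of_mem_gr {k : ℕ} (hk : topDeg M < k) {a : CH M} (ha : a ∈ gr M k) : a = 0 := by
  have h := gr_le_span M k ha
  rw [← Submodule.mem_bot ℚ]
  refine (Submodule.span_le.2 ?_ : _ ≤ (⊥ : Submodule ℚ (CH M))) h
  rintro _ ⟨s, hs, rfl, rfl⟩
  exact absurd hs.card_le (by omega)

/-- Every element of the Chow ring is a scalar plus a nilpotent element. -/
theorem exists_scalar_add_nilpotent (a : CH M) :
    ∃ (c : ℚ) (n : CH M), IsNilpotent n ∧ a = algebraMap ℚ (CH M) c + n := by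
  have h : a ∈ Algebra.adjoin ℚ {a | ∃ S, PF M S ∧ a = x M S} := by
    rw [adjoin_x]; trivial
  induction h using Algebra.adjoin_induction with
  | mem a ha =>
    obtain ⟨S, -, rfl⟩ := ha
    refine ⟨0, x M S, ⟨topDeg M + 1, ?_⟩, by simp⟩
    refine eq_zero_of_mem_gr M (Nat.lt_succ_self _) ?_
    rw [gr_pow]
    exact Submodule.pow_mem_pow _ (x_mem_gr M S) _
  | algebraMap c => exact ⟨c, 0, IsNilpotent.zero, by simp⟩
  | add a b _ _ ha hb =>
    obtain ⟨c, n, hn, rfl⟩ := ha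
    obtain ⟨d, m, hm, rfl⟩ := hb
    exact ⟨c + d, n + m, (Commute.all n m).isNilpotent_add hn hm, by rw [map_add]; ring⟩
  | mul a b _ _ ha hb =>
    obtain ⟨c, n, hn, rfl⟩ := ha
    obtain ⟨d, m, hm, rfl⟩ := hb
    refine ⟨c * d, algebraMap ℚ _ c * m + n * (algebraMap ℚ _ d + m), ?_, by rw [map_mul]; ring⟩
    exact (Commute.all _ _).isNilpotent_add ((Commute.all _ _).isNilpotent_mul_left hm)
      ((Commute.all _ _).isNilpotent_mul_right hn)

end Finite

/-! ### The degree map -/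

section Glue

variable {σ : Type*}

open Classical in
/-- The functional `D` on polynomials with `D 1 = 0` and `D (X H * p) = f H p`, for a family `f`
that satisfies the symmetry condition of `glue_X_mul`. -/
noncomputable def glue (f : σ → (MvPolynomial σ ℚ →ₗ[ℚ] ℚ)) : MvPolynomial σ ℚ →ₗ[ℚ] ℚ :=
  (MvPolynomial.basisMonomials σ ℚ).constr ℚ fun m =>
    if h : ∃ H, H ∈ m.support then
      f h.choose (MvPolynomial.monomial (m - Finsupp.single h.choose 1) 1) else 0

theorem glue_monomial (f : σ → (MvPolynomial σ ℚ →ₗ[ℚ] ℚ)) {m : σ →₀ ℕ}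
    (h : ∃ H, H ∈ m.support) : glue f (MvPolynomial.monomial m 1) =
      f h.choose (MvPolynomial.monomial (m - Finsupp.single h.choose 1) 1) := by
  have h1 : MvPolynomial.monomial m (1 : ℚ) = MvPolynomial.basisMonomials σ ℚ m := by simp
  rw [glue, h1, Module.Basis.constr_basis, dif_pos h]

theorem glue_one (f : σ → (MvPolynomial σ ℚ →ₗ[ℚ] ℚ)) : glue f 1 = 0 := by
  have h1 : (1 : MvPolynomial σ ℚ) = MvPolynomial.basisMonomials σ ℚ 0 := by simp
  rw [glue, h1, Module.Basis.constr_basis, dif_neg (by simp)]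

/-- The variable `K` chosen in `X_H m` may differ from `H`. Then `K` divides `m`, and the symmetry
condition exchanges the two variables. -/
theorem glue_X_mul (f : σ → (MvPolynomial σ ℚ →ₗ[ℚ] ℚ))
    (hf : ∀ H K p, f H (MvPolynomial.X K * p) = f K (MvPolynomial.X H * p)) (H : σ)
    (p : MvPolynomial σ ℚ) : glue f (MvPolynomial.X H * p) = f H p := by
  classical
  suffices h : glue f ∘ₗ LinearMap.mulLeft ℚ (MvPolynomial.X H) = f H from
    DFunLike.congr_fun h p
  refine (MvPolynomial.basisMonomials σ ℚ).ext fun m => ?_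
  simp only [MvPolynomial.coe_basisMonomials, LinearMap.comp_apply, LinearMap.mulLeft_apply]
  have hX : ∀ (K : σ) (m : σ →₀ ℕ), MvPolynomial.X K * MvPolynomial.monomial m (1 : ℚ) =
      MvPolynomial.monomial (Finsupp.single K 1 + m) 1 := fun K m => by
    rw [MvPolynomial.X, MvPolynomial.monomial_mul, one_mul]
  rw [hX]
  have hex : ∃ K, K ∈ (Finsupp.single H 1 + m).support := ⟨H, by simp⟩
  rw [glue_monomial f hex]
  have hK := hex.choose_spec
  generalize hex.choose = K at hK ⊢
  by_cases hHK : H = K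
  · subst hHK
    rw [add_tsub_cancel_left]
  · have hKm : K ∈ m.support := by
      rw [Finsupp.mem_support_iff, Finsupp.add_apply, Finsupp.single_eq_of_ne (Ne.symm hHK),
        zero_add] at hK
      exact Finsupp.mem_support_iff.2 hK
    have hle : Finsupp.single K 1 ≤ m := by
      rw [Finsupp.single_le_iff]
      exact Nat.one_le_iff_ne_zero.2 (Finsupp.mem_support_iff.1 hKm)
    rw [add_tsub_assoc_of_le hle, ← hX, hf, hX, add_tsub_cancel_of_le hle]

end Glue

open MvPolynomial in
theorem linForm_eq_sum (M : Matroid α) [Fintype (PFlat M)] (j : α)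
    [DecidablePred (j ∈ · : Set α → Prop)] :
    linForm M j = ∑ H : PFlat M, if j ∈ H.1 then X H else 0 := by
  rw [linForm, finsum_eq_sum_of_fintype]
  refine Finset.sum_congr rfl fun H _ => ?_
  by_cases h : j ∈ H.1 <;> simp [h]

/-- `p.1` and `p.2` separate the member `G` of the flag `s` from the other members. -/
def Separates (M : Matroid α) (s : Finset (Set α)) (G : Set α) (p : α × α) : Prop :=
  p.1 ∈ G ∧ p.2 ∈ M.E ∧ p.2 ∉ G ∧ ∀ H ∈ s, p.1 ∈ H → p.2 ∉ H → H = G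

/-! ### The functionals of flags and their symmetry. -/

section Degree

variable (M : Matroid α) [Fintype (PFlat M)]

open Classical in
/-- The flats other than `G` that are cut out by a pair that separates `G` in `s`. -/
noncomputable def opp (s : Finset (Set α)) (G : Set α) : Finset (PFlat M) :=
  if h : ∃ p, Separates M s G p then
    Finset.univ.filter fun K => (h.choose.1 ∈ K.1 ∧ h.choose.2 ∉ K.1) ∧ K.1 ≠ G else ∅

open Classical in
theorem exists_opp_eq {s : Finset (Set α)} (hs : IsFlag M s) {G : Set α} (hG : G ∈ s) :
    ∃ j l, Separates M s G (j, l) ∧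
      opp M s G = Finset.univ.filter fun K => (j ∈ K.1 ∧ l ∉ K.1) ∧ K.1 ≠ G := by
  obtain ⟨j, l, h⟩ := hs.exists_sep hG
  have hex : ∃ p, Separates M s G p := ⟨(j, l), h⟩
  exact ⟨hex.choose.1, hex.choose.2, hex.choose_spec, by rw [opp, dif_pos hex]⟩

theorem notMem_of_mem_opp {s : Finset (Set α)} (hs : IsFlag M s) {G : Set α} (hG : G ∈ s)
    {K : PFlat M} (hK : K ∈ opp M s G) : K.1 ∉ s := by
  classical
  obtain ⟨j, l, h, he⟩ := exists_opp_eq M hs hG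
  rw [he, Finset.mem_filter] at hK
  exact fun hKs => hK.2.2 (h.2.2.2 _ hKs hK.2.1.1 hK.2.1.2)

open Classical in
/-- Extend the flag by `K` in a family of functionals indexed by flags. -/
noncomputable def flagExt (D : Finset (Set α) → (MvPolynomial (PFlat M) ℚ →ₗ[ℚ] ℚ))
    (s : Finset (Set α)) (K : PFlat M) : MvPolynomial (PFlat M) ℚ →ₗ[ℚ] ℚ :=
  if K.1 ∉ s ∧ IsFlag M (insert K.1 s) then D (insert K.1 s) else 0

open Classical in
/-- The functional `p ↦ deg (x_s x_H p)`, given the functionals of all larger flags. -/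
noncomputable def flagFam (D : Finset (Set α) → (MvPolynomial (PFlat M) ℚ →ₗ[ℚ] ℚ))
    (s : Finset (Set α)) (H : PFlat M) : MvPolynomial (PFlat M) ℚ →ₗ[ℚ] ℚ :=
  -- For `H ∈ s` the linear relation of a separating pair rewrites `x_s x_H` through flats outside
  -- `s`.
  if H.1 ∈ s then - ∑ K ∈ opp M s H.1, flagExt M D s K else flagExt M D s H

/-- The functional `p ↦ deg (x_s p)` on polynomials of degree `n`, for a flag `s` that misses `n`
ranks. -/
noncomputable def flagDeg : ℕ → Finset (Set α) → (MvPolynomial (PFlat M) ℚ →ₗ[ℚ] ℚ)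
  -- A complete flag has degree `1`, so only the constant coefficient counts.
  | 0, _ => MvPolynomial.lcoeff ℚ 0
  | n + 1, s => glue (flagFam M (flagDeg n) s)

open MvPolynomial

theorem flagDeg_zero_X_mul (s : Finset (Set α)) (H : PFlat M) (p : MvPolynomial (PFlat M) ℚ) :
    flagDeg M 0 s (X H * p) = 0 := by
  simp only [flagDeg]
  rw [MvPolynomial.lcoeff_apply, ← MvPolynomial.constantCoeff_eq, map_mul,
    MvPolynomial.constantCoeff_X, zero_mul]

theorem flagDeg_succ_one (n : ℕ) (s : Finset (Set α)) : flagDeg M (n + 1) s 1 = 0 :=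
  glue_one _

/-- The functional of `s` kills the linear relations. -/
def KillsLin (D : MvPolynomial (PFlat M) ℚ →ₗ[ℚ] ℚ) : Prop :=
  ∀ j ∈ M.E, ∀ l ∈ M.E, ∀ p, D ((linForm M j - linForm M l) * p) = 0

/-- The functional of `s` kills the multiples of the variables incomparable with a member. -/
def KillsInc (D : MvPolynomial (PFlat M) ℚ →ₗ[ℚ] ℚ) (s : Finset (Set α)) : Prop :=
  ∀ H : PFlat M, ∀ T ∈ s, ¬ H.1 ⊆ T → ¬ T ⊆ H.1 → ∀ p, D (X H * p) = 0

/-- The symmetry condition for gluing. -/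
def Compat (f : PFlat M → (MvPolynomial (PFlat M) ℚ →ₗ[ℚ] ℚ)) : Prop :=
  ∀ H K p, f H (X K * p) = f K (X H * p)

theorem flagExt_killsLin {D : Finset (Set α) → (MvPolynomial (PFlat M) ℚ →ₗ[ℚ] ℚ)}
    {s : Finset (Set α)}
    (h : ∀ t, IsFlag M t → t.card = s.card + 1 → KillsLin M (D t)) (K : PFlat M) :
    KillsLin M (flagExt M D s K) := by
  classical
  rw [flagExt]
  split_ifs with hK
  · exact h _ hK.2 (Finset.card_insert_of_notMem hK.1)
  · intro j _ l _ p
    rfl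

theorem flagFam_killsLin {D : Finset (Set α) → (MvPolynomial (PFlat M) ℚ →ₗ[ℚ] ℚ)}
    {s : Finset (Set α)}
    (h : ∀ t, IsFlag M t → t.card = s.card + 1 → KillsLin M (D t)) (K : PFlat M) :
    KillsLin M (flagFam M D s K) := by
  classical
  intro j hj l hl p
  rw [flagFam]
  split_ifs with hK
  · rw [LinearMap.neg_apply, LinearMap.sum_apply,
      Finset.sum_eq_zero fun K _ => flagExt_killsLin M h K j hj l hl p, neg_zero]
  · exact flagExt_killsLin M h K j hj l hl p

theorem flagDeg_X_mul_of_compat {n : ℕ} {s : Finset (Set α)}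
    (h : Compat M (flagFam M (flagDeg M n) s)) (H : PFlat M) (p : MvPolynomial (PFlat M) ℚ) :
    flagDeg M (n + 1) s (X H * p) = flagFam M (flagDeg M n) s H p :=
  glue_X_mul _ h H p

theorem flagFam_eq_zero_of_incomparable {D : Finset (Set α) → (MvPolynomial (PFlat M) ℚ →ₗ[ℚ] ℚ)}
    {s : Finset (Set α)} (hs : IsFlag M s) {H : PFlat M} {T : Set α} (hT : T ∈ s)
    (h₁ : ¬ H.1 ⊆ T) (h₂ : ¬ T ⊆ H.1) : flagFam M D s H = 0 := by
  classical
  have hH : H.1 ∉ s := fun h => (hs.chain _ h _ hT).elim h₁ h₂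
  rw [flagFam, if_neg hH, flagExt, if_neg]
  exact fun h => ((isFlag_insert.1 h.2).2.2 T hT).elim h₂ h₁

theorem flagFam_of_notMem {D : Finset (Set α) → (MvPolynomial (PFlat M) ℚ →ₗ[ℚ] ℚ)}
    {s : Finset (Set α)} {H : PFlat M} (hH : H.1 ∉ s) : flagFam M D s H = flagExt M D s H := by
  rw [flagFam, if_neg hH]

theorem killsLin_iff (D : MvPolynomial (PFlat M) ℚ →ₗ[ℚ] ℚ) (j l : α)
    [DecidablePred (j ∈ · : Set α → Prop)] [DecidablePred (l ∈ · : Set α → Prop)]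
    (p : MvPolynomial (PFlat M) ℚ) :
    D ((linForm M j - linForm M l) * p) = (∑ H : PFlat M, if j ∈ H.1 then D (X H * p) else 0) -
      ∑ H : PFlat M, if l ∈ H.1 then D (X H * p) else 0 := by
  rw [linForm_eq_sum M j, linForm_eq_sum M l, sub_mul, map_sub, Finset.sum_mul, Finset.sum_mul,
    map_sum, map_sum]
  congr 1 <;>
  · refine Finset.sum_congr rfl fun H _ => ?_
    split_ifs <;> simp

-- The counterpart for functionals of `xs_mul_x_of_sep`. It holds for every pair with `j ∈ H` and `l
-- ∉ H`, so the choice made in `opp` does not matter.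
open Classical in
theorem apply_X_mul_eq_neg_sum {D : MvPolynomial (PFlat M) ℚ →ₗ[ℚ] ℚ} {s : Finset (Set α)}
    (hlin : KillsLin M D) (hinc : KillsInc M D s) (H : PFlat M) (hH : H.1 ∈ s) {j l : α}
    (hj : j ∈ H.1) (hlE : l ∈ M.E) (hl : l ∉ H.1) (p : MvPolynomial (PFlat M) ℚ) :
    D (X H * p) = - ∑ K : PFlat M with (j ∈ K.1 ∧ l ∉ K.1) ∧ K.1 ≠ H.1, D (X K * p) := by
  have h1 := hlin j (H.2.1.subset_ground hj) l hlE p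
  rw [killsLin_iff M D j l, ← Finset.sum_sub_distrib] at h1
  rw [eq_neg_iff_add_eq_zero, ← h1, Finset.sum_filter, add_comm, ← eq_sub_iff_add_eq]
  have h2 : D (X H * p) = ∑ K : PFlat M, if K = H then D (X K * p) else 0 := by simp
  rw [h2, ← Finset.sum_sub_distrib]
  refine Finset.sum_congr rfl fun K _ => ?_
  by_cases hKH : K = H
  · subst hKH
    simp [hj, hl]
  · have hne : K.1 ≠ H.1 := fun h => hKH (Subtype.ext h)
    by_cases h3 : l ∈ K.1 ∧ j ∉ K.1
    · rw [hinc K H.1 hH (fun h => hl (h h3.1)) (fun h => h3.2 (h hj))]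
      simp
    · by_cases h4 : j ∈ K.1 <;> by_cases h5 : l ∈ K.1 <;> simp_all

/-- The properties of the functionals of the flags that miss `n` ranks. -/
structure FlagDegProps (n : ℕ) (s : Finset (Set α)) : Prop where
  lin : KillsLin M (flagDeg M n s)
  inc : KillsInc M (flagDeg M n s) s
  symm : ∀ m, n = m + 1 → Compat M (flagFam M (flagDeg M m) s)

/-- Adjoining `K` and `K'` in either order gives the same flag, so each side is the functional of
that flag at `p`, or zero. -/
theorem flagExt_symm {n : ℕ} {s : Finset (Set α)}
    (ih : ∀ t, IsFlag M t → t.card = s.card + 1 → FlagDegProps M n t) {K K' : PFlat M}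
    (hK : K.1 ∉ s) (hK' : K'.1 ∉ s) (p : MvPolynomial (PFlat M) ℚ) :
    flagExt M (flagDeg M n) s K (X K' * p) = flagExt M (flagDeg M n) s K' (X K * p) := by
  classical
  have key : ∀ K K' : PFlat M, K.1 ∉ s → K'.1 ∉ s → K.1 ≠ K'.1 →
      flagExt M (flagDeg M n) s K (X K' * p) =
        if ∃ m, n = m + 1 ∧ IsFlag M (insert K'.1 (insert K.1 s)) then
          flagDeg M (n - 1) (insert K'.1 (insert K.1 s)) p else 0 := by
    intro K K' hK hK' hne
    by_cases hf : IsFlag M (insert K.1 s)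
    · rw [flagExt, if_pos ⟨hK, hf⟩]
      cases n with
      | zero => rw [flagDeg_zero_X_mul, if_neg (by simp)]
      | succ m =>
        have hP := ih _ hf (Finset.card_insert_of_notMem hK)
        have hn : K'.1 ∉ insert K.1 s := by simp [hK', Ne.symm hne]
        rw [flagDeg_X_mul_of_compat M (hP.symm m rfl), flagFam_of_notMem M hn, flagExt]
        simp only [hn, not_false_eq_true, true_and, Nat.add_right_cancel_iff, exists_eq_left',
          Nat.add_sub_cancel]
        split_ifs <;> rfl
    · rw [flagExt, if_neg fun h => hf h.2, if_neg]
      · rfl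
      · rintro ⟨m, -, h⟩
        exact hf (h.mono (Finset.subset_insert _ _))
  by_cases hKK : K.1 = K'.1
  · rw [Subtype.ext hKK]
  · rw [key K K' hK hK' hKK, key K' K hK' hK (Ne.symm hKK), Finset.insert_comm]

/-- The pair chosen for `s` need not separate `H` in the flag enlarged by `K'`; its linear relation
still holds for the functional of that flag. -/
theorem flagExt_X_mul_of_mem {n : ℕ} {s : Finset (Set α)} (hs : IsFlag M s)
    (ih : ∀ t, IsFlag M t → t.card = s.card + 1 → FlagDegProps M n t) (K' : PFlat M)
    {H : PFlat M} (hH : H.1 ∈ s) (p : MvPolynomial (PFlat M) ℚ) :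
    flagExt M (flagDeg M n) s K' (X H * p) =
      - ∑ K ∈ opp M s H.1, flagExt M (flagDeg M n) s K' (X K * p) := by
  classical
  obtain ⟨j, l, h, he⟩ := exists_opp_eq M hs hH
  rw [he]
  by_cases hf : K'.1 ∉ s ∧ IsFlag M (insert K'.1 s)
  · have hP := ih _ hf.2 (Finset.card_insert_of_notMem hf.1)
    rw [flagExt, if_pos hf]
    exact apply_X_mul_eq_neg_sum M hP.lin hP.inc H (Finset.mem_insert_of_mem hH) h.1 h.2.1 h.2.2.1 p
  · rw [flagExt, if_neg hf]
    simp

/-- The functional at a member of `s` is a sum over flats outside `s`, so every case reduces to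
`flagExt_symm`. -/
theorem flagFam_compat {n : ℕ} {s : Finset (Set α)} (hs : IsFlag M s)
    (ih : ∀ t, IsFlag M t → t.card = s.card + 1 → FlagDegProps M n t) :
    Compat M (flagFam M (flagDeg M n) s) := by
  classical
  have mixed : ∀ H H' : PFlat M, H.1 ∈ s → H'.1 ∉ s → ∀ p,
      flagFam M (flagDeg M n) s H (X H' * p) = flagFam M (flagDeg M n) s H' (X H * p) := by
    intro H H' hH hH' p
    rw [flagFam_of_notMem M hH', flagExt_X_mul_of_mem M hs ih H' hH, flagFam, if_pos hH,
      LinearMap.neg_apply, LinearMap.sum_apply]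
    congr 1
    exact Finset.sum_congr rfl fun K hK =>
      flagExt_symm M ih (notMem_of_mem_opp M hs hH hK) hH' p
  intro H H' p
  by_cases hH : H.1 ∈ s <;> by_cases hH' : H'.1 ∈ s
  · rw [flagFam, flagFam, if_pos hH, if_pos hH', LinearMap.neg_apply, LinearMap.neg_apply,
      LinearMap.sum_apply, LinearMap.sum_apply]
    simp_rw [flagExt_X_mul_of_mem M hs ih _ hH, flagExt_X_mul_of_mem M hs ih _ hH']
    rw [Finset.sum_neg_distrib, Finset.sum_neg_distrib, Finset.sum_comm]
    congr 2
    exact Finset.sum_congr rfl fun K' hK' => Finset.sum_congr rfl fun K hK =>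
      flagExt_symm M ih (notMem_of_mem_opp M hs hH hK) (notMem_of_mem_opp M hs hH' hK') p
  · exact mixed H H' hH hH' p
  · exact (mixed H' H hH' hH p).symm
  · rw [flagFam_of_notMem M hH, flagFam_of_notMem M hH']
    exact flagExt_symm M ih hH hH' p

end Degree

/-! ### The balancing condition and the compatibility with all relations. -/

section Balancing

variable (M : Matroid α) [Fintype (PFlat M)] [M.Finite] [M.Loopless]

open MvPolynomial

open Classical in
theorem flagExt_zero_one (s : Finset (Set α)) (K : PFlat M) :
    flagExt M (flagDeg M 0) s K 1 = if K.1 ∉ s ∧ IsFlag M (insert K.1 s) then 1 else 0 := by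
  rw [flagExt]
  split_ifs
  · simp only [flagDeg]
    rw [MvPolynomial.lcoeff_apply, MvPolynomial.coeff_zero_one]
  · rfl

open Classical in
/-- The balancing condition at a flag that misses one rank. -/
theorem flagFam_balanced {s : Finset (Set α)} (hs : IsFlag M s) (hc : s.card + 1 = topDeg M)
    {j l : α} (hj : j ∈ M.E) (hl : l ∈ M.E) :
    (∑ H : PFlat M, if j ∈ H.1 then flagFam M (flagDeg M 0) s H 1 else 0) =
      ∑ H : PFlat M, if l ∈ H.1 then flagFam M (flagDeg M 0) s H 1 else 0 := by
  obtain ⟨A, B, hA, hB, hAs, hBs, hAB, hsAB, hbtw, huniq⟩ := hs.exists_gap hc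
  have hext : ∀ K : PFlat M, flagExt M (flagDeg M 0) s K 1 = if A ⊂ K.1 ∧ K.1 ⊂ B then 1 else 0 :=
    fun K => by rw [flagExt_zero_one]; exact if_congr (hbtw K.1 K.2) rfl rfl
  let N : Finset (PFlat M) := Finset.univ.filter fun K => A ⊂ K.1 ∧ K.1 ⊂ B
  have hone : ∀ e ∈ B, e ∉ A → (N.filter fun K => e ∈ K.1).card = 1 := by
    intro e heB heA
    obtain ⟨H, ⟨h1, h2, h3, h4⟩, h5⟩ := huniq e heB heA
    have hPF : PF M H := ⟨h1, ⟨e, h4⟩, fun h => h3.2 (h ▸ hB.subset_ground)⟩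
    rw [Finset.card_eq_one]
    refine ⟨⟨H, hPF⟩, ?_⟩
    ext K
    simp only [N, Finset.mem_filter, Finset.mem_univ, true_and, Finset.mem_singleton]
    constructor
    · rintro ⟨⟨h6, h7⟩, h8⟩
      exact Subtype.ext (h5 K.1 ⟨K.2.1, h6, h7, h8⟩)
    · rintro rfl
      exact ⟨⟨h2, h3⟩, h4⟩
  -- With `N` the flats strictly inside the gap `A ⊂ B`, the degree of `x_s x_H` is `1` for `H ∈ N`,
  -- `1 - |N|` for `H = A`, `-1` for `H = B` and `0` otherwise. The last three values count the
  -- members of `N` cut out by a separating pair, and exactly one member of `N` contains a given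
  -- element of `B ∖ A`.
  have hfam : ∀ H : PFlat M, flagFam M (flagDeg M 0) s H 1 =
      (if H ∈ N then 1 else 0) - (if H.1 = A then (N.card : ℚ) - 1 else 0) -
        (if H.1 = B then 1 else 0) := by
    intro H
    by_cases hH : H.1 ∈ s
    swap
    · have hHA : H.1 ≠ A := fun h => by
        rcases hAs with rfl | hAs
        · exact H.2.2.1.ne_empty h
        · exact hH (h ▸ hAs)
      have hHB : H.1 ≠ B := fun h => by
        rcases hBs with rfl | hBs
        · exact H.2.2.2 h
        · exact hH (h ▸ hBs)
      rw [flagFam_of_notMem M hH, hext, if_neg hHA, if_neg hHB, sub_zero, sub_zero]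
      simp [N]
    · have hHN : H ∉ N := fun h => by
        have h1 := (Finset.mem_filter.1 h).2
        exact (hsAB _ hH).elim h1.1.2 h1.2.2
      obtain ⟨a, b, ⟨ha, hbE, hb, hsep⟩, hopp⟩ := exists_opp_eq M hs hH
      simp only at ha hbE hb hsep
      have hcount : flagFam M (flagDeg M 0) s H 1 =
          - ((N.filter fun K => a ∈ K.1 ∧ b ∉ K.1).card : ℚ) := by
        rw [flagFam, if_pos hH, LinearMap.neg_apply, LinearMap.sum_apply, hopp]
        simp_rw [hext]
        rw [Finset.sum_boole]
        congr 2
        congr 1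
        ext K
        simp only [N, Finset.mem_filter, Finset.mem_univ, true_and]
        constructor
        · rintro ⟨⟨h1, -⟩, h2⟩
          exact ⟨h2, h1⟩
        · rintro ⟨h2, h1⟩
          refine ⟨⟨h1, fun h => hHN ?_⟩, h2⟩
          simp only [N, Finset.mem_filter, Finset.mem_univ, true_and]
          rwa [← h]
      rw [hcount, if_neg hHN]
      by_cases hHA : H.1 = A
      · have hHB : H.1 ≠ B := hHA ▸ hAB.ne
        have hbB : b ∈ B := by
          rcases hBs with rfl | hBs
          · exact hbE
          · by_contra hbB
            exact hHB (hsep B hBs (hAB.subset (hHA ▸ ha)) hbB).symm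
        have h1 := hone b hbB (hHA ▸ hb)
        have h2 := Finset.card_filter_add_card_filter_not (s := N) fun K => b ∈ K.1
        have h3 : (N.filter fun K => a ∈ K.1 ∧ b ∉ K.1) = N.filter fun K => b ∉ K.1 := by
          refine Finset.filter_congr fun K hK => and_iff_right ?_
          exact (Finset.mem_filter.1 hK).2.1.subset (hHA ▸ ha)
        rw [if_pos hHA, if_neg hHB, h3, ← h2, h1]
        push_cast
        ring
      by_cases hHB : H.1 = B
      · have haA : a ∉ A := fun haA => by
          rcases hAs with rfl | hAs
          · exact haA
          · exact hAB.ne ((hsep A hAs haA fun h => hb (hHB ▸ hAB.subset h)).trans hHB)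
        have h3 : (N.filter fun K => a ∈ K.1 ∧ b ∉ K.1) = N.filter fun K => a ∈ K.1 := by
          refine Finset.filter_congr fun K hK => and_iff_left fun h => hb ?_
          exact hHB ▸ (Finset.mem_filter.1 hK).2.2.subset h
        rw [if_neg hHA, if_pos hHB, h3, hone a (hHB ▸ ha) haA]
        push_cast
        ring
      · have h3 : (N.filter fun K => a ∈ K.1 ∧ b ∉ K.1) = ∅ := by
          refine Finset.filter_eq_empty_iff.2 fun K hK h => ?_
          have hK := (Finset.mem_filter.1 hK).2
          rcases hsAB _ hH with h4 | h4
          · rcases hAs with rfl | hAs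
            · exact H.2.2.1.ne_empty (Set.subset_empty_iff.1 h4)
            · exact hHA (hsep A hAs (h4 ha) fun h5 => h.2 (hK.1.subset h5)).symm
          · rcases hBs with rfl | hBs
            · exact H.2.2.2 (H.2.1.subset_ground.antisymm h4)
            · exact hHB (hsep B hBs (hK.2.subset h.1) fun h5 => hb (h4 h5)).symm
        rw [if_neg hHA, if_neg hHB, h3]
        simp
  -- For `j ∈ A` the sum is `|N| - (|N| - 1)`, for `j ∈ B ∖ A` it is `1`, in both cases less `1` if
  -- `B ≠ E`. For `j ∉ B` it is `0`, and then `B ≠ E`.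
  have hval : ∀ j ∈ M.E, (∑ H : PFlat M, if j ∈ H.1 then flagFam M (flagDeg M 0) s H 1 else 0) =
      1 - (if B = M.E then 0 else 1) := by
    intro j hj
    have e1 : (∑ H : PFlat M, if j ∈ H.1 then flagFam M (flagDeg M 0) s H 1 else 0) =
        ((N.filter fun K => j ∈ K.1).card : ℚ) - (if j ∈ A then (N.card : ℚ) - 1 else 0) -
          (if B ≠ M.E ∧ j ∈ B then 1 else 0) := by
      have h1 : ((N.filter fun K => j ∈ K.1).card : ℚ) =
          ∑ H : PFlat M, if j ∈ H.1 then (if H ∈ N then 1 else 0) else 0 := by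
        rw [← Finset.sum_boole, ← Finset.univ_inter N, ← Finset.sum_ite_mem]
        refine Finset.sum_congr rfl fun H _ => ?_
        rw [Finset.univ_inter]
        split_ifs <;> rfl
      have h2 : (if j ∈ A then (N.card : ℚ) - 1 else 0) = ∑ H : PFlat M,
          if j ∈ H.1 then (if H.1 = A then (N.card : ℚ) - 1 else 0) else 0 := by
        split_ifs with hjA
        · have hPF : PF M A := ⟨hA, ⟨j, hjA⟩, fun h => hAB.2 (h ▸ hB.subset_ground)⟩
          rw [Finset.sum_eq_single (⟨A, hPF⟩ : PFlat M)]
          · simp [hjA]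
          · intro H _ hne
            have : H.1 ≠ A := fun h => hne (Subtype.ext h)
            simp [this]
          · simp
        · refine (Finset.sum_eq_zero fun H _ => ?_).symm
          split_ifs with h3 h4
          · exact absurd (h4 ▸ h3) hjA
          · rfl
          · rfl
      have h3 : (if B ≠ M.E ∧ j ∈ B then (1 : ℚ) else 0) = ∑ H : PFlat M,
          if j ∈ H.1 then (if H.1 = B then 1 else 0) else 0 := by
        split_ifs with hjB
        · have hPF : PF M B := ⟨hB, ⟨j, hjB.2⟩, hjB.1⟩
          rw [Finset.sum_eq_single (⟨B, hPF⟩ : PFlat M)]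
          · simp [hjB.2]
          · intro H _ hne
            have : H.1 ≠ B := fun h => hne (Subtype.ext h)
            simp [this]
          · simp
        · refine (Finset.sum_eq_zero fun H _ => ?_).symm
          split_ifs with h3 h4
          · exact absurd ⟨h4 ▸ H.2.2.2, h4 ▸ h3⟩ hjB
          · rfl
          · rfl
      rw [h1, h2, h3, ← Finset.sum_sub_distrib, ← Finset.sum_sub_distrib]
      refine Finset.sum_congr rfl fun H _ => ?_
      by_cases h : j ∈ H.1
      · simp only [if_pos h, hfam]
      · simp only [if_neg h, sub_zero]
    rw [e1]
    by_cases hjA : j ∈ A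
    · have h1 : (N.filter fun K => j ∈ K.1) = N := by
        refine Finset.filter_true_of_mem fun K hK => ?_
        exact (Finset.mem_filter.1 hK).2.1.subset hjA
      rw [h1, if_pos hjA]
      by_cases hBE : B = M.E <;> simp [hBE, hAB.subset hjA]
    · by_cases hjB : j ∈ B
      · rw [hone j hjB hjA, if_neg hjA]
        by_cases hBE : B = M.E <;> simp [hBE, hjB]
      · have h1 : (N.filter fun K => j ∈ K.1) = ∅ := by
          refine Finset.filter_eq_empty_iff.2 fun K hK h => hjB ?_
          exact (Finset.mem_filter.1 hK).2.2.subset h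
        have hBE : B ≠ M.E := fun h => hjB (h ▸ hj)
        simp [h1, hjA, hjB, hBE]
  rw [hval j hj, hval l hl]

/-- Linear relations are tested on monomials. A factor `X_G` passes to flags with one more member.
The monomial `1` has the wrong degree unless exactly one rank is missing, and there the balancing
condition decides. -/
theorem flagDegProps {n : ℕ} {s : Finset (Set α)} (hs : IsFlag M s) (hn : s.card + n = topDeg M) :
    FlagDegProps M n s := by
  classical
  induction n generalizing s with
  | zero =>
    refine ⟨fun j _ l _ p => ?_, fun H _ _ _ _ p => flagDeg_zero_X_mul M s H p, by simp⟩
    rw [killsLin_iff M _ j l]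
    simp [flagDeg_zero_X_mul]
  | succ n ih =>
    have ih' : ∀ t, IsFlag M t → t.card = s.card + 1 → FlagDegProps M n t :=
      fun t ht htc => ih ht (by omega)
    have hcomp := flagFam_compat M hs ih'
    have hX := flagDeg_X_mul_of_compat M hcomp
    refine ⟨fun j hj l hl p => ?_, fun H T hT h₁ h₂ p => ?_, fun m hm => ?_⟩
    · suffices h : flagDeg M (n + 1) s ∘ₗ LinearMap.mulLeft ℚ (linForm M j - linForm M l) = 0 from
        DFunLike.congr_fun h p
      refine (MvPolynomial.basisMonomials _ ℚ).ext fun m => ?_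
      simp only [MvPolynomial.coe_basisMonomials, LinearMap.comp_apply, LinearMap.mulLeft_apply,
        LinearMap.zero_apply]
      by_cases hm : ∃ G, G ∈ m.support
      · obtain ⟨G, hG⟩ := hm
        have hle : Finsupp.single G 1 ≤ m := by
          rw [Finsupp.single_le_iff]
          exact Nat.one_le_iff_ne_zero.2 (Finsupp.mem_support_iff.1 hG)
        have hmG : MvPolynomial.monomial m (1 : ℚ) =
            X G * MvPolynomial.monomial (m - Finsupp.single G 1) 1 := by
          rw [MvPolynomial.X, MvPolynomial.monomial_mul, one_mul, add_tsub_cancel_of_le hle]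
        rw [hmG, mul_left_comm, hX]
        exact flagFam_killsLin M (fun t ht htc => (ih' t ht htc).lin) G j hj l hl _
      · have hm0 : m = 0 := by
          ext G
          by_contra h
          exact hm ⟨G, Finsupp.mem_support_iff.2 h⟩
        have h1 : MvPolynomial.monomial m (1 : ℚ) = (1 : MvPolynomial (PFlat M) ℚ) := by
          rw [hm0]; rfl
        rw [h1, killsLin_iff M _ j l, sub_eq_zero]
        simp_rw [hX]
        cases n with
        | zero => exact flagFam_balanced M hs (by omega) hj hl
        | succ n =>
          have h0 : ∀ K : PFlat M, flagExt M (flagDeg M (n + 1)) s K 1 = 0 := by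
            intro K
            rw [flagExt]
            split_ifs
            · exact flagDeg_succ_one M n _
            · rfl
          have h2 : ∀ H : PFlat M, flagFam M (flagDeg M (n + 1)) s H 1 = 0 := by
            intro H
            rw [flagFam]
            split_ifs
            · rw [LinearMap.neg_apply, LinearMap.sum_apply, Finset.sum_eq_zero fun K _ => h0 K,
                neg_zero]
            · exact h0 H
          simp [h2]
    · rw [hX, flagFam_eq_zero_of_incomparable M hs hT h₁ h₂]
      rfl
    · obtain rfl : n = m := by omega
      exact hcomp

open Classical in
theorem flagDeg_prod {n : ℕ} {s : Finset (Set α)} (hn : s.card + n = topDeg M)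
    (C : Finset (PFlat M)) (hC : ∀ H ∈ C, H.1 ∉ s) (hCn : C.card = n)
    (hf : IsFlag M (s ∪ C.image Subtype.val)) : flagDeg M n s (∏ H ∈ C, X H) = 1 := by
  induction n generalizing s C with
  | zero =>
    rw [Finset.card_eq_zero.1 hCn]
    simp only [flagDeg]
    rw [Finset.prod_empty, MvPolynomial.lcoeff_apply, MvPolynomial.coeff_zero_one]
  | succ n ih =>
    obtain ⟨H, hH⟩ : C.Nonempty := Finset.card_pos.1 (by omega)
    have hs : IsFlag M s := hf.mono Finset.subset_union_left
    have hHs := hC H hH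
    have hfH : IsFlag M (insert H.1 s) := hf.mono (Finset.insert_subset
      (Finset.mem_union_right _ (Finset.mem_image_of_mem _ hH)) Finset.subset_union_left)
    have hcomp := (flagDegProps M hs hn).symm n rfl
    rw [← Finset.mul_prod_erase C _ hH, flagDeg_X_mul_of_compat M hcomp, flagFam_of_notMem M hHs,
      flagExt, if_pos ⟨hHs, hfH⟩]
    refine ih ?_ _ ?_ ?_ ?_
    · rw [Finset.card_insert_of_notMem hHs]
      omega
    · intro K hK
      rw [Finset.mem_erase] at hK
      rw [Finset.mem_insert, not_or]
      exact ⟨fun h => hK.1 (Subtype.ext h), hC K hK.2⟩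
    · rw [Finset.card_erase_of_mem hH, hCn, Nat.add_sub_cancel]
    · refine hf.mono ?_
      refine Finset.union_subset (Finset.insert_subset
        (Finset.mem_union_right _ (Finset.mem_image_of_mem _ hH)) Finset.subset_union_left) ?_
      exact (Finset.image_subset_image (Finset.erase_subset _ _)).trans Finset.subset_union_right

end Balancing

/-- A degree map in terms of flags. The socle degree is `0` for the matroid on the empty set. -/
structure IsDeg (M : Matroid α) (D : CH M →ₗ[ℚ] ℚ) : Prop where
  eq_zero : ∀ k, k ≠ topDeg M → ∀ a ∈ gr M k, D a = 0
  flag : ∀ s, IsFlag M s → s.card = topDeg M → D (xs M s) = 1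

/-! ### Existence and uniqueness of the degree map on the Chow ring. -/

section DegreeMap

variable (M : Matroid α) [M.Finite] [M.Loopless]

open MvPolynomial in
theorem flagDeg_homogeneous [Fintype (PFlat M)] {n : ℕ} {s : Finset (Set α)} (hs : IsFlag M s)
    (hn : s.card + n = topDeg M) (m : PFlat M →₀ ℕ) (hm : m.degree ≠ n) :
    flagDeg M n s (monomial m 1) = 0 := by
  classical
  induction n generalizing s m with
  | zero =>
    simp only [flagDeg]
    rw [MvPolynomial.lcoeff_apply, MvPolynomial.coeff_monomial, if_neg]
    rintro rfl
    simp at hm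
  | succ n ih =>
    by_cases hex : ∃ G, G ∈ m.support
    · obtain ⟨G, hG⟩ := hex
      have hle : Finsupp.single G 1 ≤ m := by
        rw [Finsupp.single_le_iff]
        exact Nat.one_le_iff_ne_zero.2 (Finsupp.mem_support_iff.1 hG)
      have hmG : MvPolynomial.monomial m (1 : ℚ) =
          X G * MvPolynomial.monomial (m - Finsupp.single G 1) 1 := by
        rw [MvPolynomial.X, MvPolynomial.monomial_mul, one_mul, add_tsub_cancel_of_le hle]
      have hdeg : (m - Finsupp.single G 1).degree ≠ n := by
        intro h
        apply hm
        rw [← add_tsub_cancel_of_le hle, map_add, h, Finsupp.degree_single, add_comm]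
      have h0 : ∀ K : PFlat M, flagExt M (flagDeg M n) s K
          (monomial (m - Finsupp.single G 1) 1) = 0 := by
        intro K
        rw [flagExt]
        split_ifs with hK
        · exact ih hK.2 (by rw [Finset.card_insert_of_notMem hK.1]; omega) _ hdeg
        · rfl
      rw [hmG, flagDeg_X_mul_of_compat M ((flagDegProps M hs hn).symm n rfl), flagFam]
      split_ifs
      · rw [LinearMap.neg_apply, LinearMap.sum_apply, Finset.sum_eq_zero fun K _ => h0 K,
          neg_zero]
      · exact h0 G
    · have hm0 : m = 0 := by
        ext G
        by_contra h
        exact hex ⟨G, Finsupp.mem_support_iff.2 h⟩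
      rw [hm0]
      exact flagDeg_succ_one M n s

/-- The functional of the empty flag descends to the quotient. It kills `x_F x_G` for incomparable
flats because, once `F` is moved into the flag, `G` is incomparable with a member. -/
theorem exists_isDeg : ∃ D : CH M →ₗ[ℚ] ℚ, IsDeg M D := by
  classical
  have := finite_pflat M
  have : Fintype (PFlat M) := Fintype.ofFinite _
  have hP := flagDegProps M (n := topDeg M) (isFlag_empty M) (by simp)
  have hker : (linIdeal M + monIdeal M).restrictScalars ℚ ≤
      LinearMap.ker (flagDeg M (topDeg M) ∅) := by
    intro p hp₀
    have hp : p ∈ Ideal.span ({p | ∃ j₁ ∈ M.E, ∃ j₂ ∈ M.E, j₁ ≠ j₂ ∧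
        p = linForm M j₁ - linForm M j₂} ∪ {p | ∃ F G : PFlat M, ¬ F ≤ G ∧ ¬ G ≤ F ∧
        p = MvPolynomial.X F * MvPolynomial.X G}) := by
      rw [Ideal.span_union]
      exact hp₀
    clear hp₀
    rw [LinearMap.mem_ker]
    suffices h : ∀ a, flagDeg M (topDeg M) ∅ (p * a) = 0 by simpa using h 1
    induction hp using Submodule.span_induction with
    | zero => simp
    | add p q _ _ hp hq => intro a; rw [add_mul, map_add, hp, hq, add_zero]
    | smul b p _ hp => intro a; rw [smul_eq_mul, mul_comm b, mul_assoc]; exact hp _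
    | mem p hp =>
      intro a
      rcases hp with ⟨j, hj, l, hl, -, rfl⟩ | ⟨F, G, h₁, h₂, rfl⟩
      · exact hP.lin j hj l hl a
      · rw [mul_assoc]
        generalize hn : topDeg M = n
        cases n with
        | zero => exact flagDeg_zero_X_mul M _ _ _
        | succ n =>
          rw [hn] at hP
          rw [flagDeg_X_mul_of_compat M (hP.symm n rfl), flagFam_of_notMem M (by simp), flagExt]
          split_ifs with hF
          · refine (flagDegProps M hF.2 ?_).inc G F.1 (by simp) h₂ h₁ a
            rw [Finset.card_insert_of_notMem hF.1, hn, Finset.card_empty, zero_add, add_comm]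
          · rfl
  refine ⟨(Submodule.liftQ _ (flagDeg M (topDeg M) ∅) hker :), ?_, ?_⟩
  · rintro k hk _ ⟨p, hp, rfl⟩
    change flagDeg M (topDeg M) ∅ p = 0
    rw [← MvPolynomial.support_sum_monomial_coeff p, map_sum]
    refine Finset.sum_eq_zero fun m hm => ?_
    have h1 : m.degree = k := by
      have h2 := (MvPolynomial.mem_homogeneousSubmodule k p).1 hp (MvPolynomial.mem_support_iff.1 hm)
      rw [← h2]
      exact DFunLike.congr_fun Finsupp.degree_eq_weight_one m
    have h3 : MvPolynomial.monomial m (MvPolynomial.coeff m p) =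
        (MvPolynomial.coeff m p) • MvPolynomial.monomial m (1 : ℚ) := by
      rw [MvPolynomial.smul_monomial, smul_eq_mul, mul_one]
    rw [h3, map_smul, flagDeg_homogeneous M (isFlag_empty M) (by simp) m (by rw [h1]; exact hk),
      smul_zero]
  · intro s hs hc
    have hsub : (s.subtype (PF M)).image Subtype.val = s := by
      ext S
      simp only [Finset.mem_image, Finset.mem_subtype, Subtype.exists, exists_and_left,
        exists_prop, exists_eq_right_right]
      exact ⟨fun h => h.1, fun h => ⟨h, hs.pf S h⟩⟩
    have h1 : xs M s = toCH M (∏ H ∈ s.subtype (PF M), MvPolynomial.X H) := by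
      conv_lhs => rw [← hsub, xs, Finset.prod_image (by simp)]
      rw [map_prod]
      exact Finset.prod_congr rfl fun H _ => x_of_pflat M H
    rw [h1]
    change flagDeg M (topDeg M) ∅ _ = 1
    refine flagDeg_prod M (by simp) _ (by simp) ?_ (by rwa [hsub, Finset.empty_union])
    rw [← hc, ← congrArg Finset.card hsub, Finset.card_image_of_injective _ Subtype.val_injective]

theorem IsDeg.unique {D D' : CH M →ₗ[ℚ] ℚ} (h : IsDeg M D) (h' : IsDeg M D') : D = D' := by
  refine LinearMap.ext_on (span_xs M) ?_
  rintro _ ⟨s, hs, rfl⟩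
  by_cases hc : s.card = topDeg M
  · rw [h.flag s hs hc, h'.flag s hs hc]
  · rw [h.eq_zero _ hc _ (xs_mem_gr M s), h'.eq_zero _ hc _ (xs_mem_gr M s)]

/-- In rank zero `IsDegreeMap` has no solution: it requires `deg` to vanish on degree zero and to
send the empty product to `1`. `IsDeg` still makes sense there, which the induction needs when it
deletes the last element. -/
theorem isDeg_iff_isDegreeMap (hE : M.E.Nonempty) (D : CH M →ₗ[ℚ] ℚ) :
    IsDeg M D ↔ IsDegreeMap M D := by
  classical
  have hr : M.eRank = (rk M M.E : ℕ∞) := by rw [coe_rk, Matroid.eRk_ground]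
  have hpos := rk_pos M subset_rfl hE
  have hk : ∀ k : ℕ, (k : ℕ∞) + 1 ≠ M.eRank ↔ k ≠ topDeg M := by
    intro k
    rw [hr, topDeg, Ne, Ne, not_iff_not]
    norm_cast
    omega
  constructor
  · intro h
    refine ⟨fun k hk' => h.eq_zero k ((hk k).1 hk'), fun C hC => ?_⟩
    have h1 := h.flag _ ((isMaxChain_iff C).1 hC).1 ((isMaxChain_iff C).1 hC).2
    rwa [xs, Finset.prod_image (by simp)] at h1
  · intro h
    refine ⟨fun k hk' => h.eq_zero k ((hk k).2 hk'), fun s hs hc => ?_⟩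
    have hsub : (s.subtype (PF M)).image Subtype.val = s := by
      ext S
      simp only [Finset.mem_image, Finset.mem_subtype, Subtype.exists, exists_and_left,
        exists_prop, exists_eq_right_right]
      exact ⟨fun h => h.1, fun h => ⟨h, hs.pf S h⟩⟩
    have h1 := h.flag (s.subtype (PF M)) ((isMaxChain_iff _).2 (by rw [hsub]; exact ⟨hs, hc⟩))
    rw [← hsub, xs, Finset.prod_image (by simp)]
    exact h1

end DegreeMap

/-! ### Nondegenerate pairings and tensor products -/

/-- The pairing `(a, b) ↦ deg (a b)` is nondegenerate. -/
def Nondeg (M : Matroid α) : Prop :=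
  ∀ D : CH M →ₗ[ℚ] ℚ, IsDeg M D → ∀ a, (∀ b, D (a * b) = 0) → a = 0

/-- The tensor product of two functionals. -/
noncomputable def tensorDeg {A B : Type*} [CommRing A] [Algebra ℚ A] [CommRing B] [Algebra ℚ B]
    (DA : A →ₗ[ℚ] ℚ) (DB : B →ₗ[ℚ] ℚ) : A ⊗[ℚ] B →ₗ[ℚ] ℚ :=
  LinearMap.mul' ℚ ℚ ∘ₗ TensorProduct.map DA DB

theorem tensorDeg_tmul {A B : Type*} [CommRing A] [Algebra ℚ A] [CommRing B] [Algebra ℚ B]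
    (DA : A →ₗ[ℚ] ℚ) (DB : B →ₗ[ℚ] ℚ) (a : A) (b : B) :
    tensorDeg DA DB (a ⊗ₜ b) = DA a * DB b := rfl

/-- A tensor product of nondegenerate pairings is nondegenerate. -/
theorem tensorDeg_nondegenerate {A B : Type*} [CommRing A] [Algebra ℚ A] [CommRing B]
    [Algebra ℚ B] [Module.Finite ℚ B] {DA : A →ₗ[ℚ] ℚ} {DB : B →ₗ[ℚ] ℚ}
    (hA : ∀ a, (∀ b, DA (a * b) = 0) → a = 0) (hB : ∀ a, (∀ b, DB (a * b) = 0) → a = 0)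
    (t : A ⊗[ℚ] B) (ht : ∀ u, tensorDeg DA DB (t * u) = 0) : t = 0 := by
  classical
  let b := Module.finBasis ℚ B
  let φ : B →ₗ[ℚ] Module.Dual ℚ B := (LinearMap.mul ℚ B).compr₂ DB
  have hφ : Function.Injective φ := by
    rw [injective_iff_map_eq_zero]
    exact fun a ha => hB a fun c => DFunLike.congr_fun ha c
  have hφs : Function.Surjective φ :=
    (LinearMap.injective_iff_surjective_of_finrank_eq_finrank
      (Subspace.dual_finrank_eq (K := ℚ) (V := B)).symm).1 hφ
  obtain ⟨c, rfl⟩ := TensorProduct.eq_repr_basis_right b t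
  have hc : ∀ k, c k = 0 := by
    intro k
    refine hA _ fun a => ?_
    -- By finite dimension the injective map from `B` to its dual is onto, so the `k`-th coordinate
    -- is pairing with some `d`. Pairing `t` with `a ⊗ d` then isolates the coefficient `c k`.
    obtain ⟨d, hd⟩ := hφs (b.coord k)
    have h1 := ht (a ⊗ₜ d)
    have h2 : ∀ j, DB (b j * d) = if j = k then 1 else 0 := by
      intro j
      have h3 : DB (d * b j) = b.coord k (b j) := DFunLike.congr_fun hd (b j)
      rw [mul_comm, h3, Module.Basis.coord_apply, Module.Basis.repr_self, Finsupp.single_apply]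
    rw [Finsupp.sum, Finset.sum_mul, map_sum] at h1
    simp_rw [Algebra.TensorProduct.tmul_mul_tmul, tensorDeg_tmul, h2, mul_ite, mul_one,
      mul_zero] at h1
    rw [Finset.sum_ite_eq'] at h1
    split_ifs at h1 with h4
    · exact h1
    · rw [Finsupp.notMem_support_iff.1 h4, zero_mul, map_zero]
  rw [Finsupp.sum, Finset.sum_eq_zero]
  intro k _
  rw [hc k, TensorProduct.zero_tmul]

/-! ### The grading of the tensor product. -/

section GradedTensor

variable (M N : Matroid α)

theorem grTensor_eq_span (k : ℕ) : grTensor M N k = Submodule.span ℚ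
    {t | ∃ p q a b, p + q = k ∧ a ∈ gr M p ∧ b ∈ gr N q ∧ t = a ⊗ₜ[ℚ] b} := by
  apply le_antisymm
  · refine iSup₂_le fun p hp => ?_
    rw [Submodule.map₂_le]
    intro a ha b hb
    exact Submodule.subset_span ⟨p.1, p.2, a, b, Finset.HasAntidiagonal.mem_antidiagonal.1 hp, ha, hb, rfl⟩
  · rw [Submodule.span_le]
    rintro _ ⟨p, q, a, b, hpq, ha, hb, rfl⟩
    refine Submodule.mem_iSup_of_mem (p, q) (Submodule.mem_iSup_of_mem ?_ ?_)
    · exact Finset.HasAntidiagonal.mem_antidiagonal.2 hpq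
    · exact Submodule.apply_mem_map₂ _ ha hb

theorem tmul_mem_grTensor {p q k : ℕ} (h : p + q = k) {a : CH M} {b : CH N} (ha : a ∈ gr M p)
    (hb : b ∈ gr N q) : a ⊗ₜ[ℚ] b ∈ grTensor M N k := by
  rw [grTensor_eq_span]
  exact Submodule.subset_span ⟨p, q, a, b, h, ha, hb, rfl⟩

theorem exists_components_tensor (t : CH M ⊗[ℚ] CH N) :
    ∃ c : ℕ →₀ CH M ⊗[ℚ] CH N, (∀ k, c k ∈ grTensor M N k) ∧ t = c.sum fun _ b => b := by
  have h : t ∈ ⨆ k, grTensor M N k := by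
    induction t using TensorProduct.induction_on with
    | zero => exact zero_mem _
    | add a b ha hb => exact add_mem ha hb
    | tmul a b =>
      obtain ⟨c, hc, rfl⟩ := exists_components M a
      obtain ⟨d, hd, rfl⟩ := exists_components N b
      rw [Finsupp.sum, Finsupp.sum, TensorProduct.sum_tmul]
      refine sum_mem fun k _ => ?_
      rw [TensorProduct.tmul_sum]
      exact sum_mem fun l _ => Submodule.mem_iSup_of_mem (k + l)
        (tmul_mem_grTensor M N rfl (hc k) (hd l))
  obtain ⟨c, hc, h⟩ := (Submodule.mem_iSup_iff_exists_finsupp _ _).1 h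
  exact ⟨c, hc, h.symm⟩

theorem eq_zero_of_mem_grTensor [M.Finite] [M.Loopless] [N.Finite] [N.Loopless] {k : ℕ}
    (hk : topDeg M + topDeg N < k) {t : CH M ⊗[ℚ] CH N} (ht : t ∈ grTensor M N k) : t = 0 := by
  rw [grTensor_eq_span] at ht
  rw [← Submodule.mem_bot ℚ]
  refine (Submodule.span_le.2 ?_ : _ ≤ (⊥ : Submodule ℚ _)) ht
  rintro _ ⟨p, q, a, b, h1, ha, hb, rfl⟩
  rw [SetLike.mem_coe, Submodule.mem_bot]
  by_cases hp : topDeg M < p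
  · rw [eq_zero_of_mem_gr M hp ha, TensorProduct.zero_tmul]
  · rw [eq_zero_of_mem_gr N (by omega) hb, TensorProduct.tmul_zero]

end GradedTensor

/-! ### Flats of minors -/

section Minors

variable {M : Matroid α}

theorem loopless_delete [M.Loopless] (i : α) : (M ＼ {i}).Loopless :=
  (M.delete_isRestriction {i}).loopless

theorem loopless_restrict [M.Loopless] {F : Set α} (hF : F ⊆ M.E) : (M ↾ F).Loopless :=
  (Matroid.restrict_isRestriction M F hF).loopless

theorem loopless_contract {K : Set α} (hK : M.IsFlat K) : (M ／ K).Loopless :=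
  ⟨by rw [Matroid.contract_loops_eq, hK.closure, Set.sdiff_self]⟩

theorem isFlat_restrict_iff {F : Set α} (hF : M.IsFlat F) {S : Set α} :
    (M ↾ F).IsFlat S ↔ M.IsFlat S ∧ S ⊆ F := by
  constructor
  · intro h
    have hS : S ⊆ F := h.subset_ground
    refine ⟨?_, hS⟩
    have h1 := h.closure
    rw [Matroid.restrict_closure_eq M hS hF.subset_ground] at h1
    rw [Matroid.isFlat_iff_closure_eq]
    conv_rhs => rw [← h1]
    refine (Set.inter_eq_left.2 ?_).symm
    conv_rhs => rw [← hF.closure]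
    exact M.closure_subset_closure hS
  · rintro ⟨h, hS⟩
    rw [Matroid.isFlat_iff_closure_eq, Matroid.restrict_closure_eq M hS hF.subset_ground,
      h.closure, Set.inter_eq_left.2 hS]

theorem pf_restrict_iff {F : Set α} (hF : PF M F) {S : Set α} :
    PF (M ↾ F) S ↔ PF M S ∧ S ⊂ F := by
  rw [PF, isFlat_restrict_iff hF.1]
  constructor
  · rintro ⟨⟨h1, h2⟩, h3, h4⟩
    refine ⟨⟨h1, h3, fun h => hF.2.2 (hF.1.subset_ground.antisymm (h ▸ h2))⟩, ?_⟩
    exact h2.ssubset_of_ne h4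
  · rintro ⟨⟨h1, h2, h3⟩, h4⟩
    exact ⟨⟨h1, h4.subset⟩, h2, h4.ne⟩

theorem isFlat_contract_iff {K : Set α} (hK : K ⊆ M.E) {S : Set α} (hS : Disjoint S K) :
    (M ／ K).IsFlat S ↔ M.IsFlat (S ∪ K) := by
  rw [Matroid.isFlat_iff_closure_eq, Matroid.contract_closure_eq, Matroid.isFlat_iff_closure_eq]
  constructor
  · intro h
    have hSE : S ⊆ M.E := by
      rw [← h]
      exact Set.sdiff_subset.trans (M.closure_subset_ground _)
    refine Set.Subset.antisymm ?_ (M.subset_closure _ (Set.union_subset hSE hK))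
    intro a ha
    by_cases haK : a ∈ K
    · exact Or.inr haK
    · exact Or.inl (h ▸ ⟨ha, haK⟩)
  · intro h
    rw [h, Set.union_sdiff_right, hS.sdiff_eq_left]

theorem pf_contract_iff {K : Set α} (hK : K ⊆ M.E) {S : Set α} :
    PF (M ／ K) S ↔ PF M (S ∪ K) ∧ Disjoint S K ∧ S.Nonempty := by
  constructor
  · rintro ⟨h1, h2, h3⟩
    have hS : S ⊆ M.E \ K := h1.subset_ground
    have hd : Disjoint S K := Set.disjoint_of_subset_left hS Set.disjoint_sdiff_left
    refine ⟨⟨(isFlat_contract_iff hK hd).1 h1, h2.mono Set.subset_union_left, fun h => h3 ?_⟩,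
      hd, h2⟩
    rw [Matroid.contract_ground, ← h, Set.union_sdiff_right, hd.sdiff_eq_left]
  · rintro ⟨h1, h2, h3⟩
    refine ⟨(isFlat_contract_iff hK h2).2 h1.1, h3, fun h => h1.2.2 ?_⟩
    rw [h, Matroid.contract_ground, Set.sdiff_union_of_subset hK]

theorem isFlat_delete_iff {i : α} {S : Set α} (hS : S ⊆ M.E \ {i}) :
    (M ＼ {i}).IsFlat S ↔ M.closure S = S ∨ M.closure S = insert i S := by
  have hiS : i ∉ S := fun h => (hS h).2 rfl
  have hSE : S ⊆ M.E := hS.trans Set.sdiff_subset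
  rw [Matroid.isFlat_iff_closure_eq, Matroid.delete_closure_eq, Set.sdiff_singleton_eq_self hiS]
  constructor
  · intro h
    by_cases hi : i ∈ M.closure S
    · right
      rw [← Set.insert_sdiff_self_of_mem hi, h]
    · left
      rwa [Set.sdiff_singleton_eq_self hi] at h
  · rintro (h | h)
    · rw [h, Set.sdiff_singleton_eq_self hiS]
    · rw [h, Set.insert_sdiff_self_of_notMem hiS]

variable [M.Finite]

theorem rk_restrict (F : Set α) : rk (M ↾ F) (M ↾ F).E = rk M F := by
  rw [rk, rk, Matroid.restrict_ground_eq, Matroid.restrict_eRk_eq M subset_rfl]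

theorem rk_contract {K : Set α} (hK : K ⊆ M.E) :
    rk (M ／ K) (M ／ K).E + rk M K = rk M M.E := by
  obtain ⟨I, hI⟩ := M.exists_isBasis K
  obtain ⟨B, hB, hIB⟩ := hI.indep.exists_isBase_superset
  have hBK : B ∩ K = I :=
    (hI.eq_of_subset_indep (hB.indep.inter_right K) (Set.subset_inter hIB hI.subset)
      Set.inter_subset_right).symm
  have hd : Disjoint K (B \ I) := by
    rw [Set.disjoint_left]
    exact fun a haK ha => ha.2 (hBK ▸ ⟨ha.1, haK⟩)
  have hbase : (M ／ K).IsBase (B \ I) := by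
    have h1 : (M ／ K).Indep (B \ I) := by
      rw [hI.contract_indep_iff]
      refine ⟨?_, hd⟩
      rw [Set.sdiff_union_of_subset hIB]
      exact hB.indep
    refine h1.isBase_of_spanning ((Matroid.contract_spanning_iff hK).2 ⟨?_, hd.symm⟩)
    refine hB.spanning.superset ?_ (Set.union_subset (Set.sdiff_subset.trans hB.subset_ground) hK)
    intro a ha
    by_cases haI : a ∈ I
    · exact Or.inr (hI.subset haI)
    · exact Or.inl ⟨ha, haI⟩
  have e1 : (rk (M ／ K) (M ／ K).E : ℕ∞) = (B \ I).encard := by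
    rw [coe_rk, Matroid.eRk_ground, hbase.encard_eq_eRank]
  have e2 : (rk M K : ℕ∞) = I.encard := by rw [coe_rk, hI.encard_eq_eRk]
  have e3 : (rk M M.E : ℕ∞) = B.encard := by rw [coe_rk, Matroid.eRk_ground, hB.encard_eq_eRank]
  have e4 := Set.encard_sdiff_add_encard_of_subset hIB
  rw [← e1, ← e2, ← e3] at e4
  exact_mod_cast e4

theorem rk_delete_of_not_isColoop {i : α} (hi : ¬ M.IsColoop i) :
    rk (M ＼ {i}) (M ＼ {i}).E = rk M M.E := by
  rw [Matroid.isColoop_iff_sdiff_not_spanning, not_not] at hi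
  rw [rk, rk, Matroid.eRk_ground, Matroid.eRk_ground, ← hi.eRank_restrict]
  rfl

theorem rk_delete_of_isColoop {i : α} (hi : M.IsColoop i) :
    rk (M ＼ {i}) (M ＼ {i}).E + 1 = rk M M.E := by
  have h1 := rk_insert M (S := M.E \ {i}) hi.mem_ground
    (hi.notMem_closure_of_notMem fun h => h.2 rfl)
  rw [Set.insert_sdiff_singleton, Set.insert_eq_of_mem hi.mem_ground] at h1
  rw [h1, rk, rk, Matroid.delete_ground, Matroid.delete_eq_restrict,
    Matroid.restrict_eRk_eq M subset_rfl]

end Minors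

/-! ### Generators of the Chow ring over the Chow ring of the deletion -/

section Si

variable {M : Matroid α} {i : α} {F : Set α}

theorem Si.notMem (hF : F ∈ Si M i) : i ∉ F := fun h => (hF.2.1.subset h).2 rfl

theorem Si.subset (hF : F ∈ Si M i) : F ⊆ M.E \ {i} := hF.2.1.subset

theorem Si.exists_notMem (hF : F ∈ Si M i) : ∃ l ∈ M.E, l ∉ insert i F := by
  obtain ⟨l, hl, hlF⟩ := Set.exists_of_ssubset hF.2.1
  exact ⟨l, hl.1, fun h => h.elim hl.2 hlF⟩

theorem Si.pf (hF : F ∈ Si M i) : PF M F := by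
  obtain ⟨l, hl, hlF⟩ := Si.exists_notMem hF
  exact ⟨hF.2.2.1, hF.1, fun h => hlF (Or.inr (h ▸ hl))⟩

theorem Si.pf_insert (hF : F ∈ Si M i) : PF M (insert i F) := by
  obtain ⟨l, hl, hlF⟩ := Si.exists_notMem hF
  exact ⟨hF.2.2.2, Set.insert_nonempty _ _, fun h => hlF (h ▸ hl)⟩

theorem Si.pf_delete (hF : F ∈ Si M i) : PF (M ＼ {i}) F :=
  ⟨isFlat_delete M i hF.2.2.1 (by simp [Si.notMem hF]), hF.1, hF.2.1.ne⟩

end Si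

/-! ### Linear forms under deletion and their products with `x_{F ∪ i}`. -/

section InsertSums

variable (M : Matroid α) [M.Finite] {i : α}

theorem notMem_of_mem_subs_delete {T : Set α} (hT : T ∈ subs (M ＼ {i})) : i ∉ T :=
  fun h => ((mem_subs _).1 hT h).2 rfl

theorem theta_x_of_pf {T : Set α} (hT : PF (M ＼ {i}) T) :
    theta M i (x (M ＼ {i}) T) = x M T + x M (insert i T) :=
  theta_x M i ⟨T, hT⟩

theorem pf_delete_of_pf {T G : Set α} (hne : T.Nonempty)
    (hG : PF M G) (hGT : T = G \ {i}) (hTE : T ≠ M.E \ {i}) : PF (M ＼ {i}) T :=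
  ⟨isFlat_delete M i hG.1 hGT, hne, hTE⟩

theorem x_insert_ground : x M (insert i (M.E \ {i})) = 0 := by
  apply x_of_not
  rintro ⟨h1, -, h3⟩
  have hi : i ∈ M.E := h1.subset_ground (Set.mem_insert _ _)
  exact h3 (by rw [Set.insert_sdiff_singleton, Set.insert_eq_of_mem hi])

/-- `x_T + x_{T ∪ i}` is in the image of `θ` unless `T` is `∅` or `E ∖ i`. -/
theorem x_add_x_insert {T : Set α} (hT : T ⊆ M.E \ {i}) (hne : T.Nonempty) (hTE : T ≠ M.E \ {i}) :
    x M T + x M (insert i T) = theta M i (x (M ＼ {i}) T) := by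
  by_cases h : PF (M ＼ {i}) T
  · exact (theta_x_of_pf M h).symm
  · have hiT : i ∉ T := fun h => (hT h).2 rfl
    rw [x_of_not _ h, map_zero, x_of_not M, x_of_not M, add_zero]
    · exact fun h1 => h (pf_delete_of_pf M hne h1 (by simp [hiT]) hTE)
    · exact fun h1 => h (pf_delete_of_pf M hne h1 (by simp [hiT]) hTE)

theorem sum_subs_eq {A : Type*} [AddCommMonoid A] (hi : i ∈ M.E) (g : Set α → A) :
    ∑ S ∈ subs M, g S = ∑ T ∈ subs (M ＼ {i}), (g T + g (insert i T)) := by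
  classical
  rw [← Finset.sum_filter_add_sum_filter_not (subs M) (fun S => i ∉ S), Finset.sum_add_distrib]
  congr 1
  · refine Finset.sum_congr ?_ fun _ _ => rfl
    ext S
    rw [Finset.mem_filter, mem_subs, mem_subs, Matroid.delete_ground, Set.subset_sdiff,
      Set.disjoint_singleton_right]
  · refine Finset.sum_nbij' (fun S => S \ {i}) (fun T => insert i T) ?_ ?_ ?_ ?_ ?_
    · intro S hS
      rw [Finset.mem_filter, mem_subs] at hS
      exact (mem_subs _).2 (Set.sdiff_subset_sdiff_left hS.1)
    · intro T hT
      rw [mem_subs] at hT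
      rw [Finset.mem_filter, mem_subs, not_not]
      exact ⟨Set.insert_subset hi (hT.trans Set.sdiff_subset), Set.mem_insert _ _⟩
    · intro S hS
      rw [Finset.mem_filter, not_not] at hS
      rw [Set.insert_sdiff_singleton, Set.insert_eq_of_mem hS.2]
    · intro T hT
      simp [notMem_of_mem_subs_delete M hT]
    · intro S hS
      rw [Finset.mem_filter, not_not] at hS
      rw [Set.insert_sdiff_singleton, Set.insert_eq_of_mem hS.2]

open Classical in
/-- The class `∑_{j ∈ S} x_S`. -/
noncomputable def linSum (j : α) : CH M := ∑ S ∈ subs M with j ∈ S, x M S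

theorem linSum_eq_toCH (j : α) : linSum M j = toCH M (linForm M j) :=
  (toCH_linForm_eq M j).symm

theorem linSum_congr {j l : α} (hj : j ∈ M.E) (hl : l ∈ M.E) : linSum M j = linSum M l :=
  sum_x_eq M hj hl

open Classical in
theorem linSum_of_ne (hi : i ∈ M.E) {j : α} (hj : j ≠ i) : linSum M j =
    ∑ T ∈ subs (M ＼ {i}), if j ∈ T then x M T + x M (insert i T) else 0 := by
  rw [linSum, Finset.sum_filter, sum_subs_eq M hi]
  refine Finset.sum_congr rfl fun T _ => ?_
  by_cases h : j ∈ T <;> simp [h, hj]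

theorem linSum_self (hi : i ∈ M.E) :
    linSum M i = ∑ T ∈ subs (M ＼ {i}), x M (insert i T) := by
  classical
  rw [linSum, Finset.sum_filter, sum_subs_eq M hi]
  refine Finset.sum_congr rfl fun T hT => ?_
  simp [notMem_of_mem_subs_delete M hT]

/-- The two sides differ by `x_{E ∖ i}` because `E ∖ i` is not a proper flat of the deletion. -/
theorem linSum_eq_theta {j : α} (hj : j ∈ M.E \ {i}) :
    linSum M j = theta M i (linSum (M ＼ {i}) j) + x M (M.E \ {i}) := by
  rw [linSum_eq_toCH, linSum_eq_toCH, ← sub_eq_iff_eq_add]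
  exact (thetaPoly_linForm M i j hj).symm

open Classical in
theorem sum_trichotomy {A : Type*} [AddCommMonoid A] (U : Finset (Set α)) {F : Set α}
    (hF : F ∈ U) (h : Set α → A) (h0 : ∀ T ∈ U, ¬ T ⊆ F → ¬ F ⊆ T → h T = 0) :
    ∑ T ∈ U, h T = ∑ T ∈ U with T ⊂ F, h T + h F + ∑ T ∈ U with F ⊂ T, h T := by
  have h1 : h F = ∑ T ∈ U, if T = F then h T else 0 := by
    rw [Finset.sum_ite_eq', if_pos hF]
  rw [h1, Finset.sum_filter, Finset.sum_filter, ← Finset.sum_add_distrib,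
    ← Finset.sum_add_distrib]
  refine Finset.sum_congr rfl fun T hT => ?_
  by_cases h2 : T = F
  · subst h2; simp
  by_cases h3 : T ⊆ F
  · have h4 : T ⊂ F := h3.ssubset_of_ne h2
    have h5 : ¬ F ⊂ T := fun h => h.2 h3
    simp [h2, h4, h5]
  by_cases h4 : F ⊆ T
  · have h5 : F ⊂ T := h4.ssubset_of_ne (Ne.symm h2)
    have h6 : ¬ T ⊂ F := fun h => h3 h.subset
    simp [h2, h5, h6]
  · have h5 : ¬ F ⊂ T := fun h => h4 h.subset
    have h6 : ¬ T ⊂ F := fun h => h3 h.subset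
    simp [h2, h5, h6, h0 T hT h3 h4]

variable {M} {F : Set α}

theorem x_mul_x_insert {T : Set α} (hiT : i ∉ T) (hT : ¬ T ⊆ F) :
    x M T * x M (insert i F) = 0 :=
  x_mul_x M (fun h => hT ((Set.subset_insert_iff_of_notMem hiT).1 h))
    fun h => hiT (h (Set.mem_insert _ _))

theorem x_insert_mul_x_insert (hF : F ∈ Si M i) {T : Set α} (hiT : i ∉ T) (h₁ : ¬ T ⊆ F) (h₂ : ¬ F ⊆ T) :
    x M (insert i T) * x M (insert i F) = 0 :=
  x_mul_x M (fun h => h₁ ((Set.insert_subset_insert_iff hiT).1 h))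
    fun h => h₂ ((Set.insert_subset_insert_iff (Si.notMem hF)).1 h)

theorem Si.mem_subs (hF : F ∈ Si M i) : F ∈ subs (M ＼ {i}) := (MatroidChow.mem_subs _).2 (Si.subset hF)

-- A flat that contains `j ∉ F ∪ i` and is comparable with `F ∪ i` contains it strictly. Comparing
-- this expansion with those for `j ∈ F` and for `i` yields all the relations needed in the summand
-- of `F`.
open Classical in
theorem linSum_mul_of_notMem (hF : F ∈ Si M i) (hi : i ∈ M.E) {j : α} (hj : j ∉ insert i F) :
    linSum M j * x M (insert i F) =
      ∑ T ∈ subs (M ＼ {i}) with F ⊂ T ∧ j ∈ T, x M (insert i T) * x M (insert i F) := by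
  have hji : j ≠ i := fun h => hj (Or.inl h)
  have hjF : j ∉ F := fun h => hj (Or.inr h)
  rw [linSum_of_ne M hi hji, Finset.sum_mul, Finset.sum_filter]
  refine Finset.sum_congr rfl fun T hT => ?_
  have hiT := notMem_of_mem_subs_delete M hT
  by_cases hjT : j ∈ T
  · have h1 : ¬ T ⊆ F := fun h => hjF (h hjT)
    rw [if_pos hjT, add_mul, x_mul_x_insert hiT h1, zero_add]
    by_cases h2 : F ⊂ T
    · rw [if_pos ⟨h2, hjT⟩]
    · rw [if_neg fun h => h2 h.1, x_insert_mul_x_insert hF hiT h1]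
      exact fun h => h2 ⟨h, h1⟩
  · rw [if_neg hjT, if_neg fun h => hjT h.2, zero_mul]

open Classical in
theorem linSum_mul_of_mem (hF : F ∈ Si M i) (hi : i ∈ M.E) {j : α} (hj : j ∈ F) :
    linSum M j * x M (insert i F) =
      ∑ T ∈ subs (M ＼ {i}) with T ⊂ F ∧ j ∈ T,
        (x M T + x M (insert i T)) * x M (insert i F) +
      (x M F + x M (insert i F)) * x M (insert i F) +
      ∑ T ∈ subs (M ＼ {i}) with F ⊂ T, x M (insert i T) * x M (insert i F) := by
  have hji : j ≠ i := fun h => Si.notMem hF (h ▸ hj)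
  rw [linSum_of_ne M hi hji, Finset.sum_mul, sum_trichotomy _ (Si.mem_subs hF)]
  · congr 1
    · congr 1
      · rw [← Finset.filter_filter, Finset.sum_filter (fun T => j ∈ T)]
        refine Finset.sum_congr rfl fun T _ => ?_
        split_ifs <;> simp
      · rw [if_pos hj]
    · refine Finset.sum_congr rfl fun T hT => ?_
      rw [Finset.mem_filter] at hT
      rw [if_pos (hT.2.subset hj), add_mul,
        x_mul_x_insert (notMem_of_mem_subs_delete M hT.1) hT.2.2, zero_add]
  · intro T hT h₁ h₂
    have hiT := notMem_of_mem_subs_delete M hT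
    split_ifs
    · rw [add_mul, x_mul_x_insert hiT h₁, x_insert_mul_x_insert hF hiT h₁ h₂, add_zero]
    · rw [zero_mul]

open Classical in
theorem linSum_self_mul (hF : F ∈ Si M i) (hi : i ∈ M.E) :
    linSum M i * x M (insert i F) =
      ∑ T ∈ subs (M ＼ {i}) with T ⊂ F, x M (insert i T) * x M (insert i F) +
      x M (insert i F) * x M (insert i F) +
      ∑ T ∈ subs (M ＼ {i}) with F ⊂ T, x M (insert i T) * x M (insert i F) := by
  rw [linSum_self M hi, Finset.sum_mul, sum_trichotomy _ (Si.mem_subs hF)]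
  intro T hT h₁ h₂
  exact x_insert_mul_x_insert hF (notMem_of_mem_subs_delete M hT) h₁ h₂

/-- For `F ⊂ T`, multiplication of `x_{F ∪ i}` by `x_{T ∪ i}` is multiplication by `θ(x_T)`. -/
theorem x_insert_mul_of_ssubset (hF : F ∈ Si M i) {T : Set α} (hT : T ⊆ M.E \ {i}) (hFT : F ⊂ T) :
    x M (insert i T) * x M (insert i F) =
      theta M i (x (M ＼ {i}) T) * x M (insert i F) := by
  by_cases hTE : T = M.E \ {i}
  · have h1 : ¬ PF (M ＼ {i}) T := fun h => h.2.2 hTE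
    rw [x_of_not _ h1, map_zero, hTE, x_insert_ground]
  · rw [← x_add_x_insert M hT (hF.1.mono hFT.subset) hTE, add_mul,
      x_mul_x_insert (fun h => (hT h).2 rfl) hFT.2, zero_add]

end InsertSums

/-! ### Module generators over the Chow ring of the deletion. -/

section Span

variable (M : Matroid α) [M.Finite] {i : α}

/-- `T` is the intersection of the flats `T ∪ i` and `F`. -/
theorem mem_Si_of_ssubset {F T : Set α} (hF : F ∈ Si M i) (hT : T ⊂ F) (hne : T.Nonempty)
    (h : M.IsFlat (insert i T)) : T ∈ Si M i := by
  refine ⟨hne, hT.subset.trans_ssubset hF.2.1, ?_, h⟩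
  have h1 : T = insert i T ∩ F := by
    rw [Set.insert_inter_of_notMem (Si.notMem hF), Set.inter_eq_left.2 hT.subset]
  rw [h1, Matroid.isFlat_iff_closure_eq]
  refine Set.Subset.antisymm (Set.subset_inter ?_ ?_) (M.subset_closure _
    (Set.inter_subset_right.trans hF.2.2.1.subset_ground))
  · conv_rhs => rw [← h.closure]
    exact M.closure_subset_closure Set.inter_subset_left
  · conv_rhs => rw [← hF.2.2.1.closure]
    exact M.closure_subset_closure Set.inter_subset_right

/-- An additive subgroup that contains the image of `θ`, `x_{E ∖ i}` and the `x_{F ∪ i}` for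
`F ∈ 𝒮_i` contains all generators. -/
theorem x_mem_addSubgroup [M.Loopless] (hi : i ∈ M.E) (W : AddSubgroup (CH M))
    (hθ : ∀ a, theta M i a ∈ W) (htop : x M (M.E \ {i}) ∈ W)
    (hS : ∀ F ∈ Si M i, x M (insert i F) ∈ W) (G : Set α) : x M G ∈ W := by
  classical
  have key : ∀ T ⊆ M.E \ {i}, T.Nonempty → x M (insert i T) ∈ W := by
    intro T hT hne
    by_cases hPF : PF M (insert i T)
    swap
    · rw [x_of_not M hPF]; exact zero_mem _
    have hTE : T ≠ M.E \ {i} := by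
      rintro rfl
      exact hPF.2.2 (by rw [Set.insert_sdiff_singleton, Set.insert_eq_of_mem hi])
    by_cases hTf : M.IsFlat T
    · exact hS T ⟨hne, hT.ssubset_of_ne hTE, hTf, hPF.1⟩
    -- If `T` is not a flat of `M`, then `θ(x_T)` is `x_{T ∪ i}` alone.
    · have h1 := x_add_x_insert M hT hne hTE
      rw [x_of_not M fun h => hTf h.1, zero_add] at h1
      rw [h1]
      exact hθ _
  -- The generator `x_{i}` belongs to `T = ∅`, where `θ` offers nothing. It is solved for in the
  -- relation between the linear forms of `i` and of some `j ≠ i`.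
  have hsing : x M {i} ∈ W := by
    by_cases hPF : PF M {i}
    swap
    · rw [x_of_not M hPF]; exact zero_mem _
    obtain ⟨j, hj, hji⟩ := Set.exists_of_ssubset (hPF.1.subset_ground.ssubset_of_ne hPF.2.2)
    have h1 := linSum_self M hi
    have h0 : (∅ : Set α) ∈ subs (M ＼ {i}) := (mem_subs _).2 (Set.empty_subset _)
    rw [linSum_congr M hi hj, linSum_eq_theta M ⟨hj, hji⟩, ← Finset.add_sum_erase _ _ h0,
      insert_empty_eq] at h1
    rw [← sub_eq_iff_eq_add] at h1
    rw [← h1]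
    refine sub_mem (add_mem (hθ _) htop) (sum_mem fun T hT => ?_)
    rw [Finset.mem_erase, mem_subs] at hT
    exact key T hT.2 (Set.nonempty_iff_ne_empty.2 hT.1)
  by_cases hPF : PF M G
  swap
  · rw [x_of_not M hPF]; exact zero_mem _
  by_cases hiG : i ∈ G
  · have hG : insert i (G \ {i}) = G := by
      rw [Set.insert_sdiff_singleton, Set.insert_eq_of_mem hiG]
    rcases (G \ {i}).eq_empty_or_nonempty with h | h
    · rw [← hG, h, insert_empty_eq]
      exact hsing
    · rw [← hG]
      exact key _ (Set.sdiff_subset_sdiff_left hPF.1.subset_ground) h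
  · have hGE : G ⊆ M.E \ {i} := Set.subset_sdiff_singleton hPF.1.subset_ground hiG
    by_cases hG : G = M.E \ {i}
    · rw [hG]; exact htop
    · have h1 := x_add_x_insert M hGE hPF.2.1 hG
      rw [← eq_sub_iff_add_eq] at h1
      rw [h1]
      exact sub_mem (hθ _) (key G hGE hPF.2.1)

/-- `x_{E ∖ i} ^ 2 = - α x_{E ∖ i}`. -/
theorem x_compl_mul_self (hi : i ∈ M.E) {j : α} (hj : j ∈ M.E \ {i}) :
    x M (M.E \ {i}) * x M (M.E \ {i}) =
      - (theta M i (linSum (M ＼ {i}) j) * x M (M.E \ {i})) := by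
  -- No proper flat that contains `i` is comparable with `E ∖ i`.
  have h1 : linSum M i * x M (M.E \ {i}) = 0 := by
    rw [linSum_self M hi, Finset.sum_mul]
    refine Finset.sum_eq_zero fun T hT => ?_
    rw [mem_subs] at hT
    by_cases hTE : T = M.E \ {i}
    · rw [hTE, x_insert_ground, zero_mul]
    · refine x_mul_x M (fun h => (h (Set.mem_insert _ _)).2 rfl) fun h => hTE ?_
      refine Set.Subset.antisymm hT fun a ha => ?_
      exact (h ha).resolve_left ha.2
  rw [linSum_congr M hi hj.1, linSum_eq_theta M hj, add_mul] at h1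
  exact eq_neg_of_add_eq_zero_right h1

theorem x_compl_mul_x_insert {F : Set α} (hF : F ∈ Si M i) :
    x M (M.E \ {i}) * x M (insert i F) = 0 := by
  obtain ⟨l, hl, hlF⟩ := Si.exists_notMem hF
  exact x_mul_x M (fun h => hlF (h ⟨hl, fun h' => hlF (Or.inl h')⟩))
    fun h => (h (Set.mem_insert _ _)).2 rfl

theorem smul_eq_theta_mul (a : CH (M ＼ {i})) (b : CH M) : a • b = theta M i a * b := rfl

/-- The Chow ring is generated over the Chow ring of the deletion by `1`, `x_{E ∖ i}` and the
`x_{F ∪ i}`, for `F ∈ 𝒮_i`. -/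
theorem span_generators [M.Loopless] (hi : i ∈ M.E) :
    Submodule.span (CH (M ＼ {i}))
      ({1, x M (M.E \ {i})} ∪ {a | ∃ F ∈ Si M i, a = x M (insert i F)}) = ⊤ := by
  classical
  set P := Submodule.span (CH (M ＼ {i}))
      ({1, x M (M.E \ {i})} ∪ {a | ∃ F ∈ Si M i, a = x M (insert i F)}) with hP
  have h1 : (1 : CH M) ∈ P := Submodule.subset_span (Or.inl (Or.inl rfl))
  have htop : x M (M.E \ {i}) ∈ P := Submodule.subset_span (Or.inl (Or.inr rfl))
  have hS : ∀ F ∈ Si M i, x M (insert i F) ∈ P := fun F hF =>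
    Submodule.subset_span (Or.inr ⟨F, hF, rfl⟩)
  have hθm : ∀ a, ∀ b ∈ P, theta M i a * b ∈ P := fun a b hb => P.smul_mem a hb
  have hθ : ∀ a, theta M i a ∈ P := fun a => by simpa using hθm a 1 h1
  have hxP : ∀ G, x M G ∈ P := x_mem_addSubgroup M hi P.toAddSubgroup hθ htop hS
  -- The multipliers of `P`. Once they contain all generators of the ring, `P` is an ideal, and it
  -- contains `1`. The same criterion `x_mem_addSubgroup` serves for `P` and for `A`.
  let A : AddSubgroup (CH M) :=
    { carrier := {c | ∀ b ∈ P, c * b ∈ P}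
      add_mem' := fun ha hb c hc => by rw [add_mul]; exact add_mem (ha c hc) (hb c hc)
      zero_mem' := fun c _ => by rw [zero_mul]; exact zero_mem _
      neg_mem' := fun ha c hc => by rw [neg_mul]; exact neg_mem (ha c hc) }
  have hgen : ∀ c : CH M, c ∈ P → c * x M (M.E \ {i}) ∈ P →
      (∀ F ∈ Si M i, c * x M (insert i F) ∈ P) → c ∈ A := by
    intro c h2 h3 h4 b hb
    rw [hP] at hb
    induction hb using Submodule.span_induction with
    | mem b hb =>
      rcases hb with (rfl | rfl) | ⟨F, hF, rfl⟩
      · rwa [mul_one]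
      · exact h3
      · exact h4 F hF
    | zero => rw [mul_zero]; exact zero_mem _
    | add a b _ _ ha hb => rw [mul_add]; exact add_mem ha hb
    | smul a b _ hb =>
      rw [smul_eq_theta_mul, mul_left_comm]
      exact hθm a _ hb
  have hAtop : x M (M.E \ {i}) ∈ A := by
    refine hgen _ htop ?_ fun F hF => ?_
    · rcases (M.E \ {i}).eq_empty_or_nonempty with h | ⟨j, hj⟩
      · rw [x_of_not M fun h' => h'.2.1.ne_empty h, mul_zero]
        exact zero_mem _
      · rw [x_compl_mul_self M hi hj]
        exact neg_mem (hθm _ _ htop)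
    · rw [x_compl_mul_x_insert M hF]
      exact zero_mem _
  have hmulS : ∀ F ∈ Si M i, ∀ F' ∈ Si M i, F ⊂ F' → x M (insert i F') * x M (insert i F) ∈ P := by
    intro F hF F' hF' hFF
    rw [x_insert_mul_of_ssubset hF (Si.subset hF') hFF]
    exact hθm _ _ (hS F hF)
  have hAS : ∀ F ∈ Si M i, x M (insert i F) ∈ A := by
    intro F hF
    refine hgen _ (hS F hF) ?_ fun F' hF' => ?_
    · rw [mul_comm, x_compl_mul_x_insert M hF]
      exact zero_mem _
    by_cases hFF : F ⊆ F'
    · by_cases hFF' : F = F'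
      · subst hFF'
        -- The square is solved for in the relation between the linear forms of `i` and of `l ∉ F ∪
        -- i`, multiplied by `x_{F ∪ i}`. The other terms are products with `x_{T ∪ i}` for `T`
        -- strictly comparable with `F`.
        obtain ⟨l, hl, hlF⟩ := Si.exists_notMem hF
        have h2 := linSum_self_mul hF hi
        rw [linSum_congr M hi hl, linSum_mul_of_notMem hF hi hlF] at h2
        have habove : ∀ T ∈ subs (M ＼ {i}), F ⊂ T →
            x M (insert i T) * x M (insert i F) ∈ P := fun T hT hFT => by
          rw [x_insert_mul_of_ssubset hF ((mem_subs _).1 hT) hFT]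
          exact hθm _ _ (hS F hF)
        -- Here `x_F x_{T ∪ i} = 0`, so `x_{F ∪ i}` acts on `x_{T ∪ i}` as `θ(x_F)`. The case `T =
        -- ∅` is included, hence the use of `hxP`.
        have hbelow : ∀ T ∈ subs (M ＼ {i}), T ⊂ F →
            x M (insert i T) * x M (insert i F) ∈ P := fun T hT hFT => by
          have h3 : x M (insert i T) * x M (insert i F) =
              theta M i (x (M ＼ {i}) F) * x M (insert i T) := by
            rw [theta_x_of_pf M (Si.pf_delete hF), add_mul, x_mul_x M (S := F), zero_add, mul_comm]
            · exact fun h => hFT.2 ((Set.subset_insert_iff_of_notMem (Si.notMem hF)).1 h)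
            · exact fun h => Si.notMem hF (h (Set.mem_insert _ _))
          rw [h3]
          exact hθm _ _ (hxP _)
        have h4 : x M (insert i F) * x M (insert i F) =
            ∑ T ∈ subs (M ＼ {i}) with F ⊂ T ∧ l ∈ T, x M (insert i T) * x M (insert i F) -
            ∑ T ∈ subs (M ＼ {i}) with T ⊂ F, x M (insert i T) * x M (insert i F) -
            ∑ T ∈ subs (M ＼ {i}) with F ⊂ T, x M (insert i T) * x M (insert i F) := by
          rw [h2]; ring
        rw [h4]
        refine sub_mem (sub_mem (sum_mem fun T hT => ?_) (sum_mem fun T hT => ?_))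
          (sum_mem fun T hT => ?_)
        · rw [Finset.mem_filter] at hT
          exact habove T hT.1 hT.2.1
        · rw [Finset.mem_filter] at hT
          exact hbelow T hT.1 hT.2
        · rw [Finset.mem_filter] at hT
          exact habove T hT.1 hT.2
      · rw [mul_comm]
        exact hmulS F hF F' hF' (hFF.ssubset_of_ne hFF')
    · by_cases hFF' : F' ⊆ F
      · exact hmulS F' hF' F hF ⟨hFF', hFF⟩
      · rw [mul_comm, x_insert_mul_x_insert hF (Si.notMem hF') hFF' hFF]
        exact zero_mem _
  have hA : ∀ G, x M G ∈ A := x_mem_addSubgroup M hi A (fun a => hθm a) hAtop hAS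
  rw [eq_top_iff]
  rintro a -
  have ha : a ∈ Algebra.adjoin ℚ {a | ∃ S, PF M S ∧ a = x M S} := by
    rw [adjoin_x]; trivial
  suffices h : ∀ b ∈ P, a * b ∈ P by simpa using h 1 h1
  induction ha using Algebra.adjoin_induction with
  | mem a ha =>
    obtain ⟨S, -, rfl⟩ := ha
    exact hA S
  | algebraMap c =>
    intro b hb
    rw [← (theta M i).commutes]
    exact hθm _ b hb
  | add a b _ _ ha hb => exact fun c hc => by rw [add_mul]; exact add_mem (ha c hc) (hb c hc)
  | mul a b _ _ ha hb => exact fun c hc => by rw [mul_assoc]; exact ha _ (hb c hc)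

end Span

/-! ### The summand of a flat in `𝒮_i` -/

section AnnQuot

variable (M : Matroid α) (K : Set α)

/-- The quotient of the Chow ring by the annihilator of `x_K`. -/
abbrev AnnQuot : Type u := CH M ⧸ Ideal.torsionOf (CH M) (CH M) (x M K)

/-- The quotient map to `AnnQuot`. -/
noncomputable def toAnnQuot : CH M →ₐ[ℚ] AnnQuot M K := Ideal.Quotient.mkₐ ℚ _

/-- Multiplication by `x_K` on `AnnQuot`. -/
noncomputable def mulX : AnnQuot M K →ₗ[CH M] CH M :=
  Submodule.liftQ _ (LinearMap.toSpanSingleton (CH M) (CH M) (x M K)) le_rfl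

theorem mulX_toAnnQuot (a : CH M) : mulX M K (toAnnQuot M K a) = a * x M K := rfl

/-- The ideal of `x_K` is thus a copy of a quotient ring: homomorphisms into the ring are
constructed by `liftCH`, and identities are checked after multiplication by `x_K`. -/
theorem mulX_injective : Function.Injective (mulX M K) := by
  rw [← LinearMap.ker_eq_bot]
  exact Submodule.ker_liftQ_eq_bot _ _ _ le_rfl

theorem toAnnQuot_surjective : Function.Surjective (toAnnQuot M K) :=
  Ideal.Quotient.mkₐ_surjective ℚ _

theorem mulX_mul (a : CH M) (q : AnnQuot M K) :
    mulX M K (toAnnQuot M K a * q) = a * mulX M K q := by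
  obtain ⟨b, rfl⟩ := toAnnQuot_surjective M K q
  rw [← map_mul, mulX_toAnnQuot, mulX_toAnnQuot, mul_assoc]

end AnnQuot

section FinsumPFlat

variable (M : Matroid α) [M.Finite]

open Classical in
theorem finsum_pflat {A : Type*} [AddCommMonoid A] (p : Set α → Prop) (f : Set α → A) :
    ∑ᶠ (G : PFlat M) (_ : p G.1), f G.1 = ∑ S ∈ subs M with PF M S ∧ p S, f S := by
  have := finite_pflat M
  have : Fintype (PFlat M) := Fintype.ofFinite _
  have e1 : ∑ᶠ (G : PFlat M) (_ : p G.1), f G.1 = ∑ F : PFlat M with p F.1, f F.1 := by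
    rw [finsum_eq_sum_of_fintype, Finset.sum_filter]
    refine Finset.sum_congr rfl fun F _ => ?_
    by_cases h : p F.1 <;> simp [h]
  rw [e1]
  refine Finset.sum_bij (fun F _ => F.1) ?_ ?_ ?_ ?_
  · intro F hF
    simp only [Finset.mem_filter, Finset.mem_univ, true_and] at hF
    exact Finset.mem_filter.2 ⟨(mem_subs M).2 F.2.1.subset_ground, F.2, hF⟩
  · intro F _ G _ h
    exact Subtype.ext h
  · intro S hS
    rw [Finset.mem_filter] at hS
    exact ⟨⟨S, hS.2.1⟩, by simpa using hS.2.2, rfl⟩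
  · intro F _
    rfl

open Classical in
theorem alphaAt_eq (j : α) : alphaAt M j = ∑ S ∈ subs M with PF M S ∧ j ∈ S, x M S :=
  finsum_pflat M (fun S => j ∈ S) (x M)

open Classical in
theorem betaAt_eq (j : α) : betaAt M j = ∑ S ∈ subs M with PF M S ∧ j ∉ S, x M S := by
  rw [betaAt]
  convert finsum_pflat M (fun S => j ∉ S) (x M)

end FinsumPFlat

theorem finite_restrict {M : Matroid α} [M.Finite] {F : Set α} (hF : F ⊆ M.E) :
    (M ↾ F).Finite :=
  ⟨M.ground_finite.subset hF⟩

section Summand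

variable {M : Matroid α} [M.Finite] {i : α} {F : Set α}

open Classical in
theorem sum_contract (hF : F ∈ Si M i) (p q : Set α → Prop)
    (hpq : ∀ S ⊆ M.E \ insert i F, (p S ↔ q (S ∪ F))) :
    ∑ S ∈ subs (M ／ insert i F) with PF (M ／ insert i F) S ∧ p S,
      x M (S ∪ insert i F) * x M (insert i F) =
    ∑ T ∈ subs (M ＼ {i}) with F ⊂ T ∧ q T, x M (insert i T) * x M (insert i F) := by
  have hKE : insert i F ⊆ M.E := hF.2.2.2.subset_ground
  refine Finset.sum_of_injOn (· ∪ F) ?_ ?_ ?_ ?_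
  · intro S hS T hT h
    simp only [Finset.coe_filter, Set.mem_ofPred_eq] at hS hT
    have h1 := ((pf_contract_iff hKE).1 hS.2.1).2.1
    have h2 := ((pf_contract_iff hKE).1 hT.2.1).2.1
    have h3 := congrArg (· \ F) h
    simp only [Set.union_sdiff_right] at h3
    rwa [(h1.mono_right (Set.subset_insert _ _)).sdiff_eq_left,
      (h2.mono_right (Set.subset_insert _ _)).sdiff_eq_left] at h3
  · intro S hS
    simp only [Finset.coe_filter, Set.mem_ofPred_eq, mem_subs] at hS ⊢
    obtain ⟨h1, h2, h3⟩ := (pf_contract_iff hKE).1 hS.2.1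
    have hSE : S ⊆ M.E \ insert i F := hS.1
    refine ⟨Set.union_subset (fun a ha => ⟨(hSE ha).1, fun h => (hSE ha).2 (Or.inl h)⟩)
      (Si.subset hF), ?_, (hpq S hSE).1 hS.2.2⟩
    refine Set.subset_union_right.ssubset_of_ne fun h => ?_
    obtain ⟨a, ha⟩ := h3
    have : a ∈ F := h ▸ Or.inl ha
    exact (hSE ha).2 (Or.inr this)
  · intro T hT hn
    rw [Finset.mem_filter, mem_subs] at hT
    rw [x_of_not M fun hPF => hn ?_, zero_mul]
    have hiT : i ∉ T := fun h => (hT.1 h).2 rfl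
    have hu : T \ F ∪ insert i F = insert i T := by
      rw [Set.union_insert, Set.sdiff_union_of_subset hT.2.1.subset]
    have hd : Disjoint (T \ F) (insert i F) := by
      rw [Set.disjoint_left]
      rintro a ⟨ha, haF⟩ (rfl | h)
      · exact hiT ha
      · exact haF h
    have hPF' : PF (M ／ insert i F) (T \ F) := (pf_contract_iff hKE).2
      ⟨hu ▸ hPF, hd, Set.nonempty_of_ssubset hT.2.1⟩
    have hSE : T \ F ⊆ M.E \ insert i F := hPF'.1.subset_ground
    refine ⟨T \ F, ?_, Set.sdiff_union_of_subset hT.2.1.subset⟩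
    rw [Finset.mem_coe, Finset.mem_filter]
    refine ⟨(mem_subs _).2 hSE, hPF', (hpq _ hSE).2 ?_⟩
    rw [Set.sdiff_union_of_subset hT.2.1.subset]
    exact hT.2.2
  · intro S _
    rw [Set.union_insert]

-- A set `T ⊂ F` that is not a flat contributes nothing: if `T ∪ i` were a flat, so would be `T`, by
-- `mem_Si_of_ssubset`.
open Classical in
theorem sum_restrict [(M ↾ F).Finite] (hF : F ∈ Si M i) (j : α) :
    ∑ S ∈ subs (M ↾ F) with PF (M ↾ F) S ∧ j ∈ S,
      (x M S + x M (insert i S)) * x M (insert i F) =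
    ∑ T ∈ subs (M ＼ {i}) with T ⊂ F ∧ j ∈ T,
      (x M T + x M (insert i T)) * x M (insert i F) := by
  refine Finset.sum_subset (fun S hS => ?_) fun T hT hn => ?_
  · rw [Finset.mem_filter, pf_restrict_iff (Si.pf hF)] at hS
    rw [Finset.mem_filter, mem_subs]
    exact ⟨hS.2.1.2.subset.trans (Si.subset hF), hS.2.1.2, hS.2.2⟩
  · rw [Finset.mem_filter, mem_subs] at hT
    have hnot : ¬ PF M T := fun h => hn <| Finset.mem_filter.2
      ⟨(mem_subs _).2 hT.2.1.subset, (pf_restrict_iff (Si.pf hF)).2 ⟨h, hT.2.1⟩, hT.2.2⟩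
    rw [x_of_not M hnot, x_of_not M fun h => hnot ?_, add_zero, zero_mul]
    exact Si.pf (mem_Si_of_ssubset M hF hT.2.1 ⟨j, hT.2.2⟩ h.1)

/-- The homomorphism `CH(M_{F ∪ i}) → CH(M) / Ann(x_{F ∪ i})`. -/
theorem exists_lambdaAbove (hi : i ∈ M.E) (hF : F ∈ Si M i) :
    ∃ φ : CH (M ／ insert i F) →ₐ[ℚ] AnnQuot M (insert i F), ∀ S, PF (M ／ insert i F) S →
      φ (x _ S) = toAnnQuot M (insert i F) (x M (S ∪ insert i F)) := by
  classical
  have hKE : insert i F ⊆ M.E := hF.2.2.2.subset_ground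
  refine ⟨liftCH (M ／ insert i F) (fun S => toAnnQuot M (insert i F) (x M (S ∪ insert i F)))
    ?_ ?_, fun S hS => liftCH_x _ _ _ _ hS⟩
  · intro S T hS hT h₁ h₂
    have hS' := ((pf_contract_iff hKE).1 hS).2.1
    have hT' := ((pf_contract_iff hKE).1 hT).2.1
    rw [← map_mul, x_mul_x, map_zero]
    · exact fun h => h₁ fun a ha => (h (Or.inl ha)).resolve_right (Set.disjoint_left.1 hS' ha)
    · exact fun h => h₂ fun a ha => (h (Or.inl ha)).resolve_right (Set.disjoint_left.1 hT' ha)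
  · intro j hj l hl
    apply mulX_injective
    -- Modulo the annihilator, the linear form of the contraction at `j` becomes that of `M`, which
    -- does not depend on `j`.
    have key : ∀ j ∈ M.E \ insert i F, mulX M (insert i F)
        (∑ S ∈ subs (M ／ insert i F) with PF (M ／ insert i F) S ∧ j ∈ S,
          toAnnQuot M (insert i F) (x M (S ∪ insert i F))) = linSum M j * x M (insert i F) := by
      intro j hj
      rw [map_sum, linSum_mul_of_notMem hF hi hj.2]
      simp_rw [mulX_toAnnQuot]
      refine sum_contract hF _ _ fun S hS => ?_
      exact ⟨Or.inl, fun h => h.resolve_right fun h => hj.2 (Or.inr h)⟩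
    rw [key j hj, key l hl, linSum_congr M hj.1 hl.1]

/-- The homomorphism `CH(M^F) → CH(M) / Ann(x_{F ∪ i})`. -/
theorem exists_lambdaBelow (hi : i ∈ M.E) (hF : F ∈ Si M i) :
    ∃ φ : CH (M ↾ F) →ₐ[ℚ] AnnQuot M (insert i F), ∀ S, PF (M ↾ F) S →
      φ (x _ S) = toAnnQuot M (insert i F) (x M S + x M (insert i S)) := by
  classical
  have := finite_restrict (Si.pf hF).1.subset_ground
  refine ⟨liftCH (M ↾ F) (fun S => toAnnQuot M (insert i F) (x M S + x M (insert i S)))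
    ?_ ?_, fun S hS => liftCH_x _ _ _ _ hS⟩
  · intro S T hS hT h₁ h₂
    have hiS : i ∉ S := fun h => Si.notMem hF (((pf_restrict_iff (Si.pf hF)).1 hS).2.subset h)
    have hiT : i ∉ T := fun h => Si.notMem hF (((pf_restrict_iff (Si.pf hF)).1 hT).2.subset h)
    have k₁ : ¬ S ⊆ insert i T := fun h => h₁ ((Set.subset_insert_iff_of_notMem hiS).1 h)
    have k₂ : ¬ T ⊆ insert i S := fun h => h₂ ((Set.subset_insert_iff_of_notMem hiT).1 h)
    have l₁ : ¬ insert i S ⊆ T := fun h => hiT (h (Set.mem_insert _ _))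
    have l₂ : ¬ insert i T ⊆ S := fun h => hiS (h (Set.mem_insert _ _))
    have m₁ : ¬ insert i S ⊆ insert i T := fun h => k₁ ((Set.subset_insert _ _).trans h)
    have m₂ : ¬ insert i T ⊆ insert i S := fun h => k₂ ((Set.subset_insert _ _).trans h)
    rw [← map_mul, add_mul, mul_add, mul_add, x_mul_x M h₁ h₂, x_mul_x M k₁ l₂, x_mul_x M l₁ k₂,
      x_mul_x M m₁ m₂]
    simp
  · intro j hj l hl
    apply mulX_injective
    have hj' : j ∈ F := hj
    have hl' : l ∈ F := hl
    rw [map_sum, map_sum]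
    simp_rw [mulX_toAnnQuot]
    rw [sum_restrict hF, sum_restrict hF]
    -- The expansions for `j` and `l` differ only in the flats strictly below `F`; the other two
    -- terms cancel.
    have h := congrArg (· * x M (insert i F)) (linSum_congr M ((Si.subset hF hj').1)
      ((Si.subset hF hl').1))
    simp only [linSum_mul_of_mem hF hi hj', linSum_mul_of_mem hF hi hl'] at h
    exact add_right_cancel (add_right_cancel h)

/-- `φ` and `ψ` are the two components of the homomorphism
`CH(M_{F ∪ i}) ⊗ CH(M^F) → CH(M) / Ann(x_{F ∪ i})`. -/
structure IsLambda (φ : CH (M ／ insert i F) →ₐ[ℚ] AnnQuot M (insert i F))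
    (ψ : CH (M ↾ F) →ₐ[ℚ] AnnQuot M (insert i F)) : Prop where
  above : ∀ S, PF (M ／ insert i F) S →
    φ (x _ S) = toAnnQuot M (insert i F) (x M (S ∪ insert i F))
  below : ∀ S, PF (M ↾ F) S →
    ψ (x _ S) = toAnnQuot M (insert i F) (x M S + x M (insert i S))

section Values

variable {φ : CH (M ／ insert i F) →ₐ[ℚ] AnnQuot M (insert i F)}
  {ψ : CH (M ↾ F) →ₐ[ℚ] AnnQuot M (insert i F)}

theorem toAnnQuot_theta_incomparable (hF : F ∈ Si M i) {G : Set α} (hG : PF (M ＼ {i}) G)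
    (h₁ : ¬ G ⊆ F) (h₂ : ¬ F ⊆ G) :
    toAnnQuot M (insert i F) (theta M i (x _ G)) = 0 := by
  have hiG : i ∉ G := fun h => (hG.1.subset_ground h).2 rfl
  apply mulX_injective
  rw [mulX_toAnnQuot, map_zero, theta_x_of_pf M hG, add_mul, x_mul_x_insert hiG h₁,
    x_insert_mul_x_insert hF hiG h₁ h₂, add_zero]

theorem toAnnQuot_theta_below (h : IsLambda φ ψ) (hF : F ∈ Si M i) {G : Set α}
    (hG : PF (M ＼ {i}) G) (hGF : G ⊂ F) :
    toAnnQuot M (insert i F) (theta M i (x _ G)) = ψ (x _ G) := by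
  -- The closure of `G` in `M` stays inside the flat `F`, so it cannot contain `i`.
  have hflat : M.IsFlat G := by
    rw [Matroid.isFlat_iff_closure_eq]
    refine ((isFlat_delete_iff hG.1.subset_ground).1 hG.1).resolve_right fun h1 => ?_
    have h2 : M.closure G ⊆ F := by
      rw [← (Si.pf hF).1.closure]
      exact M.closure_subset_closure hGF.subset
    exact Si.notMem hF (h2 (h1 ▸ Set.mem_insert _ _))
  have hPF : PF M G := ⟨hflat, hG.2.1, fun h1 =>
    hGF.2 (h1 ▸ (Si.pf hF).1.subset_ground)⟩
  rw [h.below G ((pf_restrict_iff (Si.pf hF)).2 ⟨hPF, hGF⟩), theta_x_of_pf M hG]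

theorem toAnnQuot_theta_above (h : IsLambda φ ψ) (hF : F ∈ Si M i) {G : Set α}
    (hG : PF (M ＼ {i}) G) (hGF : F ⊂ G) :
    toAnnQuot M (insert i F) (theta M i (x _ G)) = φ (x _ (G \ F)) := by
  have hGE : G ⊆ M.E \ {i} := hG.1.subset_ground
  have hiG : i ∉ G := fun h => (hGE h).2 rfl
  have hKE : insert i F ⊆ M.E := hF.2.2.2.subset_ground
  have hu : G \ F ∪ insert i F = insert i G := by
    rw [Set.union_insert, Set.sdiff_union_of_subset hGF.subset]
  have hd : Disjoint (G \ F) (insert i F) := by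
    rw [Set.disjoint_left]
    rintro a ⟨ha, haF⟩ (rfl | h)
    · exact hiG ha
    · exact haF h
  apply mulX_injective
  rw [mulX_toAnnQuot, theta_x_of_pf M hG, add_mul, x_mul_x_insert hiG hGF.2, zero_add]
  by_cases hPF : PF M (insert i G)
  · rw [h.above _ ((pf_contract_iff hKE).2 ⟨hu ▸ hPF, hd, Set.nonempty_of_ssubset hGF⟩), hu,
      mulX_toAnnQuot]
  · rw [x_of_not M hPF, zero_mul, x_of_not (M ／ insert i F) fun h1 => hPF ?_, map_zero, map_zero]
    rw [← hu]
    exact ((pf_contract_iff hKE).1 h1).1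

/-- Compare the linear forms of `j ∈ F` and `l ∉ F ∪ i` after multiplication by `x_{F ∪ i}`. The
flats above `F` that contain `l` cancel; what remains is `θ(x_F)`, the form `α` of `M^F` and the
form `β` of the contraction. -/
theorem toAnnQuot_theta_self (h : IsLambda φ ψ) (hi : i ∈ M.E) (hF : F ∈ Si M i) {j l : α}
    (hj : j ∈ F) (hl : l ∈ M.E \ insert i F) :
    toAnnQuot M (insert i F) (theta M i (x _ F)) =
      - ψ (alphaAt (M ↾ F) j) - φ (betaAt (M ／ insert i F) l) := by
  classical
  have := finite_restrict (Si.pf hF).1.subset_ground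
  have hα : mulX M (insert i F) (ψ (alphaAt (M ↾ F) j)) =
      ∑ T ∈ subs (M ＼ {i}) with T ⊂ F ∧ j ∈ T,
        (x M T + x M (insert i T)) * x M (insert i F) := by
    rw [alphaAt_eq, map_sum, map_sum, ← sum_restrict hF]
    refine Finset.sum_congr rfl fun S hS => ?_
    rw [h.below S (Finset.mem_filter.1 hS).2.1, mulX_toAnnQuot]
  have hβ : mulX M (insert i F) (φ (betaAt (M ／ insert i F) l)) =
      ∑ T ∈ subs (M ＼ {i}) with F ⊂ T ∧ l ∉ T, x M (insert i T) * x M (insert i F) := by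
    rw [betaAt_eq, map_sum, map_sum]
    have hc := sum_contract hF (fun S => l ∉ S) (fun T => l ∉ T) fun S _ => by
      rw [Set.mem_union, not_or]
      exact ⟨fun h1 => ⟨h1, fun h2 => hl.2 (Or.inr h2)⟩, And.left⟩
    refine (Finset.sum_congr rfl fun S hS => ?_).trans (by convert hc)
    rw [h.above S (Finset.mem_filter.1 hS).2.1, mulX_toAnnQuot]
  apply mulX_injective
  rw [map_sub, map_neg, hα, hβ, mulX_toAnnQuot, theta_x_of_pf M (Si.pf_delete hF)]
  have h1 := congrArg (· * x M (insert i F)) (linSum_congr M ((Si.subset hF hj).1) hl.1)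
  simp only [linSum_mul_of_mem hF hi hj, linSum_mul_of_notMem hF hi hl.2] at h1
  have h2 := Finset.sum_filter_add_sum_filter_not ((subs (M ＼ {i})).filter fun T => F ⊂ T)
    (fun T => l ∈ T) fun T => x M (insert i T) * x M (insert i F)
  rw [Finset.filter_filter, Finset.filter_filter] at h2
  rw [← h2] at h1
  linear_combination h1

end Values

end Summand

theorem mem_imTheta (M : Matroid α) [M.Finite] {i : α} {y : CH M} :
    y ∈ imTheta M i ↔ ∃ a, y = theta M i a :=
  ⟨fun ⟨a, ha⟩ => ⟨a, ha.symm⟩, fun ⟨a, ha⟩ => ⟨a, ha.symm⟩⟩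

theorem mem_xImTheta (M : Matroid α) [M.Finite] {i : α} {S : Set α} {y : CH M} :
    y ∈ xImTheta M i S ↔ ∃ a, y = x M S * theta M i a := by
  constructor
  · rintro ⟨_, ⟨a, rfl⟩, rfl⟩
    exact ⟨a, rfl⟩
  · rintro ⟨a, rfl⟩
    exact ⟨_, ⟨a, rfl⟩, rfl⟩

theorem theta_mem_gr (M : Matroid α) [M.Finite] {i : α} {k : ℕ} {a : CH (M ＼ {i})}
    (ha : a ∈ gr (M ＼ {i}) k) : theta M i a ∈ gr M k := by
  refine map_mem_of_mem_gr _ (theta M i) (gr M) (one_mem_gr M) (fun k a b h1 h2 => ?_)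
    (fun S hS => ?_) ha
  · rw [add_comm]
    exact mul_mem_gr M h1 h2
  · rw [theta_x_of_pf M hS]
    exact add_mem (x_mem_gr M _) (x_mem_gr M _)

theorem exists_shift {M : Matroid α} {V : Type*} [AddCommGroup V] (f : V →+ CH M)
    (s : ℕ) (c : ℕ →₀ V) : ∃ d : ℕ →₀ CH M, (∀ j, d (j + s) = f (c j)) ∧
      (∀ m, (∀ j, j + s ≠ m) → d m = 0) ∧ (d.sum fun _ b => b) = f (c.sum fun _ b => b) := by
  refine ⟨(c.mapRange f f.map_zero).embDomain (addRightEmbedding s), fun j => ?_,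
    fun m hm => Finsupp.embDomain_of_notMem_range _ _ _ fun ⟨j, hj⟩ => hm j hj, ?_⟩
  · have := Finsupp.embDomain_apply_self (addRightEmbedding s) (c.mapRange f f.map_zero) j
    simpa using this
  · rw [Finsupp.sum_embDomain, Finsupp.sum_mapRange_index fun _ => rfl, Finsupp.sum, Finsupp.sum,
      map_sum]

/-- An injective additive map that shifts degrees by `s` reflects homogeneity. -/
theorem sum_eq_component (M : Matroid α) [M.Finite] {V : Type*} [AddCommGroup V] {f : V →+ CH M}
    (hf : Function.Injective f) {s : ℕ} {c : ℕ →₀ V} (hc : ∀ j, f (c j) ∈ gr M (j + s)) {k : ℕ}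
    (h : f (c.sum fun _ b => b) ∈ gr M (k + s)) : (c.sum fun _ b => b) = c k := by
  obtain ⟨d, hd, hd0, hsum⟩ := exists_shift f s c
  have hz : ∀ j, j ≠ k → c j = 0 := fun j hj => by
    apply hf
    rw [← hd, map_zero]
    refine eq_zero_of_sum_mem_gr M (fun m => ?_) (hsum ▸ h) (by omega : j + s ≠ k + s)
    by_cases hm : ∃ j, j + s = m
    · obtain ⟨j, rfl⟩ := hm
      rw [hd]
      exact hc j
    · rw [hd0 m fun j hj => hm ⟨j, hj⟩]
      exact zero_mem _
  rw [Finsupp.sum, Finset.sum_eq_single k (fun j _ hj => hz j hj)]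
  exact Finsupp.notMem_support_iff.1

/-- Factors may be replaced under multiplication by an element that does not see the difference. -/
theorem mul_prod_congr {ι A : Type*} [CommRing A] {s : Finset ι} {a : A} {f g : ι → A}
    (h : ∀ S ∈ s, a * f S = a * g S) : a * ∏ S ∈ s, f S = a * ∏ S ∈ s, g S := by
  classical
  induction s using Finset.induction_on with
  | empty => rfl
  | insert S s hS ih =>
    have h1 := ih fun T hT => h T (Finset.mem_insert_of_mem hT)
    have h2 := h S (Finset.mem_insert_self _ _)
    rw [Finset.prod_insert hS, Finset.prod_insert hS]
    linear_combination f S * h1 + (∏ S ∈ s, g S) * h2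

theorem IsDeg.apply_xs {M : Matroid α} {D : CH M →ₗ[ℚ] ℚ} (hD : IsDeg M D)
    {s : Finset (Set α)} (hs : IsFlag M s) : D (xs M s) = if s.card = topDeg M then 1 else 0 := by
  split_ifs with h
  · exact hD.flag _ hs h
  · exact hD.eq_zero _ h _ (xs_mem_gr M s)

/-- The monomial divides that of a complete flag, whose degree is `1`. -/
theorem xs_ne_zero {M : Matroid α} [M.Finite] [M.Loopless] {s : Finset (Set α)}
    (hs : IsFlag M s) : xs M s ≠ 0 := by
  obtain ⟨t, hst, ht, hc⟩ := hs.exists_complete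
  obtain ⟨D, hD⟩ := exists_isDeg M
  intro h
  have h1 := hD.flag t ht hc
  rw [xs, ← Finset.prod_sdiff hst, ← xs, ← xs, h, mul_zero, map_zero] at h1
  exact zero_ne_one h1

theorem x_ne_zero {M : Matroid α} [M.Finite] [M.Loopless] {S : Set α} (hS : PF M S) :
    x M S ≠ 0 := by
  classical
  have h := xs_ne_zero (isFlag_insert.2 ⟨hS, isFlag_empty M, by simp⟩)
  simpa [xs] using h

section Summand

variable {M : Matroid α} [M.Finite] {i : α} {F : Set α}

/-- The two missing degrees are those of `x_F` and `x_{F ∪ i}`. After the shift by one, the summand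
therefore ends one degree below the top of `CH(M)`. -/
theorem topDeg_summand [M.Loopless] (hi : i ∈ M.E) (hF : F ∈ Si M i) :
    topDeg (M ／ insert i F) + topDeg (M ↾ F) + 2 = topDeg M := by
  have h1 := rk_contract (Si.pf_insert hF).1.subset_ground
  have h2 := rk_restrict (M := M) F
  have h3 : rk M (insert i F) = rk M F + 1 := rk_insert M hi (by
    rw [(Si.pf hF).1.closure]; exact Si.notMem hF)
  have h4 := (Si.pf hF).rk_mem
  have h5 := (Si.pf_insert hF).rk_mem
  rw [Finset.mem_Ico] at h4 h5
  simp only [topDeg]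
  omega

/-! ### Flags of `M` through `F` and `F ∪ i`. -/

section FlagLift

variable (i F) in
open Classical in
/-- The flag of `M` composed of a flag of `M_{F ∪ i}`, a flag of `M^F`, `F` and `F ∪ i`. -/
noncomputable def joinFlag (s t : Finset (Set α)) : Finset (Set α) :=
  insert F (insert (insert i F) (s.image (· ∪ insert i F) ∪ t))

variable {s t : Finset (Set α)}

theorem union_injOn_flag (hF : F ∈ Si M i) (hs : IsFlag (M ／ insert i F) s) :
    Set.InjOn (· ∪ insert i F) (s : Set (Set α)) := by
  intro S hS T hT h
  have h1 := ((pf_contract_iff (Si.pf_insert hF).1.subset_ground).1 (hs.pf S hS)).2.1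
  have h2 := ((pf_contract_iff (Si.pf_insert hF).1.subset_ground).1 (hs.pf T hT)).2.1
  have h3 := congrArg (· \ insert i F) h
  simpa only [Set.union_sdiff_right, h1.sdiff_eq_left, h2.sdiff_eq_left] using h3

theorem ssubset_of_mem_flag_restrict (hF : F ∈ Si M i) (ht : IsFlag (M ↾ F) t) {S : Set α}
    (hS : S ∈ t) : PF M S ∧ S ⊂ F :=
  (pf_restrict_iff (Si.pf hF)).1 (ht.pf S hS)

theorem ssubset_union_of_mem_flag_contract (hF : F ∈ Si M i) (hs : IsFlag (M ／ insert i F) s)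
    {S : Set α} (hS : S ∈ s) : PF M (S ∪ insert i F) ∧ insert i F ⊂ S ∪ insert i F := by
  obtain ⟨h1, h2, a, ha⟩ :=
    (pf_contract_iff (Si.pf_insert hF).1.subset_ground).1 (hs.pf S hS)
  exact ⟨h1, Set.subset_union_right, fun h => Set.disjoint_left.1 h2 ha (h (Or.inl ha))⟩

theorem isFlag_joinFlag (hF : F ∈ Si M i) (hs : IsFlag (M ／ insert i F) s)
    (ht : IsFlag (M ↾ F) t) : IsFlag M (joinFlag i F s t) := by
  classical
  have ht' := fun S hS => ssubset_of_mem_flag_restrict hF ht (S := S) hS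
  have hs' := fun S hS => ssubset_union_of_mem_flag_contract hF hs (S := S) hS
  have hFK : F ⊆ insert i F := Set.subset_insert _ _
  rw [joinFlag, isFlag_insert, isFlag_insert]
  refine ⟨Si.pf hF, ⟨Si.pf_insert hF, ⟨?_, ?_⟩, ?_⟩, ?_⟩
  · intro S hS
    rw [Finset.mem_union, Finset.mem_image] at hS
    obtain ⟨T, hT, rfl⟩ | hS := hS
    · exact (hs' T hT).1
    · exact (ht' S hS).1
  · intro S hS T hT
    rw [Finset.mem_union, Finset.mem_image] at hS hT
    obtain ⟨S, hS, rfl⟩ | hS := hS <;> obtain ⟨T, hT, rfl⟩ | hT := hT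
    · exact (hs.chain S hS T hT).imp (Set.union_subset_union_left _)
        (Set.union_subset_union_left _)
    · exact Or.inr ((ht' T hT).2.subset.trans (hFK.trans (hs' S hS).2.subset))
    · exact Or.inl ((ht' S hS).2.subset.trans (hFK.trans (hs' T hT).2.subset))
    · exact ht.chain S hS T hT
  · intro S hS
    rw [Finset.mem_union, Finset.mem_image] at hS
    obtain ⟨S, hS, rfl⟩ | hS := hS
    · exact Or.inr (hs' S hS).2.subset
    · exact Or.inl ((ht' S hS).2.subset.trans hFK)
  · intro S hS
    rw [Finset.mem_insert, Finset.mem_union, Finset.mem_image] at hS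
    obtain rfl | ⟨S, hS, rfl⟩ | hS := hS
    · exact Or.inr hFK
    · exact Or.inr (hFK.trans (hs' S hS).2.subset)
    · exact Or.inl (ht' S hS).2.subset

theorem prod_joinFlag (hF : F ∈ Si M i) (hs : IsFlag (M ／ insert i F) s)
    (ht : IsFlag (M ↾ F) t) {A : Type*} [CommMonoid A] (f : Set α → A) :
    ∏ S ∈ joinFlag i F s t, f S =
      f F * (f (insert i F) * ((∏ S ∈ s, f (S ∪ insert i F)) * ∏ S ∈ t, f S)) := by
  classical
  have ht' := fun S hS => ssubset_of_mem_flag_restrict hF ht (S := S) hS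
  have hs' := fun S hS => ssubset_union_of_mem_flag_contract hF hs (S := S) hS
  have hFK : F ⊆ insert i F := Set.subset_insert _ _
  have hiF := Si.notMem hF
  have hdis : Disjoint (s.image (· ∪ insert i F)) t := by
    rw [Finset.disjoint_left]
    intro S hS hS'
    obtain ⟨T, hT, rfl⟩ := Finset.mem_image.1 hS
    exact hiF ((ht' _ hS').2.subset (Or.inr (Set.mem_insert _ _)))
  rw [joinFlag, Finset.prod_insert, Finset.prod_insert, Finset.prod_union hdis,
    Finset.prod_image (union_injOn_flag hF hs)]
  · rw [Finset.mem_union, Finset.mem_image]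
    rintro (⟨T, hT, h⟩ | h)
    · exact (hs' T hT).2.ne h.symm
    · exact hiF ((ht' _ h).2.subset (Set.mem_insert _ _))
  · rw [Finset.mem_insert, Finset.mem_union, Finset.mem_image]
    rintro (h | ⟨T, hT, h⟩ | h)
    · exact hiF (h ▸ Set.mem_insert _ _)
    · exact hiF (h ▸ Or.inr (Set.mem_insert _ _))
    · exact (ht' _ h).2.ne rfl

theorem card_joinFlag (hF : F ∈ Si M i) (hs : IsFlag (M ／ insert i F) s)
    (ht : IsFlag (M ↾ F) t) : (joinFlag i F s t).card = s.card + t.card + 2 := by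
  have h := prod_joinFlag hF hs ht fun _ => Multiplicative.ofAdd 1
  simp only [Finset.prod_const, ← ofAdd_nsmul, ← ofAdd_add, smul_eq_mul, mul_one] at h
  -- The product of constant factors `ofAdd 1` counts the members.
  have h := Multiplicative.ofAdd.injective h
  omega

theorem x_mul_prod_restrict (hF : F ∈ Si M i) (ht : IsFlag (M ↾ F) t) :
    x M F * ∏ S ∈ t, (x M S + x M (insert i S)) = x M F * ∏ S ∈ t, x M S := by
  refine mul_prod_congr fun S hS => ?_
  rw [mul_add, x_mul_x M (T := insert i S), add_zero]
  · exact fun h => (ssubset_of_mem_flag_restrict hF ht hS).2.2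
      ((Set.subset_insert_iff_of_notMem (Si.notMem hF)).1 h)
  · exact fun h => Si.notMem hF (h (Set.mem_insert _ _))

end FlagLift

/-! ### The homomorphism from the tensor product: degree, injectivity, image. -/

section Lambda

variable {φ : CH (M ／ insert i F) →ₐ[ℚ] AnnQuot M (insert i F)}
  {ψ : CH (M ↾ F) →ₐ[ℚ] AnnQuot M (insert i F)}

/-- The degree of `x_F x_{F ∪ i} η` is the product degree of `η`. -/
theorem deg_lambda [M.Loopless] (h : IsLambda φ ψ) (hi : i ∈ M.E) (hF : F ∈ Si M i)
    {D : CH M →ₗ[ℚ] ℚ} (hD : IsDeg M D) {DN : CH (M ／ insert i F) →ₗ[ℚ] ℚ}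
    (hN : IsDeg (M ／ insert i F) DN) {DR : CH (M ↾ F) →ₗ[ℚ] ℚ} (hR : IsDeg (M ↾ F) DR)
    (t : CH (M ／ insert i F) ⊗[ℚ] CH (M ↾ F)) :
    D (x M F * mulX M (insert i F) (Algebra.TensorProduct.productMap φ ψ t)) =
      tensorDeg DN DR t := by
  have := finite_restrict (Si.pf hF).1.subset_ground
  have := loopless_restrict (M := M) (Si.pf hF).1.subset_ground
  have := loopless_contract (Si.pf_insert hF).1
  let L : CH (M ／ insert i F) ⊗[ℚ] CH (M ↾ F) →ₗ[ℚ] ℚ :=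
    D ∘ₗ LinearMap.mulLeft ℚ (x M F) ∘ₗ (mulX M (insert i F)).restrictScalars ℚ ∘ₗ
      (Algebra.TensorProduct.productMap φ ψ).toLinearMap
  have hL' : ∀ t, L t = D (x M F *
    mulX M (insert i F) (Algebra.TensorProduct.productMap φ ψ t)) := fun _ => rfl
  suffices hL : L = tensorDeg DN DR from LinearMap.congr_fun hL t
  ext a b
  change L (a ⊗ₜ b) = tensorDeg DN DR (a ⊗ₜ b)
  have ha : a ∈ Submodule.span ℚ {a | ∃ s, IsFlag (M ／ insert i F) s ∧ a = xs _ s} := by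
    rw [span_xs]; trivial
  have hb : b ∈ Submodule.span ℚ {a | ∃ s, IsFlag (M ↾ F) s ∧ a = xs _ s} := by
    rw [span_xs]; trivial
  induction ha using Submodule.span_induction with
  | zero => simp
  | add a a' _ _ h1 h2 => rw [TensorProduct.add_tmul, map_add, map_add, h1, h2]
  | smul r a _ h1 => rw [← TensorProduct.smul_tmul', map_smul, map_smul, h1]
  | mem a ha =>
  induction hb using Submodule.span_induction with
  | zero => simp
  | add a a' _ _ h1 h2 => rw [TensorProduct.tmul_add, map_add, map_add, h1, h2]
  | smul r a _ h1 => rw [TensorProduct.tmul_smul, map_smul, map_smul, h1]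
  | mem b hb =>
  obtain ⟨s, hs, rfl⟩ := ha
  obtain ⟨t, ht, rfl⟩ := hb
  have hφ : φ (xs _ s) = toAnnQuot M (insert i F) (∏ S ∈ s, x M (S ∪ insert i F)) := by
    rw [xs, map_prod, map_prod]
    exact Finset.prod_congr rfl fun S hS => h.above S (hs.pf S hS)
  have hψ : ψ (xs _ t) = toAnnQuot M (insert i F) (∏ S ∈ t, (x M S + x M (insert i S))) := by
    rw [xs, map_prod, map_prod]
    exact Finset.prod_congr rfl fun S hS => h.below S (ht.pf S hS)
  -- The factor `x_F` kills each `x_{S ∪ i}` with `S ⊂ F`, so a single monomial survives, that of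
  -- the joined flag.
  have key : L (xs _ s ⊗ₜ xs _ t) = D (xs M (joinFlag i F s t)) := by
    rw [hL', Algebra.TensorProduct.productMap_apply_tmul, hφ, hψ, ← map_mul, mulX_toAnnQuot, xs,
      prod_joinFlag hF hs ht]
    congr 1
    linear_combination (∏ S ∈ s, x M (S ∪ insert i F)) * x M (insert i F) *
      x_mul_prod_restrict hF ht
  rw [key, hD.apply_xs (isFlag_joinFlag hF hs ht), tensorDeg_tmul, hN.apply_xs hs, hR.apply_xs ht,
    card_joinFlag hF hs ht]
  -- Neither flag exceeds its top length, so the joined flag is complete exactly when both are.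
  have h1 := topDeg_summand hi hF
  have h2 := hs.card_le
  have h3 := ht.card_le
  split_ifs <;> first | omega | norm_num

/-- By `deg_lambda` the product pairing factors through the map, so an element of the kernel pairs
to zero with everything and vanishes by duality for the two minors. -/
theorem lambda_injective [M.Loopless] (h : IsLambda φ ψ) (hi : i ∈ M.E) (hF : F ∈ Si M i)
    (hN : Nondeg (M ／ insert i F)) (hR : Nondeg (M ↾ F)) :
    Function.Injective (Algebra.TensorProduct.productMap φ ψ) := by
  have := finite_restrict (Si.pf hF).1.subset_ground
  have := loopless_restrict (M := M) (Si.pf hF).1.subset_ground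
  have := loopless_contract (Si.pf_insert hF).1
  have := finite_CH (M ↾ F)
  obtain ⟨D, hD⟩ := exists_isDeg M
  obtain ⟨DN, hDN⟩ := exists_isDeg (M ／ insert i F)
  obtain ⟨DR, hDR⟩ := exists_isDeg (M ↾ F)
  rw [injective_iff_map_eq_zero]
  intro t ht
  refine tensorDeg_nondegenerate (hN DN hDN) (hR DR hDR) t fun u => ?_
  rw [← deg_lambda h hi hF hD hDN hDR, map_mul (Algebra.TensorProduct.productMap φ ψ), ht, zero_mul, map_zero, mul_zero, map_zero]

/-- Each generator of the two factors goes to the class of some `θ(x_G)`, and each `θ(x_G)` is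
covered. For `G = F` this is the formula of `toAnnQuot_theta_self`. -/
theorem lambda_range (h : IsLambda φ ψ) (hi : i ∈ M.E) (hF : F ∈ Si M i) :
    (Algebra.TensorProduct.productMap φ ψ).range =
      ((toAnnQuot M (insert i F)).comp (theta M i)).range := by
  have := finite_restrict (Si.pf hF).1.subset_ground
  obtain ⟨j, hj⟩ := (Si.pf hF).2.1
  obtain ⟨l, hlE, hl⟩ := Si.exists_notMem hF
  have hKE := (Si.pf_insert hF).1.subset_ground
  apply le_antisymm
  · rw [Algebra.TensorProduct.productMap_range]
    refine sup_le ?_ ?_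
    · rw [← Algebra.map_top, ← adjoin_x, AlgHom.map_adjoin, Algebra.adjoin_le_iff]
      rintro _ ⟨_, ⟨S, hS, rfl⟩, rfl⟩
      obtain ⟨h1, h2, h3⟩ := (pf_contract_iff hKE).1 hS
      have hd : Disjoint S F := h2.mono_right (Set.subset_insert _ _)
      have hiS : i ∉ S ∪ F := by
        rintro (h | h)
        · exact Set.disjoint_left.1 h2 h (Set.mem_insert _ _)
        · exact Si.notMem hF h
      have hPF : PF (M ＼ {i}) (S ∪ F) := by
        refine pf_delete_of_pf M (h3.mono Set.subset_union_left) h1 ?_ fun h => h1.2.2 ?_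
        · rw [Set.union_insert, Set.insert_sdiff_of_mem _ (Set.mem_singleton i), Set.sdiff_singleton_eq_self hiS]
        · rw [Set.union_insert, h, Set.insert_sdiff_singleton, Set.insert_eq_of_mem hi]
      refine ⟨x _ (S ∪ F), ?_⟩
      change toAnnQuot M (insert i F) (theta M i (x _ (S ∪ F))) = φ (x _ S)
      rw [toAnnQuot_theta_above h hF hPF, Set.union_sdiff_right, hd.sdiff_eq_left]
      refine Set.subset_union_right.ssubset_of_ne fun h => ?_
      obtain ⟨a, ha⟩ := h3
      exact Set.disjoint_left.1 hd ha (h ▸ Or.inl ha)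
    · rw [← Algebra.map_top, ← adjoin_x, AlgHom.map_adjoin, Algebra.adjoin_le_iff]
      rintro _ ⟨_, ⟨S, hS, rfl⟩, rfl⟩
      obtain ⟨h1, h2⟩ := (pf_restrict_iff (Si.pf hF)).1 hS
      refine ⟨x _ S, toAnnQuot_theta_below h hF ?_ h2⟩
      have hiS : i ∉ S := fun h => Si.notMem hF (h2.subset h)
      refine pf_delete_of_pf M h1.2.1 h1 (Set.sdiff_singleton_eq_self hiS).symm fun h => ?_
      exact h2.2 (h ▸ Si.subset hF)
  · rw [← Algebra.map_top, ← adjoin_x, AlgHom.map_adjoin, Algebra.adjoin_le_iff]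
    rintro _ ⟨_, ⟨G, hG, rfl⟩, rfl⟩
    change toAnnQuot M (insert i F) (theta M i (x _ G)) ∈ _
    by_cases h1 : G ⊆ F
    · obtain rfl | h2 := h1.eq_or_ssubset
      · rw [toAnnQuot_theta_self h hi hF hj ⟨hlE, hl⟩]
        exact ⟨- (1 ⊗ₜ[ℚ] alphaAt (M ↾ G) j) - betaAt (M ／ (insert i G)) l ⊗ₜ[ℚ] 1, by simp⟩
      · rw [toAnnQuot_theta_below h hF hG h2]
        exact ⟨1 ⊗ₜ x _ G, by simp⟩
    · by_cases h2 : F ⊆ G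
      · rw [toAnnQuot_theta_above h hF hG ⟨h2, h1⟩]
        exact ⟨x _ (G \ F) ⊗ₜ 1, by simp⟩
      · rw [toAnnQuot_theta_incomparable hF hG h1 h2]
        exact zero_mem _

theorem lambda_gr (h : IsLambda φ ψ) {k : ℕ}
    {t : CH (M ／ insert i F) ⊗[ℚ] CH (M ↾ F)} (ht : t ∈ grTensor (M ／ insert i F) (M ↾ F) k) :
    mulX M (insert i F) (Algebra.TensorProduct.productMap φ ψ t) ∈ gr M (k + 1) := by
  let 𝒢 : ℕ → Submodule ℚ (AnnQuot M (insert i F)) := fun k =>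
    (gr M k).map (toAnnQuot M (insert i F)).toLinearMap
  have h1 : 1 ∈ 𝒢 0 := ⟨1, one_mem_gr M, map_one (toAnnQuot M (insert i F))⟩
  have hmul : ∀ k a b, a ∈ 𝒢 1 → b ∈ 𝒢 k → a * b ∈ 𝒢 (k + 1) := by
    rintro k _ _ ⟨a, ha, rfl⟩ ⟨b, hb, rfl⟩
    exact ⟨a * b, add_comm 1 k ▸ mul_mem_gr M ha hb, map_mul (toAnnQuot M (insert i F)) _ _⟩
  rw [grTensor_eq_span] at ht
  induction ht using Submodule.span_induction with
  | zero => simp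
  | add a b _ _ h1 h2 =>
    rw [map_add, map_add]
    exact add_mem h1 h2
  | smul r a _ h1 =>
    rw [map_smul]
    exact (((mulX M (insert i F)).restrictScalars ℚ).map_smul r _) ▸ Submodule.smul_mem _ r h1
  | mem t ht =>
    obtain ⟨p, q, a, b, rfl, ha, hb, rfl⟩ := ht
    obtain ⟨c, hc, h2⟩ := map_mem_of_mem_gr _ φ 𝒢 h1 hmul
      (fun S hS => ⟨_, x_mem_gr M (S ∪ insert i F), (h.above S hS).symm⟩) ha
    obtain ⟨d, hd, h3⟩ := map_mem_of_mem_gr _ ψ 𝒢 h1 hmul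
      (fun S hS => ⟨_, add_mem (x_mem_gr M S) (x_mem_gr M (insert i S)),
        (h.below S hS).symm⟩) hb
    rw [Algebra.TensorProduct.productMap_apply_tmul, ← h2, ← h3]
    change mulX M (insert i F) (toAnnQuot M _ c * toAnnQuot M _ d) ∈ _
    rw [← map_mul, mulX_toAnnQuot]
    exact mul_mem_gr M (mul_mem_gr M hc hd) (x_mem_gr M _)

end Lambda

/-- The homomorphism `CH(M ∖ i) → CH(M_{F ∪ i}) ⊗ CH(M^F)` together with the isomorphism of its
target with `x_{F ∪ i} CH_(i)`. -/
theorem exists_rho [M.Loopless] (hi : i ∈ M.E) (hF : F ∈ Si M i) (hN : Nondeg (M ／ insert i F))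
    (hR : Nondeg (M ↾ F)) :
    ∃ (ρ : CH (M ＼ {i}) →ₐ[ℚ] CH (M ／ (insert i F)) ⊗[ℚ] CH (M ↾ F))
      (f : CH (M ／ (insert i F)) ⊗[ℚ] CH (M ↾ F) →+ CH M),
      IsRestriction M i F ρ ∧ Function.Surjective ρ ∧ Function.Injective f ∧
      (∀ a t, f (ρ a * t) = theta M i a * f t) ∧ f 1 = x M (insert i F) ∧
      (∀ k t, t ∈ grTensor (M ／ (insert i F)) (M ↾ F) k ↔ f t ∈ gr M (k + 1)) ∧
      ∀ D DN DR, IsDeg M D → IsDeg (M ／ insert i F) DN → IsDeg (M ↾ F) DR →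
        ∀ t, D (x M F * f t) = tensorDeg DN DR t := by
  obtain ⟨φ, hφ⟩ := exists_lambdaAbove hi hF
  obtain ⟨ψ, hψ⟩ := exists_lambdaBelow hi hF
  have h : IsLambda φ ψ := ⟨hφ, hψ⟩
  have hinj := lambda_injective h hi hF hN hR
  set l := Algebra.TensorProduct.productMap φ ψ with hl
  have hmem : ∀ a, toAnnQuot M (insert i F) (theta M i a) ∈ l.range := fun a => by
    rw [hl, lambda_range h hi hF]
    exact ⟨a, rfl⟩
  -- The tensor product embeds in the quotient with the same image as `θ`, so lifting `θ` through
  -- this embedding defines `ρ`.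
  let ρ : CH (M ＼ {i}) →ₐ[ℚ] CH (M ／ (insert i F)) ⊗[ℚ] CH (M ↾ F) :=
    (AlgEquiv.ofInjective l hinj).symm.toAlgHom.comp
      (((toAnnQuot M (insert i F)).comp (theta M i)).codRestrict l.range hmem)
  have hρ : ∀ a, l (ρ a) = toAnnQuot M (insert i F) (theta M i a) := fun a =>
    congrArg Subtype.val ((AlgEquiv.ofInjective l hinj).apply_symm_apply ⟨_, hmem a⟩)
  let f : CH (M ／ (insert i F)) ⊗[ℚ] CH (M ↾ F) →+ CH M :=
    (mulX M (insert i F)).toAddMonoidHom.comp l.toLinearMap.toAddMonoidHom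
  have hf : ∀ t, f t = mulX M (insert i F) (l t) := fun _ => rfl
  have hfinj : Function.Injective f := (mulX_injective M _).comp hinj
  refine ⟨ρ, f, ⟨?_, ?_, ?_, ?_⟩, ?_, hfinj, ?_, ?_, ?_, ?_⟩
  · intro G h1 h2
    apply hinj
    rw [hρ, toAnnQuot_theta_incomparable hF G.2 h1 h2, map_zero]
  · intro G h1
    apply hinj
    rw [hρ, toAnnQuot_theta_below h hF G.2 h1]
    simp [hl]
  · intro G h1
    apply hinj
    rw [hρ, toAnnQuot_theta_above h hF G.2 h1]
    simp [hl]
  · intro j hj m hm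
    apply hinj
    rw [hρ, toAnnQuot_theta_self h hi hF hj hm]
    simp [hl]
  · intro t
    have ht : l t ∈ l.range := ⟨t, rfl⟩
    rw [hl, lambda_range h hi hF] at ht
    obtain ⟨a, ha⟩ := ht
    exact ⟨a, hinj ((hρ a).trans ha)⟩
  · intro a t
    rw [hf, hf, map_mul, hρ, mulX_mul]
  · rw [hf, map_one, ← map_one (toAnnQuot M (insert i F)), mulX_toAnnQuot, one_mul]
  · intro k t
    refine ⟨fun ht => lambda_gr h ht, fun ht => ?_⟩
    obtain ⟨c, hc, rfl⟩ := exists_components_tensor _ _ t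
    rw [sum_eq_component M hfinj (fun j => lambda_gr h (hc j)) ht]
    exact hc k
  · intro D DN DR hD hDN hDR t
    exact deg_lambda h hi hF hD hDN hDR t

theorem isoTensor [M.Loopless] (hi : i ∈ M.E) (hF : F ∈ Si M i) (hN : Nondeg (M ／ insert i F))
    (hR : Nondeg (M ↾ F)) : IsoTensor M i F := by
  obtain ⟨ρ, f, hρ, hsurj, hinj, hmul, h1, hgr, -⟩ := exists_rho hi hF hN hR
  have hf : ∀ a, f (ρ a) = x M (insert i F) * theta M i a := fun a => by
    rw [← mul_one (ρ a), hmul, h1, mul_comm]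
  have hmem : ∀ t, f t ∈ xImTheta M i (insert i F) := fun t => by
    obtain ⟨a, rfl⟩ := hsurj t
    exact (mem_xImTheta M).2 ⟨a, hf a⟩
  let g : CH (M ／ (insert i F)) ⊗[ℚ] CH (M ↾ F) →+ xImTheta M i (insert i F) :=
    f.codRestrict _ hmem
  have hg : Function.Bijective g := by
    refine ⟨fun s t h => hinj (congrArg Subtype.val h), fun ⟨y, hy⟩ => ?_⟩
    obtain ⟨a, rfl⟩ := (mem_xImTheta M).1 hy
    exact ⟨ρ a, Subtype.ext (hf a)⟩
  exact ⟨ρ, hρ, AddEquiv.ofBijective g hg, fun a t => Subtype.ext (hmul a t), fun k t => hgr k t⟩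

/-- The top degree of `CH(M)` would correspond to a degree of the tensor product beyond its own top,
by `topDeg_summand`. All orthogonality with the summand of `F` rests on this. -/
theorem deg_x_insert_mul_theta [M.Loopless] (hi : i ∈ M.E) (hF : F ∈ Si M i)
    (hN : Nondeg (M ／ insert i F)) (hR : Nondeg (M ↾ F)) {D : CH M →ₗ[ℚ] ℚ} (hD : IsDeg M D)
    (a : CH (M ＼ {i})) : D (x M (insert i F) * theta M i a) = 0 := by
  have := finite_restrict (Si.pf hF).1.subset_ground
  have := loopless_restrict (M := M) (Si.pf hF).1.subset_ground
  have := loopless_contract (Si.pf_insert hF).1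
  obtain ⟨ρ, f, hρ, hsurj, hinj, hmul, h1, hgr, -⟩ := exists_rho hi hF hN hR
  have hf : ∀ a, f (ρ a) = x M (insert i F) * theta M i a := fun a => by
    rw [← mul_one (ρ a), hmul, h1, mul_comm]
  obtain ⟨c, hc, rfl⟩ := exists_components _ a
  rw [Finsupp.sum, map_sum, Finset.mul_sum, map_sum]
  refine Finset.sum_eq_zero fun k _ => ?_
  have hk : x M (insert i F) * theta M i (c k) ∈ gr M (k + 1) :=
    add_comm 1 k ▸ mul_mem_gr M (x_mem_gr M _) (theta_mem_gr M (hc k))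
  by_cases h : k + 1 = topDeg M
  · rw [← hf] at hk ⊢
    have h2 := topDeg_summand hi hF
    rw [eq_zero_of_mem_grTensor _ _ (by omega) ((hgr k _).2 hk), map_zero, map_zero]
  · exact hD.eq_zero _ h _ hk

/-- Write `x_{F ∪ i}² = θ(x_F) x_{F ∪ i} - x_F x_{F ∪ i}`. The first term contributes degree zero,
so the pairing on the summand is minus that of the tensor product. -/
theorem x_insert_mul_theta_eq_zero [M.Loopless] (hi : i ∈ M.E) (hF : F ∈ Si M i)
    (hN : Nondeg (M ／ insert i F)) (hR : Nondeg (M ↾ F)) {D : CH M →ₗ[ℚ] ℚ} (hD : IsDeg M D)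
    {a : CH (M ＼ {i})}
    (ha : ∀ b, D (x M (insert i F) * theta M i a * (x M (insert i F) * theta M i b)) = 0) :
    x M (insert i F) * theta M i a = 0 := by
  have := finite_restrict (Si.pf hF).1.subset_ground
  have := loopless_restrict (M := M) (Si.pf hF).1.subset_ground
  have := loopless_contract (Si.pf_insert hF).1
  have := finite_CH (M ↾ F)
  obtain ⟨ρ, f, hρ, hsurj, hinj, hmul, h1, hgr, hdeg⟩ := exists_rho hi hF hN hR
  have hf : ∀ a, f (ρ a) = x M (insert i F) * theta M i a := fun a => by
    rw [← mul_one (ρ a), hmul, h1, mul_comm]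
  obtain ⟨DN, hDN⟩ := exists_isDeg (M ／ insert i F)
  obtain ⟨DR, hDR⟩ := exists_isDeg (M ↾ F)
  suffices h : ρ a = 0 by rw [← hf, h, map_zero]
  refine tensorDeg_nondegenerate (hN DN hDN) (hR DR hDR) _ fun u => ?_
  obtain ⟨b, rfl⟩ := hsurj u
  rw [← hdeg D DN DR hD hDN hDR, ← map_mul, hf]
  have h2 := ha b
  have h3 := deg_x_insert_mul_theta hi hF hN hR hD (x _ F * (a * b))
  rw [map_mul (theta M i), theta_x_of_pf M (Si.pf_delete hF)] at h3
  have h4 : x M F * (x M (insert i F) * theta M i (a * b)) =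
      x M (insert i F) * ((x M F + x M (insert i F)) * theta M i (a * b)) -
      x M (insert i F) * theta M i a * (x M (insert i F) * theta M i b) := by
    rw [map_mul]
    ring
  rw [h4, map_sub, h2, h3, sub_zero]

end Summand

/-! ### Degree maps under deletion -/

section Deletion

variable {M : Matroid α} [M.Finite] [M.Loopless] {i : α}

/-- The summands of the flats in `𝒮_i` satisfy Poincaré duality. -/
def SummandNondeg (M : Matroid α) (i : α) : Prop :=
  ∀ F ∈ Si M i, Nondeg (M ／ insert i F) ∧ Nondeg (M ↾ F)

theorem closure_sdiff_of_pf_delete {S : Set α} (hS : PF (M ＼ {i}) S) :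
    M.closure S \ {i} = S := by
  have hiS : i ∉ S := fun h => (hS.1.subset_ground h).2 rfl
  have h := hS.1.closure
  rwa [Matroid.delete_closure_eq, Set.sdiff_singleton_eq_self hiS] at h

theorem pf_closure_of_pf_delete {S : Set α} (hS : PF (M ＼ {i}) S) : PF M (M.closure S) := by
  have hSE : S ⊆ M.E \ {i} := hS.1.subset_ground
  refine ⟨M.isFlat_closure S, hS.2.1.mono (M.subset_closure S (hSE.trans Set.sdiff_subset)),
    fun h => hS.2.2 ?_⟩
  rw [← closure_sdiff_of_pf_delete hS, h, Matroid.delete_ground]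

theorem isFlag_image_closure [DecidableEq (Set α)] {s : Finset (Set α)}
    (hs : IsFlag (M ＼ {i}) s) : IsFlag M (s.image M.closure) := by
  constructor
  · intro S hS
    obtain ⟨T, hT, rfl⟩ := Finset.mem_image.1 hS
    exact pf_closure_of_pf_delete (hs.pf T hT)
  · intro S hS T hT
    obtain ⟨S, hS', rfl⟩ := Finset.mem_image.1 hS
    obtain ⟨T, hT', rfl⟩ := Finset.mem_image.1 hT
    exact (hs.chain S hS' T hT').imp (fun h => M.closure_subset_closure h)
      fun h => M.closure_subset_closure h

theorem closure_injOn_flag {s : Finset (Set α)} (hs : IsFlag (M ＼ {i}) s) :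
    Set.InjOn M.closure (s : Set (Set α)) := by
  intro S hS T hT h
  rw [← closure_sdiff_of_pf_delete (hs.pf S hS), h, closure_sdiff_of_pf_delete (hs.pf T hT)]

/-- If the rank does not drop, the degree map of the deletion is induced by `θ_i`. -/
theorem isDeg_comp_theta (hi : i ∈ M.E) (hM : SummandNondeg M i)
    (htop : topDeg (M ＼ {i}) = topDeg M) {D : CH M →ₗ[ℚ] ℚ} (hD : IsDeg M D) :
    IsDeg (M ＼ {i}) (D ∘ₗ (theta M i).toLinearMap) := by
  classical
  refine ⟨fun k hk a ha => hD.eq_zero k (htop ▸ hk) _ (theta_mem_gr M ha), fun s hs hc => ?_⟩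
  change D (theta M i (xs _ s)) = 1
  have hval : ∀ S ∈ s, i ∈ M.closure S →
      x M S + x M (insert i S) = x M (M.closure S) := fun S hS hiS => by
    have hPF := hs.pf S hS
    have hiS' : i ∉ S := fun h => (hPF.1.subset_ground h).2 rfl
    have h1 := ((isFlat_delete_iff hPF.1.subset_ground).1 hPF.1).resolve_left
      fun h => hiS' (h ▸ hiS)
    rw [x_of_not M (S := S) fun h => hiS' ?_, zero_add, h1]
    rwa [h.1.closure] at hiS
  -- The closures in `M` form a complete flag. The rest of the proof shows that `θ(x_s)` has the
  -- degree of its monomial.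
  have hflag : D (∏ S ∈ s, x M (M.closure S)) = 1 := by
    rw [← Finset.prod_image (g := M.closure) (f := x M) (closure_injOn_flag hs)]
    refine hD.flag _ (isFlag_image_closure hs) ?_
    rw [Finset.card_image_of_injOn (closure_injOn_flag hs), hc, htop]
  have hθ : ∀ t ⊆ s, theta M i (xs _ t) = ∏ S ∈ t, (x M S + x M (insert i S)) := fun t ht => by
    rw [xs, map_prod]
    exact Finset.prod_congr rfl fun S hS => theta_x_of_pf M (hs.pf S (ht hS))
  by_cases hA : (s.filter fun S => i ∉ M.closure S).Nonempty
  -- `T` is the largest member whose closure avoids `i`. Its term `x_{T ∪ i}` contributes degree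
  -- zero, and the remaining `x_T` kills `x_{S ∪ i}` for every smaller member `S`.
  · obtain ⟨T, hT, hTmax⟩ := exists_top_of_chain _ hA fun S hS T hT =>
      hs.chain S (Finset.mem_filter.1 hS).1 T (Finset.mem_filter.1 hT).1
    obtain ⟨hTs, hiT⟩ := Finset.mem_filter.1 hT
    have hPF := hs.pf T hTs
    have hclT : M.closure T = T :=
      ((isFlat_delete_iff hPF.1.subset_ground).1 hPF.1).resolve_right
        fun h => hiT (h ▸ Set.mem_insert _ _)
    have hiT' : i ∉ T := hclT ▸ hiT
    have h0 : D (x M (insert i T) * theta M i (xs _ (s.erase T))) = 0 := by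
      by_cases hfl : M.IsFlat (insert i T)
      · have hTS : T ∈ Si M i := by
          refine ⟨hPF.2.1, ?_, Matroid.isFlat_iff_closure_eq.2 hclT, hfl⟩
          have h1 : T ⊆ M.E \ {i} := hPF.1.subset_ground
          exact h1.ssubset_of_ne hPF.2.2
        exact deg_x_insert_mul_theta hi hTS (hM T hTS).1 (hM T hTS).2 hD _
      · rw [x_of_not M fun h => hfl h.1, zero_mul, map_zero]
    rw [← hflag, ← Finset.mul_prod_erase s _ hTs, hclT]
    have h1 : theta M i (xs _ s) = (x M T + x M (insert i T)) *
        theta M i (xs _ (s.erase T)) := by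
      rw [hθ s subset_rfl, hθ _ (Finset.erase_subset _ _),
        Finset.mul_prod_erase s (fun S => x M S + x M (insert i S)) hTs]
    rw [h1, add_mul, map_add, h0, add_zero, hθ _ (Finset.erase_subset _ _)]
    refine congrArg D (mul_prod_congr fun S hS => ?_)
    obtain ⟨hST, hSs⟩ := Finset.mem_erase.1 hS
    by_cases hiS : i ∈ M.closure S
    · rw [hval S hSs hiS]
    · have hclS : M.closure S = S :=
        ((isFlat_delete_iff (hs.pf S hSs).1.subset_ground).1 (hs.pf S hSs).1).resolve_right
          fun h => hiS (h ▸ Set.mem_insert _ _)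
      rw [hclS, mul_add, x_mul_x M (T := insert i S), add_zero]
      · intro h
        exact hST ((hTmax S (Finset.mem_filter.2 ⟨hSs, hiS⟩)).antisymm
          ((Set.subset_insert_iff_of_notMem hiT').1 h))
      · exact fun h => hiT' (h (Set.mem_insert _ _))
  · rw [Finset.not_nonempty_iff_eq_empty, Finset.filter_eq_empty_iff] at hA
    rw [hθ s subset_rfl, ← hflag]
    exact congrArg D (Finset.prod_congr rfl fun S hS => hval S hS (not_not.1 (hA hS)))

theorem topDeg_delete_of_not_isColoop (h : ¬ M.IsColoop i) : topDeg (M ＼ {i}) = topDeg M := by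
  rw [topDeg, topDeg, rk_delete_of_not_isColoop h]

theorem delete_ground_nonempty (hi : i ∈ M.E) (hE : M.E ≠ {i}) : (M.E \ {i}).Nonempty := by
  rw [Set.nonempty_iff_ne_empty, Ne, Set.sdiff_eq_empty]
  exact fun h => hE (h.antisymm (Set.singleton_subset_iff.2 hi))

theorem topDeg_delete_of_isColoop (h : M.IsColoop i) (hE : M.E ≠ {i}) :
    topDeg (M ＼ {i}) + 1 = topDeg M := by
  have := loopless_delete (M := M) i
  have h1 := rk_delete_of_isColoop h
  have h2 := rk_pos (M ＼ {i}) subset_rfl (delete_ground_nonempty h.mem_ground hE)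
  rw [topDeg, topDeg]
  omega

/-- The rank does drop, but `topDeg` is truncated at `0`; so a single coloop is treated like a
non-coloop. -/
theorem topDeg_delete_of_ground_eq (hE : M.E = {i}) : topDeg (M ＼ {i}) = topDeg M := by
  have h1 : (M ＼ {i}).E = ∅ := by simp [hE]
  have h2 : rk M M.E ≤ 1 := by
    rw [← Nat.cast_le (α := ℕ∞), coe_rk, hE]
    simp
  rw [topDeg, topDeg, h1, rk_empty]
  omega

theorem pf_compl (h : M.IsColoop i) (hE : M.E ≠ {i}) : PF M (M.E \ {i}) := by
  refine ⟨?_, delete_ground_nonempty h.mem_ground hE, fun h1 => ?_⟩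
  · rw [Matroid.isFlat_iff_closure_eq]
    refine Set.Subset.antisymm (fun a ha => ⟨M.closure_subset_ground _ ha, ?_⟩)
      (M.subset_closure _ Set.sdiff_subset)
    rintro rfl
    exact h.notMem_closure_of_notMem (fun h => h.2 rfl) ha
  · exact (h1.symm.subset h.mem_ground).2 rfl

/-- Outside the coloop case with `E ≠ {i}` the second summand disappears, so one decomposition
covers all cases. -/
theorem x_compl_eq_zero (hi : i ∈ M.E) (h : ¬ (M.IsColoop i ∧ M.E ≠ {i})) :
    x M (M.E \ {i}) = 0 := by
  refine x_of_not M fun hPF => h ⟨?_, fun hE => ?_⟩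
  · rw [Matroid.isColoop_iff_sdiff_not_spanning, Matroid.spanning_iff_closure_eq,
      hPF.1.closure]
    exact hPF.2.2
  · have := hPF.2.1
    rw [hE, Set.sdiff_self] at this
    exact Set.not_nonempty_empty this

/-- For a coloop, the degree map of the deletion is induced by `a ↦ x_{E ∖ i} θ_i(a)`. -/
theorem isDeg_compl_mul_theta (h : M.IsColoop i) (hE : M.E ≠ {i}) {D : CH M →ₗ[ℚ] ℚ}
    (hD : IsDeg M D) :
    IsDeg (M ＼ {i}) (D ∘ₗ LinearMap.mulLeft ℚ (x M (M.E \ {i})) ∘ₗ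
      (theta M i).toLinearMap) := by
  classical
  have htop := topDeg_delete_of_isColoop h hE
  refine ⟨fun k hk a ha => hD.eq_zero (1 + k) (by omega) _
    (mul_mem_gr M (x_mem_gr M _) (theta_mem_gr M ha)), fun s hs hc => ?_⟩
  change D (x M (M.E \ {i}) * theta M i (xs _ s)) = 1
  have hSE : ∀ S ∈ s, S ⊆ M.E \ {i} := fun S hS => (hs.pf S hS).1.subset_ground
  have hcl : ∀ S ∈ s, M.closure S = S := fun S hS => by
    refine ((isFlat_delete_iff (hSE S hS)).1 (hs.pf S hS).1).resolve_right fun h1 => ?_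
    exact h.notMem_closure_of_notMem (fun h2 => (hSE S hS h2).2 rfl) (h1 ▸ Set.mem_insert _ _)
  have hflag : IsFlag M s := by
    have := isFlag_image_closure hs
    rwa [Finset.image_congr hcl, Finset.image_id'] at this
  have hnot : M.E \ {i} ∉ s := fun h1 => (hs.pf _ h1).2.2 rfl
  -- The factor `x_{E ∖ i}` kills every `x_{S ∪ i}`, and adding `E ∖ i` on top completes the flag in
  -- `M`.
  have h1 : x M (M.E \ {i}) * theta M i (xs _ s) = xs M (insert (M.E \ {i}) s) := by
    rw [xs, xs, Finset.prod_insert hnot, map_prod]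
    refine mul_prod_congr fun S hS => ?_
    rw [theta_x_of_pf M (hs.pf S hS), mul_add, x_mul_x M (T := insert i S), add_zero]
    · intro h2
      exact (hs.pf S hS).2.2 ((hSE S hS).antisymm
        ((Set.subset_insert_iff_of_notMem fun h3 => h3.2 rfl).1 h2))
    · exact fun h2 => (h2 (Set.mem_insert _ _)).2 rfl
  rw [h1]
  refine hD.flag _ (isFlag_insert.2 ⟨pf_compl h hE, hflag, fun S hS => Or.inl (hSE S hS)⟩) ?_
  rw [Finset.card_insert_of_notMem hnot, hc, htop]

/-- The Chow ring of the deletion ends one degree below that of `M`. -/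
theorem deg_theta_of_isColoop (h : M.IsColoop i) (hE : M.E ≠ {i}) {D : CH M →ₗ[ℚ] ℚ}
    (hD : IsDeg M D) (a : CH (M ＼ {i})) : D (theta M i a) = 0 := by
  have := loopless_delete (M := M) i
  have htop := topDeg_delete_of_isColoop h hE
  obtain ⟨c, hc, rfl⟩ := exists_components _ a
  rw [Finsupp.sum, map_sum, map_sum]
  refine Finset.sum_eq_zero fun k _ => ?_
  by_cases hk : k = topDeg M
  · rw [eq_zero_of_mem_gr _ (by omega) (hc k), map_zero, map_zero]
  · exact hD.eq_zero k hk _ (theta_mem_gr M (hc k))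

/-! ### The decomposition -/

theorem finite_Si (M : Matroid α) [M.Finite] (i : α) : Finite (Si M i) :=
  Set.Finite.to_subtype (M.ground_finite.finite_subsets.subset fun _ hF => hF.2.2.1.subset_ground)

/-- For `F ⊂ G` the product equals `θ(x_G) x_{F ∪ i}` up to the image of `θ`, so it falls into the
summand of `F`; for incomparable flats it is zero. -/
theorem deg_summand_mul_summand (hi : i ∈ M.E) (hM : SummandNondeg M i) {D : CH M →ₗ[ℚ] ℚ}
    (hD : IsDeg M D) {F G : Set α} (hF : F ∈ Si M i) (hG : G ∈ Si M i) (hFG : F ≠ G)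
    (a b : CH (M ＼ {i})) :
    D (x M (insert i F) * theta M i a * (x M (insert i G) * theta M i b)) = 0 := by
  by_cases h1 : F ⊆ G
  · have h : x M (insert i F) * theta M i a * (x M (insert i G) * theta M i b) =
        x M (insert i F) * theta M i (x _ G * a * b) := by
      rw [map_mul, map_mul]
      linear_combination theta M i a * theta M i b *
        x_insert_mul_of_ssubset hF (Si.subset hG) (h1.ssubset_of_ne hFG)
    rw [h]
    exact deg_x_insert_mul_theta hi hF (hM F hF).1 (hM F hF).2 hD _
  by_cases h2 : G ⊆ F
  · have h : x M (insert i F) * theta M i a * (x M (insert i G) * theta M i b) =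
        x M (insert i G) * theta M i (x _ F * a * b) := by
      rw [map_mul, map_mul]
      linear_combination theta M i a * theta M i b *
        x_insert_mul_of_ssubset hG (Si.subset hF) (h2.ssubset_of_ne hFG.symm)
    rw [h]
    exact deg_x_insert_mul_theta hi hG (hM G hG).1 (hM G hG).2 hD _
  · have h : x M (insert i F) * theta M i a * (x M (insert i G) * theta M i b) = 0 := by
      linear_combination theta M i a * theta M i b *
        x_insert_mul_x_insert hG (Si.notMem hF) h1 h2
    rw [h, map_zero]

/-- The components of an element that pairs to zero with everything vanish. -/
theorem components_eq_zero [Fintype (Si M i)] (hi : i ∈ M.E) (hM : SummandNondeg M i)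
    (hdel : Nondeg (M ＼ {i})) {D : CH M →ₗ[ℚ] ℚ} (hD : IsDeg M D) {a b : CH (M ＼ {i})}
    {c : Si M i → CH (M ＼ {i})}
    (h : ∀ z, D ((theta M i a + x M (M.E \ {i}) * theta M i b +
      ∑ F, x M (insert i F.1) * theta M i (c F)) * z) = 0) :
    a = 0 ∧ (M.IsColoop i → M.E ≠ {i} → b = 0) ∧ x M (M.E \ {i}) * theta M i b = 0 ∧
      ∀ F, x M (insert i F.1) * theta M i (c F) = 0 := by
  classical
  -- Pairing with the summand of `F` leaves only its own component, on which the pairing is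
  -- nondegenerate.
  have hc : ∀ F, x M (insert i F.1) * theta M i (c F) = 0 := fun F => by
    refine x_insert_mul_theta_eq_zero hi F.2 (hM F F.2).1 (hM F F.2).2 hD fun d => ?_
    have h1 := h (x M (insert i F.1) * theta M i d)
    rw [add_mul, add_mul, map_add, map_add, Finset.sum_mul, map_sum,
      Finset.sum_eq_single F (fun G _ hG => deg_summand_mul_summand hi hM hD G.2 F.2
        (fun h => hG (Subtype.ext h)) _ _) (fun h => absurd (Finset.mem_univ F) h)] at h1
    have h2 : theta M i a * (x M (insert i F.1) * theta M i d) =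
        x M (insert i F.1) * theta M i (a * d) := by
      rw [map_mul]
      ring
    have h3 : x M (M.E \ {i}) * theta M i b * (x M (insert i F.1) * theta M i d) = 0 := by
      linear_combination theta M i b * theta M i d * x_compl_mul_x_insert M F.2
    rwa [h2, h3, deg_x_insert_mul_theta hi F.2 (hM F F.2).1 (hM F F.2).2 hD, map_zero, zero_add,
      zero_add] at h1
  simp only [hc, Finset.sum_const_zero, add_zero] at h
  by_cases hco : M.IsColoop i ∧ M.E ≠ {i}
  -- The pairing of the first two summands is triangular: pairing with `θ(d)` sees only `b`, and
  -- once `b = 0`, pairing with `x_{E ∖ i} θ(d)` tests `a`.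
  · have hD' := isDeg_compl_mul_theta hco.1 hco.2 hD
    have hb : b = 0 := by
      refine hdel _ hD' b fun d => ?_
      have h1 := h (theta M i d)
      rw [add_mul, map_add, ← map_mul, deg_theta_of_isColoop hco.1 hco.2 hD, zero_add,
        mul_assoc, ← map_mul] at h1
      exact h1
    subst hb
    refine ⟨?_, fun _ _ => rfl, by rw [map_zero, mul_zero], hc⟩
    refine hdel _ hD' a fun d => ?_
    have h1 := h (x M (M.E \ {i}) * theta M i d)
    rw [map_zero, mul_zero, add_zero, mul_left_comm, ← map_mul] at h1
    exact h1
  -- Only `CH_(i)` remains, and `D ∘ θ` is the degree map of the deletion, also for `E = {i}`.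
  · have hx := x_compl_eq_zero hi hco
    refine ⟨?_, fun h1 h2 => absurd ⟨h1, h2⟩ hco, by rw [hx, zero_mul], hc⟩
    have htop : topDeg (M ＼ {i}) = topDeg M := by
      by_cases h1 : M.IsColoop i
      · exact topDeg_delete_of_ground_eq (by_contra fun h2 => hco ⟨h1, h2⟩)
      · exact topDeg_delete_of_not_isColoop h1
    refine hdel _ (isDeg_comp_theta hi hM htop hD) a fun d => ?_
    have h1 := h (theta M i d)
    rw [hx, zero_mul, add_zero, ← map_mul] at h1
    exact h1

theorem exists_decomposition [Fintype (Si M i)] (hi : i ∈ M.E) (y : CH M) :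
    ∃ (a b : CH (M ＼ {i})) (c : Si M i → CH (M ＼ {i})),
      y = theta M i a + x M (M.E \ {i}) * theta M i b +
        ∑ F, x M (insert i F.1) * theta M i (c F) := by
  classical
  have hy : y ∈ Submodule.span (CH (M ＼ {i}))
      ({1, x M (M.E \ {i})} ∪ {a | ∃ F ∈ Si M i, a = x M (insert i F)}) := by
    rw [span_generators M hi]
    trivial
  induction hy using Submodule.span_induction with
  | zero => exact ⟨0, 0, 0, by simp⟩
  | add y z _ _ h1 h2 =>
    obtain ⟨a, b, c, rfl⟩ := h1
    obtain ⟨a', b', c', rfl⟩ := h2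
    refine ⟨a + a', b + b', c + c', ?_⟩
    simp only [map_add, Pi.add_apply, mul_add, Finset.sum_add_distrib]
    ring
  | smul r y _ h1 =>
    obtain ⟨a, b, c, rfl⟩ := h1
    refine ⟨r * a, r * b, fun F => r * c F, ?_⟩
    rw [smul_eq_theta_mul]
    simp only [map_mul, mul_add, Finset.mul_sum]
    refine congrArg₂ _ (by ring) (Finset.sum_congr rfl fun F _ => by ring)
  | mem y hy =>
    obtain (rfl | rfl) | ⟨F, hF, rfl⟩ := hy
    · exact ⟨1, 0, 0, by simp⟩
    · exact ⟨0, 1, 0, by simp⟩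
    · refine ⟨0, 0, Pi.single ⟨F, hF⟩ 1, ?_⟩
      rw [Finset.sum_eq_single ⟨F, hF⟩]
      · simp
      · intro G _ hG
        rw [Pi.single_eq_of_ne hG, map_zero, mul_zero]
      · exact fun h => absurd (Finset.mem_univ _) h

end Deletion

/-! ### Poincaré duality -/

theorem nondeg_of_ground_eq_empty {M : Matroid α} [M.Finite] (hE : M.E = ∅) : Nondeg M := by
  have hflag : ∀ s, IsFlag M s → s = ∅ := fun s hs => by
    refine Finset.eq_empty_of_forall_notMem fun S hS => ?_
    have h1 := (hs.pf S hS).1.subset_ground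
    rw [hE, Set.subset_empty_iff] at h1
    exact (hs.pf S hS).2.1.ne_empty h1
  intro D hD a ha
  have hmem : a ∈ Submodule.span ℚ {(1 : CH M)} := by
    have h1 : a ∈ (⊤ : Submodule ℚ (CH M)) := trivial
    rw [← span_xs] at h1
    refine Submodule.span_mono ?_ h1
    rintro _ ⟨s, hs, rfl⟩
    rw [hflag s hs]
    exact Finset.prod_empty
  obtain ⟨c, rfl⟩ := Submodule.mem_span_singleton.1 hmem
  have h1 : D 1 = 1 := by
    refine hD.flag ∅ (isFlag_empty M) ?_
    rw [topDeg, hE, rk_empty, Finset.card_empty]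
  have h2 := ha 1
  rw [mul_one, map_smul, h1, smul_eq_mul, mul_one] at h2
  rw [h2, zero_smul]

/-- The Chow ring of a matroid satisfies Poincaré duality. -/
theorem nondeg (M : Matroid α) [M.Finite] [M.Loopless] : Nondeg M := by
  -- The decomposition of `M` uses duality only for the deletion and for the two minors of each `F`,
  -- all on smaller ground sets.
  obtain ⟨n, hn⟩ : ∃ n, M.E.ncard = n := ⟨_, rfl⟩
  induction n using Nat.strong_induction_on generalizing M with
  | _ n ih =>
  subst hn
  obtain hE | ⟨i, hi⟩ := M.E.eq_empty_or_nonempty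
  · exact nondeg_of_ground_eq_empty hE
  have hlt : ∀ N : Matroid α, N.E ⊂ M.E → N.E.ncard < M.E.ncard := fun N h =>
    Set.ncard_lt_ncard h M.ground_finite
  have := loopless_delete (M := M) i
  have := finite_Si M i
  have : Fintype (Si M i) := Fintype.ofFinite _
  have hdel : Nondeg (M ＼ {i}) := by
    refine ih _ (hlt _ ?_) _ rfl
    exact Set.sdiff_subset.ssubset_of_ne fun h => (h.symm.subset hi).2 rfl
  have hM : SummandNondeg M i := by
    intro F hF
    have := finite_restrict (Si.pf hF).1.subset_ground
    have := loopless_restrict (M := M) (Si.pf hF).1.subset_ground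
    have := loopless_contract (Si.pf_insert hF).1
    refine ⟨ih _ (hlt _ ?_) _ rfl, ih _ (hlt _ ?_) _ rfl⟩
    · exact Set.sdiff_subset.ssubset_of_ne fun h => (h.symm.subset hi).2 (Set.mem_insert _ _)
    · exact (Si.pf hF).1.subset_ground.ssubset_of_ne (Si.pf hF).2.2
  intro D hD y hy
  obtain ⟨a, b, c, rfl⟩ := exists_decomposition hi y
  obtain ⟨rfl, -, h2, h3⟩ := components_eq_zero hi hM hdel hD hy
  simp [h2, h3]

theorem summandNondeg (M : Matroid α) [M.Finite] [M.Loopless] (i : α) : SummandNondeg M i := by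
  intro F hF
  have := finite_restrict (Si.pf hF).1.subset_ground
  have := loopless_restrict (M := M) (Si.pf hF).1.subset_ground
  have := loopless_contract (Si.pf_insert hF).1
  exact ⟨nondeg _, nondeg _⟩

/-! ### Properties of the summands -/

theorem isDirectSum_of_fintype {R V ι : Type*} [CommRing R] [AddCommGroup V] [Module R V]
    [Fintype ι] {N : ι → Submodule R V}
    (hind : ∀ v : ι → V, (∀ s, v s ∈ N s) → ∑ s, v s = 0 → ∀ s, v s = 0)
    (hspan : ∀ y, ∃ v : ι → V, (∀ s, v s ∈ N s) ∧ y = ∑ s, v s) : IsDirectSum N := by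
  classical
  refine (DirectSum.isInternal_submodule_iff_iSupIndep_and_iSup_eq_top N).2 ⟨?_, ?_⟩
  · rw [iSupIndep_iff_finsetSum_eq_zero_imp_eq_zero]
    intro s v hv h0 j hj
    have h1 := hind (fun j => if j ∈ s then v j else 0) (fun j => ?_) ?_ j
    · simpa [hj] using h1
    · split_ifs with h
      · exact hv j h
      · exact zero_mem _
    · rwa [Finset.sum_ite_mem, Finset.univ_inter]
  · rw [eq_top_iff]
    intro y _
    obtain ⟨v, hv, rfl⟩ := hspan y
    exact sum_mem fun s _ => Submodule.mem_iSup_of_mem s (hv s)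

/-- A nonzero cyclic module over a ring all of whose elements are units or nilpotent is
indecomposable. -/
theorem isIndecomposable_span_singleton {R V : Type*} [CommRing R] [AddCommGroup V] [Module R V]
    (hR : ∀ r : R, IsUnit r ∨ IsNilpotent r) {g : V} (hg : g ≠ 0) :
    IsIndecomposable (Submodule.span R {g}) := by
  refine ⟨by rwa [Ne, Submodule.span_singleton_eq_bot], fun A B hd hs => ?_⟩
  have key : ∀ {A B : Submodule R V}, Disjoint A B → A ⊔ B = Submodule.span R {g} →
      ∀ {r : R}, IsUnit r → r • g ∈ A → B = ⊥ := by
    intro A B hd hs r hr hrA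
    have hgA : g ∈ A := by
      have h1 := A.smul_mem (↑hr.unit⁻¹ : R) hrA
      rwa [smul_smul, IsUnit.val_inv_mul, one_smul] at h1
    have hle : B ≤ A := by
      refine (le_sup_right.trans hs.le).trans ?_
      rwa [Submodule.span_le, Set.singleton_subset_iff]
    exact disjoint_self.1 (hd.mono_left hle)
  have hgm : g ∈ A ⊔ B := hs ▸ Submodule.mem_span_singleton_self g
  obtain ⟨a, ha, b, hb, hab⟩ := Submodule.mem_sup.1 hgm
  have ham : a ∈ Submodule.span R {g} := hs ▸ Submodule.mem_sup_left ha
  obtain ⟨r, rfl⟩ := Submodule.mem_span_singleton.1 ham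
  -- The components of `g` are `r g` and `(1 - r) g`, and one of `r` and `1 - r` is a unit. The
  -- corresponding part then contains `g`, hence everything.
  obtain hr | hr := hR r
  · exact Or.inr (key hd hs hr ha)
  · have hb' : b = (1 - r) • g := by
      rw [sub_smul, one_smul]
      exact eq_sub_of_add_eq' hab
    exact Or.inl (key hd.symm (sup_comm A B ▸ hs) hr.isUnit_one_sub (hb' ▸ hb))

theorem isUnit_or_isNilpotent (M : Matroid α) [M.Finite] [M.Loopless] (a : CH M) :
    IsUnit a ∨ IsNilpotent a := by
  obtain ⟨c, n, hn, rfl⟩ := exists_scalar_add_nilpotent M a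
  by_cases hc : c = 0
  · right
    rwa [hc, map_zero, zero_add]
  · left
    exact hn.isUnit_add_left_of_commute ((IsUnit.mk0 c hc).map _) (Commute.all _ _)

section Graded

variable {M : Matroid α} [M.Finite] {i : α}

theorem xImTheta_eq_span (S : Set α) :
    xImTheta M i S = Submodule.span (CH (M ＼ {i})) {x M S} := by
  ext y
  rw [mem_xImTheta, Submodule.mem_span_singleton]
  exact exists_congr fun a => by rw [smul_eq_theta_mul, mul_comm, eq_comm]

theorem imTheta_eq_span : imTheta M i = Submodule.span (CH (M ＼ {i})) {1} := by
  ext y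
  rw [mem_imTheta, Submodule.mem_span_singleton]
  exact exists_congr fun a => by rw [smul_eq_theta_mul, mul_one, eq_comm]

theorem isGradedSubmodule_span {g : CH M} {s : ℕ} (hg : g ∈ gr M s) :
    IsGradedSubmodule M i (Submodule.span (CH (M ＼ {i})) {g}) := by
  intro y hy
  obtain ⟨a, rfl⟩ := Submodule.mem_span_singleton.1 hy
  obtain ⟨c, hc, rfl⟩ := exists_components _ a
  obtain ⟨d, hd, hd0, hsum⟩ := exists_shift
    (LinearMap.toSpanSingleton (CH (M ＼ {i})) (CH M) g).toAddMonoidHom s c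
  refine ⟨d, fun m => ?_, hsum.symm⟩
  by_cases hm : ∃ j, j + s = m
  · obtain ⟨j, rfl⟩ := hm
    rw [hd]
    exact ⟨Submodule.smul_mem _ _ (Submodule.mem_span_singleton_self g),
      mul_mem_gr M (theta_mem_gr M (hc j)) hg⟩
  · rw [hd0 m fun j hj => hm ⟨j, hj⟩]
    exact ⟨zero_mem _, zero_mem _⟩

theorem isoDelete_span {g : CH M} {s : ℕ} (hg : g ∈ gr M s)
    (hinj : ∀ a, g * theta M i a = 0 → a = 0) :
    IsoDelete M i s (Submodule.span (CH (M ＼ {i})) {g}) := by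
  let f := LinearMap.toSpanSingleton (CH (M ＼ {i})) (CH M) g
  have hf : ∀ a, f a = theta M i a * g := fun _ => rfl
  have hfinj : Function.Injective f := (injective_iff_map_eq_zero f).2 fun a ha =>
    hinj a (by rw [mul_comm, ← hf, ha])
  have hgr : ∀ {k a}, a ∈ gr (M ＼ {i}) k → f a ∈ gr M (k + s) := fun ha =>
    mul_mem_gr M (theta_mem_gr M ha) hg
  refine ⟨(LinearEquiv.ofInjective f hfinj).trans
    (LinearEquiv.ofEq _ _ (LinearMap.range_toSpanSingleton g)), fun k a => ?_⟩
  change a ∈ gr (M ＼ {i}) k ↔ f a ∈ gr M (k + s)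
  refine ⟨hgr, fun ha => ?_⟩
  obtain ⟨c, hc, rfl⟩ := exists_components _ a
  rw [sum_eq_component M (f := f.toAddMonoidHom) hfinj (fun j => hgr (hc j)) ha]
  exact hc k

end Graded

/-! ### Directness, orthogonality and indecomposability of the summands. -/

section Summands

variable {M : Matroid α} [M.Finite] [M.Loopless] {i : α}

theorem isIndecomposable_span {g : CH M} (hg : g ≠ 0) :
    IsIndecomposable (Submodule.span (CH (M ＼ {i})) {g}) := by
  have := loopless_delete (M := M) i
  exact isIndecomposable_span_singleton (isUnit_or_isNilpotent (M ＼ {i})) hg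

theorem one_ne_zero_CH : (1 : CH M) ≠ 0 := by
  have h := xs_ne_zero (isFlag_empty M)
  rwa [xs, Finset.prod_empty] at h

/-- The sum of the summands is direct. -/
theorem components_eq_zero_of_sum_eq_zero [Fintype (Si M i)] (hi : i ∈ M.E)
    {a b : CH (M ＼ {i})} {c : Si M i → CH (M ＼ {i})}
    (h : theta M i a + x M (M.E \ {i}) * theta M i b +
      ∑ F, x M (insert i F.1) * theta M i (c F) = 0) :
    a = 0 ∧ (M.IsColoop i → M.E ≠ {i} → b = 0) ∧ x M (M.E \ {i}) * theta M i b = 0 ∧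
      ∀ F, x M (insert i F.1) * theta M i (c F) = 0 := by
  have := loopless_delete (M := M) i
  obtain ⟨D, hD⟩ := exists_isDeg M
  refine components_eq_zero hi (summandNondeg M i) (nondeg _) hD fun z => ?_
  rw [h, zero_mul, map_zero]

theorem theta_eq_zero (hi : i ∈ M.E) {a : CH (M ＼ {i})} (h : theta M i a = 0) : a = 0 := by
  have := finite_Si M i
  have : Fintype (Si M i) := Fintype.ofFinite _
  exact (components_eq_zero_of_sum_eq_zero (b := 0) (c := 0) hi (by simp [h])).1

theorem eq_zero_of_x_compl_mul_theta (hi : M.IsColoop i) (hE : M.E ≠ {i}) {a : CH (M ＼ {i})}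
    (h : x M (M.E \ {i}) * theta M i a = 0) : a = 0 := by
  have := finite_Si M i
  have : Fintype (Si M i) := Fintype.ofFinite _
  exact (components_eq_zero_of_sum_eq_zero (a := 0) (c := 0) hi.mem_ground
    (by simp [h])).2.1 hi hE

theorem isDirectSum_summandColoop (hi : i ∈ M.E) : IsDirectSum (summandColoop M i) := by
  have := finite_Si M i
  have : Fintype (Si M i) := Fintype.ofFinite _
  refine isDirectSum_of_fintype (fun v hv h0 => ?_) fun y => ?_
  · obtain ⟨a, ha⟩ := (mem_imTheta M).1 (hv none)
    obtain ⟨b, hb⟩ := (mem_xImTheta M).1 (hv (some none))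
    choose c hc using fun F => (mem_xImTheta M).1 (hv (some (some F)))
    rw [Fintype.sum_option, Fintype.sum_option, ha, hb, Finset.sum_congr rfl fun F _ => hc F,
      ← add_assoc] at h0
    obtain ⟨rfl, -, h2, h3⟩ := components_eq_zero_of_sum_eq_zero hi h0
    rintro (_ | _ | F)
    · rw [ha, map_zero]
    · rw [hb, h2]
    · rw [hc, h3]
  · obtain ⟨a, b, c, rfl⟩ := exists_decomposition hi y
    refine ⟨fun
      | none => theta M i a
      | some none => x M (M.E \ {i}) * theta M i b
      | some (some F) => x M (insert i F.1) * theta M i (c F), ?_, ?_⟩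
    · rintro (_ | _ | F)
      · exact (mem_imTheta M).2 ⟨a, rfl⟩
      · exact (mem_xImTheta M).2 ⟨b, rfl⟩
      · exact (mem_xImTheta M).2 ⟨c F, rfl⟩
    · rw [Fintype.sum_option, Fintype.sum_option, add_assoc]

theorem isDirectSum_summand (hi : i ∈ M.E) (h : ¬ M.IsColoop i) :
    IsDirectSum (summand M i) := by
  have := finite_Si M i
  have : Fintype (Si M i) := Fintype.ofFinite _
  have hx : x M (M.E \ {i}) = 0 := x_compl_eq_zero hi fun h1 => h h1.1
  refine isDirectSum_of_fintype (fun v hv h0 => ?_) fun y => ?_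
  · obtain ⟨a, ha⟩ := (mem_imTheta M).1 (hv none)
    choose c hc using fun F => (mem_xImTheta M).1 (hv (some F))
    rw [Fintype.sum_option, ha, Finset.sum_congr rfl fun F _ => hc F] at h0
    obtain ⟨rfl, -, -, h3⟩ := components_eq_zero_of_sum_eq_zero (b := 0) hi
      (by rwa [hx, zero_mul, add_zero])
    rintro (_ | F)
    · rw [ha, map_zero]
    · rw [hc, h3]
  · obtain ⟨a, b, c, rfl⟩ := exists_decomposition hi y
    refine ⟨fun
      | none => theta M i a
      | some F => x M (insert i F.1) * theta M i (c F), ?_, ?_⟩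
    · rintro (_ | F)
      · exact (mem_imTheta M).2 ⟨a, rfl⟩
      · exact (mem_xImTheta M).2 ⟨c F, rfl⟩
    · rw [Fintype.sum_option, hx, zero_mul, add_zero]

theorem IsOrtho.symm {D : CH M →ₗ[ℚ] ℚ} {N₁ N₂ : Submodule (CH (M ＼ {i})) (CH M)}
    (h : IsOrtho M i D N₁ N₂) : IsOrtho M i D N₂ N₁ := fun a ha b hb => by
  rw [mul_comm]
  exact h b hb a ha

variable {D : CH M →ₗ[ℚ] ℚ}

theorem isOrtho_imTheta_xImTheta (hi : i ∈ M.E) (hD : IsDeg M D) {F : Set α} (hF : F ∈ Si M i) :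
    IsOrtho M i D (imTheta M i) (xImTheta M i (insert i F)) := by
  intro y hy z hz
  obtain ⟨a, rfl⟩ := (mem_imTheta M).1 hy
  obtain ⟨b, rfl⟩ := (mem_xImTheta M).1 hz
  rw [mul_left_comm, ← map_mul]
  have hM := summandNondeg M i F hF
  exact deg_x_insert_mul_theta hi hF hM.1 hM.2 hD _

theorem isOrtho_compl_xImTheta {F : Set α} (hF : F ∈ Si M i) :
    IsOrtho M i D (xImTheta M i (M.E \ {i})) (xImTheta M i (insert i F)) := by
  intro y hy z hz
  obtain ⟨a, rfl⟩ := (mem_xImTheta M).1 hy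
  obtain ⟨b, rfl⟩ := (mem_xImTheta M).1 hz
  rw [mul_mul_mul_comm, x_compl_mul_x_insert M hF, zero_mul, map_zero]

theorem isOrtho_xImTheta_xImTheta (hi : i ∈ M.E) (hD : IsDeg M D) {F G : Set α}
    (hF : F ∈ Si M i) (hG : G ∈ Si M i) (hFG : F ≠ G) :
    IsOrtho M i D (xImTheta M i (insert i F)) (xImTheta M i (insert i G)) := by
  intro y hy z hz
  obtain ⟨a, rfl⟩ := (mem_xImTheta M).1 hy
  obtain ⟨b, rfl⟩ := (mem_xImTheta M).1 hz
  exact deg_summand_mul_summand hi (summandNondeg M i) hD hF hG hFG a b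

theorem isOrtho_summand (hi : i ∈ M.E) (hD : IsDeg M D) {s t : Option (Si M i)} (hst : s ≠ t) :
    IsOrtho M i D (summand M i s) (summand M i t) := by
  rcases s with _ | F <;> rcases t with _ | G
  · exact absurd rfl hst
  · exact isOrtho_imTheta_xImTheta hi hD G.2
  · exact (isOrtho_imTheta_xImTheta hi hD F.2).symm
  · exact isOrtho_xImTheta_xImTheta hi hD F.2 G.2 fun h => hst (congrArg some (Subtype.ext h))

theorem isOrtho_summandColoop (hi : i ∈ M.E) (hD : IsDeg M D) {s t : Option (Option (Si M i))}
    (hst : s ≠ t) (h₁ : ¬ (s = none ∧ t = some none)) (h₂ : ¬ (s = some none ∧ t = none)) :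
    IsOrtho M i D (summandColoop M i s) (summandColoop M i t) := by
  rcases s with _ | _ | F <;> rcases t with _ | _ | G
  · exact absurd rfl hst
  · exact absurd ⟨rfl, rfl⟩ h₁
  · exact isOrtho_imTheta_xImTheta hi hD G.2
  · exact absurd ⟨rfl, rfl⟩ h₂
  · exact absurd rfl hst
  · exact isOrtho_compl_xImTheta G.2
  · exact (isOrtho_imTheta_xImTheta hi hD F.2).symm
  · exact (isOrtho_compl_xImTheta F.2).symm
  · exact isOrtho_xImTheta_xImTheta hi hD F.2 G.2
      fun h => hst (congrArg (some ∘ some) (Subtype.ext h))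

/-- The witnesses are `1` and `x_{E ∖ i} θ(x_s)` for a complete flag `s` of the deletion. -/
theorem not_isOrtho_compl (h : M.IsColoop i) (hE : M.E ≠ {i}) (hD : IsDeg M D) :
    ¬ IsOrtho M i D (imTheta M i) (xImTheta M i (M.E \ {i})) := by
  have := loopless_delete (M := M) i
  intro ho
  obtain ⟨s, -, hs, hc⟩ := (isFlag_empty (M ＼ {i})).exists_complete
  have h1 : D (x M (M.E \ {i}) * theta M i (xs _ s)) = 1 :=
    (isDeg_compl_mul_theta h hE hD).flag s hs hc
  have h2 := ho 1 ((mem_imTheta M).2 ⟨1, (map_one _).symm⟩) _ ((mem_xImTheta M).2 ⟨xs _ s, rfl⟩)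
  rw [one_mul, h1] at h2
  exact one_ne_zero h2

end Summands

end MatroidChow

/-! ### Assembly of the theorem. -/

open MatroidChow in
theorem theorem1p1 {α : Type*} (M : Matroid α) [M.Finite] [M.Loopless] (i : α) (hi : i ∈ M.E) :
    (∃! deg : CH M →ₗ[ℚ] ℚ, IsDegreeMap M deg) ∧
    (¬ M.IsColoop i →
      IsDirectSum (summand M i) ∧
      (∀ s, IsGradedSubmodule M i (summand M i s) ∧ IsIndecomposable (summand M i s)) ∧
      (∀ deg, IsDegreeMap M deg →
        ∀ s t, s ≠ t → IsOrtho M i deg (summand M i s) (summand M i t))) ∧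
    (M.IsColoop i →
      IsDirectSum (summandColoop M i) ∧
      (∀ s, IsGradedSubmodule M i (summandColoop M i s) ∧
        (s ≠ some none ∨ M.E ≠ {i} → IsIndecomposable (summandColoop M i s))) ∧
      (∀ deg, IsDegreeMap M deg →
        (∀ s t, s ≠ t → ¬ (s = none ∧ t = some none) → ¬ (s = some none ∧ t = none) →
          IsOrtho M i deg (summandColoop M i s) (summandColoop M i t)) ∧
        (M.E ≠ {i} →
          ¬ IsOrtho M i deg (summandColoop M i none) (summandColoop M i (some none)))) ∧
      (M.E = {i} → summandColoop M i (some none) = ⊥) ∧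
      (M.E ≠ {i} → IsoDelete M i 1 (xImTheta M i (M.E \ {i})))) ∧
    IsoDelete M i 0 (imTheta M i) ∧
    (∀ F ∈ Si M i, IsoTensor M i F) := by
  have hiff := isDeg_iff_isDegreeMap M ⟨i, hi⟩
  refine ⟨?_, fun hco => ⟨isDirectSum_summand hi hco, ?_, ?_⟩, fun hco =>
    ⟨isDirectSum_summandColoop hi, ?_, ?_, fun hE => ?_, fun hE => ?_⟩, ?_, fun F hF => ?_⟩
  · obtain ⟨D, hD⟩ := exists_isDeg M
    exact ⟨D, (hiff D).1 hD, fun D' hD' => ((hiff D').2 hD').unique M hD⟩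
  · rintro (_ | F)
    · rw [summand, imTheta_eq_span]
      exact ⟨isGradedSubmodule_span (one_mem_gr M), isIndecomposable_span one_ne_zero_CH⟩
    · rw [summand, xImTheta_eq_span]
      exact ⟨isGradedSubmodule_span (x_mem_gr M _),
        isIndecomposable_span (x_ne_zero (Si.pf_insert F.2))⟩
  · exact fun D hD s t hst => isOrtho_summand hi ((hiff D).2 hD) hst
  · rintro (_ | _ | F)
    · rw [summandColoop, imTheta_eq_span]
      exact ⟨isGradedSubmodule_span (one_mem_gr M),
        fun _ => isIndecomposable_span one_ne_zero_CH⟩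
    · rw [summandColoop, xImTheta_eq_span]
      exact ⟨isGradedSubmodule_span (x_mem_gr M _), fun h => isIndecomposable_span
        (x_ne_zero (pf_compl hco (h.resolve_left fun h => h rfl)))⟩
    · rw [summandColoop, xImTheta_eq_span]
      exact ⟨isGradedSubmodule_span (x_mem_gr M _),
        fun _ => isIndecomposable_span (x_ne_zero (Si.pf_insert F.2))⟩
  · intro D hD
    have hD' := (hiff D).2 hD
    exact ⟨fun s t hst h₁ h₂ => isOrtho_summandColoop hi hD' hst h₁ h₂,
      fun hE => not_isOrtho_compl hco hE hD'⟩
  · rw [summandColoop, xImTheta_eq_span, x_compl_eq_zero hi fun h => h.2 hE,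
      Submodule.span_singleton_eq_bot]
  · rw [xImTheta_eq_span]
    exact isoDelete_span (x_mem_gr M _) fun a ha => eq_zero_of_x_compl_mul_theta hco hE ha
  · rw [imTheta_eq_span]
    exact isoDelete_span (one_mem_gr M) fun a ha => theta_eq_zero hi (by rwa [one_mul] at ha)
  · have hM := summandNondeg M i F hF
    exact isoTensor hi hF hM.1 hM.2
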